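/- **Setting.** Let $\mathscr A$ be an algebra of subsets of $\Omega$, $m$ a finitely additive probability on $\mathscr A$, $X$ a real Banach space and $f:\Omega\to X$ a function. Put $m^*(E)=\inf\{m(A):A\in\mathscr A,\ E\subset A\}$. A function $g:\Omega\to\mathbb R$ belongs to $L^1(m)$ if there are $\mathscr A$-simple functions $g_n$ with $m^*(|g_n-g|>c)\to0$ for all $c>0$ and $\int|g_n-g_k|\,dm\to0$ as $n,k\to\infty$; then $\int g\,dm=\lim_n\int g_n\,dm$. It is $m$-null on $A$ if $m^*(A\cap\{|g|>c\})=0$ for all $c>0$. Let $\mathscr A(m)$ be the set of those $E\subset\Omega$ such that for every $\varepsilon>0$ there are $A,B\in\mathscr A$ with $A\subset E\subset B$ and $m(B\setminus A)<\varepsilon$. We call $f$ norm integrable if $\|f\|\in L^1(m)$; weakly integrable if $x^*f\in L^1(m)$ for all $x^*\in X^*$; Pettis integrable if for every $A\in\mathscr A$ there is $x_A\in X$ with $x^*x_A=\int_A x^*f\,dm$ for all $x^*\in X^*$. Let $\Lambda(m,f)$ be the set of $H:\Omega\times X\to\mathbb R$ for which $H(f):=H(\cdot,f(\cdot))\in L^1(m)$,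 let $\Lambda_b(m,f)$ be the set of its bounded elements, and regard functions on $X$ as functions on $\Omega\times X$. An *abstract standard representation* $(\chi,\lambda,T)$ of $(m,f)$ consists of a regular countably additive Borel probability $\lambda$ on a compact Hausdorff space $S$, a Boolean homomorphism $\chi$ of $\mathscr A(m)$ into the clopen subsets of $S$, and a vector lattice homomorphism $T:\Lambda(m,f)\to L^1(\lambda)$ with $\|T(H)\|_{L^1(\lambda)}=\int|H(f)|\,dm$, such that $$\int_AH(f)\,dm=\int_{\chi(A)}T(H)\,d\lambda,\qquad A\in\mathscr A,\ H\in\Lambda(m,f),$$ and moreover: (a) $T$ restricts to an isomorphism of algebras of $\Lambda_b(m,f)$ onto $C(S)$ (that is, there is such an isomorphism $U$, with $T(H)=U(H)$ $\lambda$-a.e.); (b) continuous functions on $S$ are measurable for the $\sigma$-algebra generated by the clopen sets; (c) for each clopen $E\subset S$ there is $A\in\mathscr A(m)$ with $\lambda(E\bigtriangleup\chi(A))=0$; (d) $T[\Lambda(m,f)]$ is norm dense in $L^1(\lambda)$; (e) $T(\alpha(H_1,\dots,H_n))=\alpha(T(H_1),\dots,T(H_n))$ $\lambda$-a.e. for all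 $n$, all $H_i\in\Lambda(m,f)$ and all bounded continuous $\alpha:\mathbb R^n\to\mathbb R$; (f) for $A\in\mathscr A(m)$ and $H\in\Lambda(m,f)$, $H(f)$ is $m$-null on $A$ if and only if $T(H)=0$ $\lambda$-a.e. on $\chi(A)$; and the set of those $s\in\chi(A)$ at which $U(H)(s)=0$ for every $H\in\Lambda_b(m,f)$ with $H(f)$ $m$-null on $A$ has full $\lambda$-measure in $\chi(A)$. For a family $\mathscr H$ of functions on $X$ contained in $\Lambda(m,f)$ and $\tilde f:S\to X$, $(\chi,\lambda,\tilde f)$ is a *standard representation of $(m,f)$ relative to $\mathscr H$* if there is $T$ such that $(\chi,\lambda,T)$ is an abstract standard representation and $T(h)=h(\tilde f)$ $\lambda$-a.e. for all $h\in\mathscr H$. Let $\mathscr H_w=C_u(X,\mathrm{weak})\cap\Lambda(m,f)$, the functions $h:X\to\mathbb R$ in $\Lambda(m,f)$ that are uniformly continuous for the weak uniformity. $L^1_X(\lambda)$ denotes the strongly measurable, Bochner integrable functions. $X$ has the Radon–Nikodým property if for every countably additive probability space $(S,\Sigma,\nu)$ and every countably additive $G:\Sigma\to X$ of finite variation with $G\ll\nu$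 there is $g\in L^1_X(\nu)$ with $G(E)=\int_Eg\,d\nu$ for all $E\in\Sigma$. **Theorem.** Let $X$ have the Radon–Nikodým property and let $f$ be norm and weakly integrable. Then $f$ is Pettis integrable if and only if $(m,f)$ admits a standard representation $(\chi,\lambda,\tilde f)$ relative to $\mathscr H_w$ with $\tilde f\in L^1_X(\lambda)$. Moreover, for every such representation and every $A\in\mathscr A$, there are a closed set $\tilde A\subset\chi(A)$ with $\lambda(\chi(A)\setminus\tilde A)=0$ and a function $g=\tilde f$ $\lambda$-a.e. (a representative, possibly depending on $A$, of the class of $\tilde f$ in $L^1_X(\lambda)$) with $g[\tilde A]\subset\overline{f[A]}^{\,\mathrm{weak}}$; and the given function $\tilde f$ itself maps a countable union of closed subsets of $\chi(A)$, of full $\lambda$-measure in $\chi(A)$, into $\overline{f[A]}^{\,\mathrm{weak}}$. -/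

import Mathlib

open MeasureTheory Filter Topology

noncomputable section

/-- A finitely additive probability space on `Ω`: an algebra `sets` of subsets of `Ω` and a
finitely additive probability `prob` on it (values of `prob` off `sets` are irrelevant). -/
structure FinAddProb (Ω : Type*) where
  sets : Set (Set Ω)
  isSetAlgebra : IsSetAlgebra sets
  prob : Set Ω → ℝ
  nonneg : ∀ A ∈ sets, 0 ≤ prob A
  prob_univ : prob Set.univ = 1
  prob_union : ∀ A ∈ sets, ∀ B ∈ sets, Disjoint A B → prob (A ∪ B) = prob A + prob B

namespace FinAddProb

variable {Ω : Type*} (m : FinAddProb Ω)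

/-- The outer measure `m^*(E) = inf {m(A) : A ∈ 𝒜, E ⊆ A}`. -/
def outer (E : Set Ω) : ℝ := sInf (m.prob '' {A | A ∈ m.sets ∧ E ⊆ A})

/-- The completion `𝒜(m)` of the algebra with respect to `m`. -/
def completion : Set (Set Ω) :=
  {E | ∀ ε > 0, ∃ A ∈ m.sets, ∃ B ∈ m.sets, A ⊆ E ∧ E ⊆ B ∧ m.prob (B \ A) < ε}

/-- Real valued `𝒜`-simple functions. -/
def IsSimple (g : Ω → ℝ) : Prop :=
  (Set.range g).Finite ∧ ∀ y : ℝ, g ⁻¹' {y} ∈ m.sets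

/-- The integral of an `𝒜`-simple function. -/
def simpleIntegral (g : Ω → ℝ) : ℝ := ∑ᶠ y : ℝ, y * m.prob (g ⁻¹' {y})

/-- `m`-convergence of a sequence of real functions (convergence in `m`-measure). -/
def TendstoInMeas (g : ℕ → Ω → ℝ) (g₀ : Ω → ℝ) : Prop :=
  ∀ c > 0, Tendsto (fun n => m.outer {ω | c < |g n ω - g₀ ω|}) atTop (𝓝 0)

/-- `g` is a determining sequence for `g₀`: a sequence of simple functions which `m`-converges to
`g₀` and is Cauchy in the `L¹` seminorm. -/
def IsDetermining (g : ℕ → Ω → ℝ) (g₀ : Ω → ℝ) : Prop :=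
  (∀ n, m.IsSimple (g n)) ∧ m.TendstoInMeas g g₀ ∧
    Tendsto (fun p : ℕ × ℕ => m.simpleIntegral (fun ω => |g p.1 ω - g p.2 ω|)) atTop (𝓝 0)

/-- `g₀ ∈ L¹(m)`. -/
def IsIntegrable (g₀ : Ω → ℝ) : Prop := ∃ g, m.IsDetermining g g₀

/-- `g₀ ∈ L¹(m)` and `∫ g₀ dm = I`. -/
def HasIntegral (g₀ : Ω → ℝ) (I : ℝ) : Prop :=
  ∃ g, m.IsDetermining g g₀ ∧ Tendsto (fun n => m.simpleIntegral (g n)) atTop (𝓝 I)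

/-- `g` is `m`-null on `A`. -/
def IsNullOn (A : Set Ω) (g : Ω → ℝ) : Prop :=
  ∀ c > 0, m.outer (A ∩ {ω | c < |g ω|}) = 0

variable {X : Type*} [NormedAddCommGroup X] [NormedSpace ℝ X] (f : Ω → X)

/-- `‖f‖ ∈ L¹(m)`. -/
def NormIntegrable : Prop := m.IsIntegrable (fun ω => ‖f ω‖)

/-- `x* f ∈ L¹(m)` for all `x* ∈ X*`. -/
def WeaklyIntegrable : Prop := ∀ φ : StrongDual ℝ X, m.IsIntegrable (fun ω => φ (f ω))

/-- For every `A ∈ 𝒜` there is `x_A ∈ X` with `x*(x_A) = ∫_A x* f dm` for all `x* ∈ X*`. -/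
def PettisIntegrable : Prop :=
  ∀ A ∈ m.sets, ∃ x : X, ∀ φ : StrongDual ℝ X,
    m.HasIntegral (A.indicator fun ω => φ (f ω)) (φ x)

/-- The space `Λ(m,f)` of the functions `H` on `Ω × X` with `H(·, f(·)) ∈ L¹(m)`. -/
def La : Set (Ω × X → ℝ) := {H | m.IsIntegrable (fun ω => H (ω, f ω))}

/-- The bounded functions in `Λ(m,f)`. -/
def LaBdd : Set (Ω × X → ℝ) := {H | H ∈ m.La f ∧ ∃ C : ℝ, ∀ p, |H p| ≤ C}

end FinAddProb

/-- The weak uniformity of `X`: the initial uniformity induced by all `x* ∈ X*`. -/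
@[reducible] def weakUniformSpace (X : Type*) [NormedAddCommGroup X] [NormedSpace ℝ X] : UniformSpace X :=
  UniformSpace.comap (fun (x : X) (φ : StrongDual ℝ X) => φ x) inferInstance

/-- `C_u(X, weak) ∩ Λ(m,f)`, functions on `X` being regarded as functions on `Ω × X`. -/
def weakUnifLa {Ω X : Type*} [NormedAddCommGroup X] [NormedSpace ℝ X] (m : FinAddProb Ω)
    (f : Ω → X) : Set (X → ℝ) :=
  {h | @UniformContinuous X ℝ (weakUniformSpace X) inferInstance h ∧
    (fun p : Ω × X => h p.2) ∈ m.La f}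

/-- The weak closure of a subset of `X`, as a subset of `X`. -/
def weakClosure {X : Type*} [NormedAddCommGroup X] [NormedSpace ℝ X] (C : Set X) : Set X :=
  toWeakSpace ℝ X ⁻¹' closure (toWeakSpace ℝ X '' C)

/-- The Radon–Nikodým property: each countably additive `X` valued measure of finite variation,
absolutely continuous with respect to a probability `ν`, has a density in `L¹_X(ν)`. -/
def HasRNP.{w, v} (X : Type v) [NormedAddCommGroup X] [NormedSpace ℝ X] : Prop :=
  ∀ (S : Type w) [MeasurableSpace S] (ν : Measure S) [IsProbabilityMeasure ν]
    (G : VectorMeasure S X), G.variation Set.univ ≠ ⊤ →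
    (∀ E, MeasurableSet E → ν E = 0 → G E = 0) →
    ∃ g : S → X, Integrable g ν ∧ ∀ E, MeasurableSet E → G E = ∫ s in E, g s ∂ν

/-- `(χ, lam, T)` is an abstract standard representation of `(m, f)`. Here `χ` matters on `𝒜(m)`
only and `T` on `Λ(m,f)` only; `T` takes its values in `L¹(lam)` (classes modulo `lam`-null sets)
and `U` is the restriction of `T` to the bounded functions of `Λ(m,f)`, with values in `C(S)`. -/
structure IsAbstractStandardRep {Ω X S : Type*} [NormedAddCommGroup X] [NormedSpace ℝ X]
    [TopologicalSpace S] [MeasurableSpace S] (m : FinAddProb Ω) (f : Ω → X)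
    (χ : Set Ω → Set S) (lam : Measure S) (T : (Ω × X → ℝ) → Lp ℝ 1 lam)
    (U : (Ω × X → ℝ) → C(S, ℝ)) : Prop where
  compact : CompactSpace S
  hausdorff : T2Space S
  borel : BorelSpace S
  probability : IsProbabilityMeasure lam
  regular : lam.Regular
  /- `χ` is a Boolean homomorphism of `𝒜(m)` into the clopen subsets of `S`. -/
  clopen_chi : ∀ A ∈ m.completion, IsClopen (χ A)
  chi_compl : ∀ A ∈ m.completion, χ Aᶜ = (χ A)ᶜ
  chi_union : ∀ A ∈ m.completion, ∀ B ∈ m.completion, χ (A ∪ B) = χ A ∪ χ B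
  chi_inter : ∀ A ∈ m.completion, ∀ B ∈ m.completion, χ (A ∩ B) = χ A ∩ χ B
  /- `T` is an isometric vector lattice homomorphism. -/
  map_add : ∀ H ∈ m.La f, ∀ G ∈ m.La f, T (H + G) = T H + T G
  map_smul : ∀ (c : ℝ), ∀ H ∈ m.La f, T (c • H) = c • T H
  map_sup : ∀ H ∈ m.La f, ∀ G ∈ m.La f, T (H ⊔ G) = T H ⊔ T G
  map_inf : ∀ H ∈ m.La f, ∀ G ∈ m.La f, T (H ⊓ G) = T H ⊓ T G
  isometric : ∀ H ∈ m.La f, m.HasIntegral (fun ω => |H (ω, f ω)|) ‖T H‖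
  /- `∫_A H(f) dm = ∫_{χ(A)} T(H) d lam`. -/
  integral_eq : ∀ A ∈ m.sets, ∀ H ∈ m.La f,
    m.HasIntegral (A.indicator fun ω => H (ω, f ω)) (∫ s in χ A, T H s ∂lam)
  /- `T` is an algebraic isomorphism of the bounded part of `Λ(m,f)` onto `C(S)`. -/
  bounded_ae : ∀ H ∈ m.LaBdd f, T H =ᵐ[lam] U H
  bounded_bij : Set.BijOn U (m.LaBdd f) Set.univ
  bounded_add : ∀ H ∈ m.LaBdd f, ∀ G ∈ m.LaBdd f, U (H + G) = U H + U G
  bounded_smul : ∀ (c : ℝ), ∀ H ∈ m.LaBdd f, U (c • H) = c • U H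
  bounded_mul : ∀ H ∈ m.LaBdd f, ∀ G ∈ m.LaBdd f, U (H * G) = U H * U G
  /- Continuous functions are `σ(clop(S))` measurable. -/
  measurable_clopen : ∀ g : C(S, ℝ),
    @Measurable S ℝ (MeasurableSpace.generateFrom {E : Set S | IsClopen E}) inferInstance g
  clopen_eq : ∀ E : Set S, IsClopen E → ∃ A ∈ m.completion, lam (symmDiff E (χ A)) = 0
  dense_range : Dense (T '' m.La f)
  map_comp : ∀ (n : ℕ) (H : Fin n → Ω × X → ℝ), (∀ i, H i ∈ m.La f) →
    ∀ α : (Fin n → ℝ) → ℝ, Continuous α → (∃ C : ℝ, ∀ y, |α y| ≤ C) →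
    T (fun p => α fun i => H i p) =ᵐ[lam] fun s => α fun i => T (H i) s
  null_iff : ∀ A ∈ m.completion, ∀ H ∈ m.La f,
    m.IsNullOn A (fun ω => H (ω, f ω)) ↔ ∀ᵐ s ∂lam, s ∈ χ A → T H s = 0
  null_tilde : ∀ A ∈ m.completion,
    lam (χ A \ {s | ∀ H ∈ m.LaBdd f, m.IsNullOn A (fun ω => H (ω, f ω)) → U H s = 0}) = 0

/-- `(χ, lam, ft)` is a standard representation of `(m, f)` relatively to the family `ℋ`. -/
def IsStandardRep {Ω X S : Type*} [NormedAddCommGroup X] [NormedSpace ℝ X]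
    [TopologicalSpace S] [MeasurableSpace S] (m : FinAddProb Ω) (f : Ω → X) (ℋ : Set (X → ℝ))
    (χ : Set Ω → Set S) (lam : Measure S) (ft : S → X) : Prop :=
  ∃ (T : (Ω × X → ℝ) → Lp ℝ 1 lam) (U : (Ω × X → ℝ) → C(S, ℝ)),
    IsAbstractStandardRep m f χ lam T U ∧
      ∀ h ∈ ℋ, T (fun p => h p.2) =ᵐ[lam] fun s => h (ft s)

end

universe u v

open scoped ENNReal NNReal

noncomputable section

/-! ### Simple functions, their integral and the outer measure -/

namespace FinAddProb

variable {Ω : Type*} (m : FinAddProb Ω)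

theorem prob_empty : m.prob ∅ = 0 := by
  have h := m.prob_union ∅ m.isSetAlgebra.empty_mem ∅ m.isSetAlgebra.empty_mem (by simp)
  simp only [Set.union_self] at h
  linarith

theorem prob_add_sdiff {A B : Set Ω} (hA : A ∈ m.sets) (hB : B ∈ m.sets) (h : A ⊆ B) :
    m.prob A + m.prob (B \ A) = m.prob B := by
  rw [← m.prob_union A hA _ (m.isSetAlgebra.sdiff_mem hB hA) Set.disjoint_sdiff_right,
    Set.union_sdiff_cancel h]

theorem prob_mono {A B : Set Ω} (hA : A ∈ m.sets) (hB : B ∈ m.sets) (h : A ⊆ B) :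
    m.prob A ≤ m.prob B := by
  have h1 := m.prob_add_sdiff hA hB h
  have h2 := m.nonneg _ (m.isSetAlgebra.sdiff_mem hB hA)
  linarith

theorem prob_union_le {A B : Set Ω} (hA : A ∈ m.sets) (hB : B ∈ m.sets) :
    m.prob (A ∪ B) ≤ m.prob A + m.prob B := by
  have h1 := m.prob_union A hA _ (m.isSetAlgebra.sdiff_mem hB hA) Set.disjoint_sdiff_right
  have h2 := m.prob_mono (m.isSetAlgebra.sdiff_mem hB hA) hB Set.sdiff_subset
  rw [Set.union_sdiff_self] at h1
  linarith

theorem prob_biUnion {ι : Type*} (s : Finset ι) (A : ι → Set Ω) (hA : ∀ i ∈ s, A i ∈ m.sets)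
    (hd : (s : Set ι).PairwiseDisjoint A) :
    m.prob (⋃ i ∈ s, A i) = ∑ i ∈ s, m.prob (A i) := by
  classical
  induction s using Finset.induction_on with
  | empty => simp [prob_empty]
  | insert a s ha ih =>
    rw [Finset.sum_insert ha, Finset.set_biUnion_insert,
      m.prob_union _ (hA a (by simp)) _
        (m.isSetAlgebra.biUnion_mem s fun i hi => hA i (by simp [hi])),
      ih (fun i hi => hA i (by simp [hi])) (hd.subset (by simp))]
    rw [Set.disjoint_iUnion₂_right]
    intro i hi
    exact hd (by simp) (by simp [hi]) (fun h => ha (h ▸ hi))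

/-- Maps of finite range with level sets in the algebra. -/
def IsSimpleMap {β : Type*} (k : Ω → β) : Prop :=
  (Set.range k).Finite ∧ ∀ b, k ⁻¹' {b} ∈ m.sets

variable {m}

namespace IsSimpleMap

variable {β β' : Type*} {k : Ω → β} {l : Ω → β'}

theorem preimage_mem (hk : m.IsSimpleMap k) (s : Set β) : k ⁻¹' s ∈ m.sets := by
  classical
  have : k ⁻¹' s = ⋃ b ∈ hk.1.toFinset.filter (· ∈ s), k ⁻¹' {b} := by
    ext ω; simp
  rw [this]
  exact m.isSetAlgebra.biUnion_mem _ fun i _ => hk.2 i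

theorem comp (hk : m.IsSimpleMap k) (Φ : β → β') : m.IsSimpleMap (fun ω => Φ (k ω)) := by
  refine ⟨?_, fun b => hk.preimage_mem (Φ ⁻¹' {b})⟩
  have := hk.1.image Φ
  rwa [← Set.range_comp] at this

theorem prodMk (hk : m.IsSimpleMap k) (hl : m.IsSimpleMap l) :
    m.IsSimpleMap (fun ω => (k ω, l ω)) := by
  refine ⟨(hk.1.prod hl.1).subset ?_, fun b => ?_⟩
  · rintro _ ⟨ω, rfl⟩
    exact ⟨⟨ω, rfl⟩, ⟨ω, rfl⟩⟩
  · convert m.isSetAlgebra.inter_mem (hk.2 b.1) (hl.2 b.2) using 1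
    ext ω; simp [Prod.ext_iff]

theorem pi {ι : Type*} [Finite ι] {k : ι → Ω → β} (hk : ∀ i, m.IsSimpleMap (k i)) :
    m.IsSimpleMap (fun ω i => k i ω) := by
  cases nonempty_fintype ι
  refine ⟨(Set.Finite.pi' (fun i => (hk i).1)).subset ?_, fun b => ?_⟩
  · rintro _ ⟨ω, rfl⟩ i
    exact ⟨ω, rfl⟩
  · convert m.isSetAlgebra.biInter_mem Finset.univ (fun i _ => (hk i).2 (b i)) using 1
    ext ω; simp [funext_iff]

theorem prob_preimage (hk : m.IsSimpleMap k) (s : Set β) [DecidablePred (· ∈ s)] :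
    m.prob (k ⁻¹' s) = ∑ b ∈ hk.1.toFinset.filter (· ∈ s), m.prob (k ⁻¹' {b}) := by
  have : k ⁻¹' s = ⋃ b ∈ hk.1.toFinset.filter (· ∈ s), k ⁻¹' {b} := by
    ext ω; simp
  rw [this, m.prob_biUnion _ _ fun i _ => hk.2 i]
  intro a _ b _ hab
  exact (Set.disjoint_singleton.2 hab).preimage k

/-- Group the values of `k` according to their image under `Φ`. With `k` a pair of simple functions,
linearity and monotonicity of the integral become termwise statements about finite sums over one
common partition. -/
theorem simpleIntegral_comp (hk : m.IsSimpleMap k) (Φ : β → ℝ) :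
    m.simpleIntegral (fun ω => Φ (k ω)) = ∑ b ∈ hk.1.toFinset, Φ b * m.prob (k ⁻¹' {b}) := by
  classical
  have h1 : m.simpleIntegral (fun ω => Φ (k ω)) =
      ∑ y ∈ hk.1.toFinset.image Φ, y * m.prob ((fun ω => Φ (k ω)) ⁻¹' {y}) := by
    refine finsum_eq_sum_of_support_subset _ fun y hy => ?_
    by_contra hy'
    apply hy
    have : (fun ω => Φ (k ω)) ⁻¹' {y} = ∅ := by
      ext ω
      simp only [Set.mem_preimage, Set.mem_singleton_iff, Set.mem_empty_iff_false, iff_false]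
      intro h
      exact hy' (by simpa using ⟨ω, h⟩)
    simp [this, prob_empty]
  rw [h1, ← Finset.sum_fiberwise_of_maps_to
    (fun b hb => Finset.mem_image_of_mem Φ hb : ∀ b ∈ hk.1.toFinset, Φ b ∈ hk.1.toFinset.image Φ)]
  refine Finset.sum_congr rfl fun y _ => ?_
  have h2 := hk.prob_preimage (Φ ⁻¹' {y})
  rw [show (fun ω => Φ (k ω)) ⁻¹' {y} = k ⁻¹' (Φ ⁻¹' {y}) from rfl, h2, Finset.mul_sum]
  refine Finset.sum_congr (by ext; simp) fun b hb => ?_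
  simp only [Finset.mem_filter] at hb
  rw [hb.2]

end IsSimpleMap

theorem isSimpleMap_const {β : Type*} (b : β) : m.IsSimpleMap (fun _ : Ω => b) := by
  refine ⟨(Set.finite_singleton b).subset (by rintro _ ⟨ω, rfl⟩; rfl), fun b' => ?_⟩
  by_cases h : b = b'
  · simpa [Set.preimage, h] using m.isSetAlgebra.univ_mem
  · simpa [Set.preimage, h] using m.isSetAlgebra.empty_mem

theorem isSimpleMap_indicator {A : Set Ω} (hA : A ∈ m.sets) (c : ℝ) :
    m.IsSimpleMap (A.indicator fun _ => c) := by
  classical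
  refine ⟨(Set.toFinite {c, 0}).subset ?_, fun b => ?_⟩
  · rintro _ ⟨ω, rfl⟩
    by_cases h : ω ∈ A <;> simp [h]
  · rw [Set.indicator_const_preimage_eq_union]
    refine m.isSetAlgebra.union_mem ?_ ?_ <;> split_ifs
    exacts [hA, m.isSetAlgebra.empty_mem, m.isSetAlgebra.compl_mem hA, m.isSetAlgebra.empty_mem]

variable {g h : Ω → ℝ}

theorem IsSimple.simpleMap (hg : m.IsSimple g) : m.IsSimpleMap g := hg

theorem IsSimple.comp₁ (hg : m.IsSimple g) (Φ : ℝ → ℝ) : m.IsSimple (fun ω => Φ (g ω)) :=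
  hg.simpleMap.comp Φ

theorem IsSimple.comp₂ (hg : m.IsSimple g) (hh : m.IsSimple h) (Φ : ℝ → ℝ → ℝ) :
    m.IsSimple (fun ω => Φ (g ω) (h ω)) :=
  (hg.simpleMap.prodMk hh.simpleMap).comp fun p => Φ p.1 p.2

theorem isSimple_const (c : ℝ) : m.IsSimple (fun _ : Ω => c) := isSimpleMap_const c

theorem IsSimple.bounded (hg : m.IsSimple g) : ∃ C : ℝ, 0 ≤ C ∧ ∀ ω, |g ω| ≤ C := by
  obtain ⟨C, hC⟩ := (hg.1.image (fun x => |x|)).bddAbove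
  refine ⟨max C 0, le_max_right _ _, fun ω => le_max_of_le_left (hC ⟨g ω, ⟨ω, rfl⟩, rfl⟩)⟩

theorem simpleIntegral_add (hg : m.IsSimple g) (hh : m.IsSimple h) :
    m.simpleIntegral (fun ω => g ω + h ω) = m.simpleIntegral g + m.simpleIntegral h := by
  have hk := hg.simpleMap.prodMk hh.simpleMap
  have h1 := hk.simpleIntegral_comp fun p => p.1
  have h2 := hk.simpleIntegral_comp fun p => p.2
  have h3 := hk.simpleIntegral_comp fun p => p.1 + p.2
  simp only [add_mul, Finset.sum_add_distrib] at h1 h2 h3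
  rw [h3, ← h1, ← h2]

theorem simpleIntegral_const_mul (hg : m.IsSimple g) (c : ℝ) :
    m.simpleIntegral (fun ω => c * g ω) = c * m.simpleIntegral g := by
  have h1 := hg.simpleMap.simpleIntegral_comp fun p => p
  have h2 := hg.simpleMap.simpleIntegral_comp fun p => c * p
  rw [h1, h2, Finset.mul_sum]
  simp only [mul_assoc]

theorem simpleIntegral_sub (hg : m.IsSimple g) (hh : m.IsSimple h) :
    m.simpleIntegral (fun ω => g ω - h ω) = m.simpleIntegral g - m.simpleIntegral h := by
  have h1 := simpleIntegral_add hg (hh.comp₁ fun x => -1 * x)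
  rw [simpleIntegral_const_mul hh] at h1
  simpa [sub_eq_add_neg] using h1

theorem simpleIntegral_mono (hg : m.IsSimple g) (hh : m.IsSimple h) (hgh : ∀ ω, g ω ≤ h ω) :
    m.simpleIntegral g ≤ m.simpleIntegral h := by
  have hk := hg.simpleMap.prodMk hh.simpleMap
  have h1 := hk.simpleIntegral_comp fun p => p.1
  have h2 := hk.simpleIntegral_comp fun p => p.2
  simp only at h1 h2
  rw [h1, h2]
  refine Finset.sum_le_sum fun b hb => ?_
  simp only [Set.Finite.mem_toFinset, Set.mem_range] at hb
  obtain ⟨ω, rfl⟩ := hb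
  exact mul_le_mul_of_nonneg_right (hgh ω) (m.nonneg _ (hk.2 _))

theorem simpleIntegral_indicator (A : Set Ω) (c : ℝ) :
    m.simpleIntegral (A.indicator fun _ => c) = c * m.prob A := by
  classical
  rw [simpleIntegral, finsum_eq_single _ c]
  · by_cases hc : c = 0
    · simp [hc]
    · congr 2
      ext ω
      by_cases h : ω ∈ A <;> simp [h, Ne.symm hc]
  · intro y hy
    by_cases h0 : y = 0
    · simp [h0]
    · have : (A.indicator fun _ => c) ⁻¹' {y} = ∅ := by
        ext ω
        by_cases h : ω ∈ A <;> simp [h, Ne.symm h0, Ne.symm hy]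
      simp [this, prob_empty]

theorem simpleIntegral_const (c : ℝ) : m.simpleIntegral (fun _ : Ω => c) = c := by
  have := simpleIntegral_indicator (m := m) Set.univ c
  simpa [m.prob_univ] using this

theorem simpleIntegral_nonneg (hg : m.IsSimple g) (h0 : ∀ ω, 0 ≤ g ω) :
    0 ≤ m.simpleIntegral g := by
  simpa [simpleIntegral_const] using simpleIntegral_mono (isSimple_const 0) hg h0

theorem abs_simpleIntegral_le (hg : m.IsSimple g) :
    |m.simpleIntegral g| ≤ m.simpleIntegral (fun ω => |g ω|) := by
  rw [abs_le]
  constructor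
  · have h1 := simpleIntegral_mono (hg.comp₁ fun x => -1 * |x|) hg
      (fun ω => by simpa using neg_abs_le (g ω))
    rw [simpleIntegral_const_mul (hg.comp₁ fun x => |x|)] at h1
    linarith
  · exact simpleIntegral_mono hg (hg.comp₁ fun x => |x|) fun ω => le_abs_self _

variable (m) in
theorem outer_bddBelow (E : Set Ω) : BddBelow (m.prob '' {A | A ∈ m.sets ∧ E ⊆ A}) :=
  ⟨0, by rintro _ ⟨A, hA, rfl⟩; exact m.nonneg A hA.1⟩

theorem outer_le {A E : Set Ω} (hA : A ∈ m.sets) (h : E ⊆ A) : m.outer E ≤ m.prob A :=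
  csInf_le (m.outer_bddBelow E) ⟨A, ⟨hA, h⟩, rfl⟩

variable (m) in
theorem outer_nonempty (E : Set Ω) : (m.prob '' {A | A ∈ m.sets ∧ E ⊆ A}).Nonempty :=
  ⟨_, Set.univ, ⟨m.isSetAlgebra.univ_mem, Set.subset_univ _⟩, rfl⟩

variable (m) in
theorem outer_nonneg (E : Set Ω) : 0 ≤ m.outer E :=
  le_csInf (m.outer_nonempty E) (by rintro _ ⟨A, hA, rfl⟩; exact m.nonneg A hA.1)

theorem exists_of_outer_lt {E : Set Ω} {r : ℝ} (h : m.outer E < r) :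
    ∃ A ∈ m.sets, E ⊆ A ∧ m.prob A < r := by
  obtain ⟨_, ⟨A, hA, rfl⟩, hr⟩ := exists_lt_of_csInf_lt (m.outer_nonempty E) h
  exact ⟨A, hA.1, hA.2, hr⟩

theorem outer_mono {E F : Set Ω} (h : E ⊆ F) : m.outer E ≤ m.outer F :=
  csInf_le_csInf (m.outer_bddBelow E) (m.outer_nonempty F)
    (Set.image_mono fun _ hA => ⟨hA.1, h.trans hA.2⟩)

theorem outer_of_mem {A : Set Ω} (hA : A ∈ m.sets) : m.outer A = m.prob A :=
  le_antisymm (outer_le hA subset_rfl) (le_csInf (m.outer_nonempty A)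
    (by rintro _ ⟨B, hB, rfl⟩; exact m.prob_mono hA hB.1 hB.2))

theorem outer_union_le (E F : Set Ω) : m.outer (E ∪ F) ≤ m.outer E + m.outer F := by
  refine le_of_forall_pos_le_add fun ε hε => ?_
  obtain ⟨A, hA, hEA, h1⟩ := exists_of_outer_lt (m := m) (E := E) (r := m.outer E + ε / 2)
    (by linarith)
  obtain ⟨B, hB, hFB, h2⟩ := exists_of_outer_lt (m := m) (E := F) (r := m.outer F + ε / 2)
    (by linarith)
  have h3 := outer_le (m.isSetAlgebra.union_mem hA hB) (Set.union_subset_union hEA hFB)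
  have h4 := m.prob_union_le hA hB
  linarith

theorem outer_empty : m.outer ∅ = 0 := by
  rw [outer_of_mem m.isSetAlgebra.empty_mem, prob_empty]

theorem outer_iUnion_le {ι : Type*} [Fintype ι] (E : ι → Set Ω) :
    m.outer (⋃ i, E i) ≤ ∑ i, m.outer (E i) := by
  classical
  have : ∀ s : Finset ι, m.outer (⋃ i ∈ s, E i) ≤ ∑ i ∈ s, m.outer (E i) := by
    intro s
    induction s using Finset.induction_on with
    | empty => simp [outer_empty]
    | insert a s ha ih =>
      rw [Finset.sum_insert ha, Finset.set_biUnion_insert]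
      exact (outer_union_le _ _).trans (by gcongr)
  simpa using this Finset.univ

/-- Chebyshev's inequality: `c` times the indicator of `{c < g}` lies below `g`. -/
theorem mul_prob_le_simpleIntegral (hg : m.IsSimple g) (h0 : ∀ ω, 0 ≤ g ω) {c : ℝ} :
    c * m.prob {ω | c < g ω} ≤ m.simpleIntegral g := by
  have hA : {ω | c < g ω} ∈ m.sets := hg.simpleMap.preimage_mem (Set.Ioi c)
  rw [← simpleIntegral_indicator]
  refine simpleIntegral_mono (isSimpleMap_indicator hA c) hg fun ω => ?_
  by_cases h : ω ∈ {ω | c < g ω}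
  · rw [Set.indicator_of_mem h]; exact le_of_lt h
  · rw [Set.indicator_of_notMem h]; exact h0 ω

end FinAddProb
-- The upper norm and the space `L¹(m)`
namespace FinAddProb

variable {Ω : Type*} (m : FinAddProb Ω)

/-- `r` bounds the integrals of nonnegative simple functions which asymptotically dominate `|g|`
in `m`-measure. -/
def IsUpperBound (g : Ω → ℝ) (r : ℝ) : Prop :=
  ∃ t : ℕ → Ω → ℝ, (∀ n, m.IsSimple (t n) ∧ (∀ ω, 0 ≤ t n ω) ∧ m.simpleIntegral (t n) ≤ r) ∧
    ∀ c > 0, Tendsto (fun n => m.outer {ω | t n ω + c < |g ω|}) atTop (𝓝 0)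

/-- A monotone extended seminorm on all functions, extending the `L¹` seminorm of simple functions,
such that `L¹(m)` is the closure of the simple functions. -/
def upperNorm (g : Ω → ℝ) : ℝ≥0∞ := ⨅ (r : ℝ) (_ : m.IsUpperBound g r), ENNReal.ofReal r

variable {m} {g h g₁ g₂ : Ω → ℝ}

theorem IsUpperBound.nonneg {r : ℝ} (hr : m.IsUpperBound g r) : 0 ≤ r := by
  obtain ⟨t, ht, -⟩ := hr
  exact (simpleIntegral_nonneg (ht 0).1 (ht 0).2.1).trans (ht 0).2.2

theorem IsUpperBound.upperNorm_le {r : ℝ} (hr : m.IsUpperBound g r) :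
    m.upperNorm g ≤ ENNReal.ofReal r :=
  iInf₂_le r hr

theorem exists_isUpperBound {a : ℝ≥0∞} (ha : m.upperNorm g < a) :
    ∃ r, m.IsUpperBound g r ∧ ENNReal.ofReal r < a := by
  simpa [upperNorm, iInf_lt_iff] using ha

theorem tendsto_outer_of_le {E F : ℕ → Set Ω} (hF : Tendsto (fun n => m.outer (F n)) atTop (𝓝 0))
    (h : ∀ n, E n ⊆ F n) : Tendsto (fun n => m.outer (E n)) atTop (𝓝 0) :=
  squeeze_zero (fun _ => outer_nonneg m _) (fun n => outer_mono (h n)) hF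

theorem tendsto_outer_union {E F : ℕ → Set Ω} (hE : Tendsto (fun n => m.outer (E n)) atTop (𝓝 0))
    (hF : Tendsto (fun n => m.outer (F n)) atTop (𝓝 0)) :
    Tendsto (fun n => m.outer (E n ∪ F n)) atTop (𝓝 0) :=
  squeeze_zero (fun _ => outer_nonneg m _) (fun n => outer_union_le _ _) (by simpa using hE.add hF)

theorem IsUpperBound.mul_add {r₁ r₂ C : ℝ} (h₁ : m.IsUpperBound g₁ r₁)
    (h₂ : m.IsUpperBound g₂ r₂) (hC : 0 ≤ C) (hh : ∀ ω, |h ω| ≤ C * (|g₁ ω| + |g₂ ω|)) :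
    m.IsUpperBound h (C * (r₁ + r₂)) := by
  obtain ⟨t, ht, ht'⟩ := h₁
  obtain ⟨u, hu, hu'⟩ := h₂
  refine ⟨fun n ω => C * (t n ω + u n ω), fun n => ⟨?_, fun ω => ?_, ?_⟩, fun c hc => ?_⟩
  · exact (ht n).1.comp₂ (hu n).1 fun x y => C * (x + y)
  · exact mul_nonneg hC (add_nonneg ((ht n).2.1 ω) ((hu n).2.1 ω))
  · rw [simpleIntegral_const_mul ((ht n).1.comp₂ (hu n).1 fun x y => x + y),
      simpleIntegral_add (ht n).1 (hu n).1]
    exact mul_le_mul_of_nonneg_left (add_le_add (ht n).2.2 (hu n).2.2) hC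
  -- The two errors sum to `c / (C + 1)`, and `C * (c / (C + 1)) ≤ c`; using `C + 1` covers `C = 0`.
  · have hd : 0 < c / (2 * (C + 1)) := by positivity
    refine tendsto_outer_of_le (tendsto_outer_union (ht' _ hd) (hu' _ hd)) fun n ω hω => ?_
    simp only [Set.mem_ofPred_eq, Set.mem_union] at hω ⊢
    by_contra! hcon
    have h1 : C * (|g₁ ω| + |g₂ ω|) ≤ C * (t n ω + u n ω + c / (C + 1)) := by
      refine mul_le_mul_of_nonneg_left ?_ hC
      have : c / (C + 1) = c / (2 * (C + 1)) + c / (2 * (C + 1)) := by field_simp; ring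
      linarith [hcon.1, hcon.2]
    have h2 : C * (c / (C + 1)) ≤ c := by
      rw [← mul_div_assoc, div_le_iff₀ (by positivity)]
      nlinarith
    linarith [hh ω]

/-- The source of the monotonicity, triangle and Lipschitz estimates for `upperNorm`: add dominating
sequences, then pass to the infimum over both bounds. -/
theorem upperNorm_le_mul_add {C : ℝ} (hC : 0 ≤ C)
    (hh : ∀ ω, |h ω| ≤ C * (|g₁ ω| + |g₂ ω|)) :
    m.upperNorm h ≤ ENNReal.ofReal C * (m.upperNorm g₁ + m.upperNorm g₂) := by
  have key : ∀ r₁, m.IsUpperBound g₁ r₁ → ∀ r₂, m.IsUpperBound g₂ r₂ →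
      m.upperNorm h ≤ ENNReal.ofReal C * (ENNReal.ofReal r₁ + ENNReal.ofReal r₂) := by
    intro r₁ h₁ r₂ h₂
    rw [← ENNReal.ofReal_add h₁.nonneg h₂.nonneg, ← ENNReal.ofReal_mul hC]
    exact (h₁.mul_add h₂ hC hh).upperNorm_le
  by_cases htop : m.upperNorm g₁ = ⊤ ∨ m.upperNorm g₂ = ⊤
  -- Since `0 * ⊤ = 0` in `ℝ≥0∞`, the case `C = 0` has content: there `h` vanishes identically.
  · rcases hC.eq_or_lt with rfl | hC'
    · have h0 : m.IsUpperBound h 0 := by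
        refine ⟨fun _ _ => 0, fun n => ⟨isSimple_const 0, fun _ => le_rfl, ?_⟩, fun c hc => ?_⟩
        · rw [simpleIntegral_const]
        · have : {ω | 0 + c < |h ω|} = ∅ := by
            ext ω
            have := hh ω
            simp only [zero_mul] at this
            simp only [Set.mem_ofPred_eq, Set.mem_empty_iff_false, iff_false]
            linarith
          simp only [this, outer_empty]
          exact tendsto_const_nhds
      simpa using h0.upperNorm_le
    · have : ENNReal.ofReal C ≠ 0 := by simpa using hC'
      rcases htop with h | h <;> simp [h, ENNReal.mul_top this]
  · push Not at htop
    have hn₁ : (𝓝[>] (m.upperNorm g₁)).NeBot :=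
      nhdsGT_neBot_of_exists_gt ⟨⊤, lt_top_iff_ne_top.2 htop.1⟩
    have hn₂ : (𝓝[>] (m.upperNorm g₂)).NeBot :=
      nhdsGT_neBot_of_exists_gt ⟨⊤, lt_top_iff_ne_top.2 htop.2⟩
    refine ge_of_tendsto (f := fun a : ℝ≥0∞ × ℝ≥0∞ => ENNReal.ofReal C * (a.1 + a.2))
      (x := 𝓝[>] (m.upperNorm g₁) ×ˢ 𝓝[>] (m.upperNorm g₂)) ?_ ?_
    · refine ENNReal.Tendsto.const_mul ?_ (Or.inr ENNReal.ofReal_ne_top)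
      exact ((tendsto_nhdsWithin_of_tendsto_nhds tendsto_id).comp tendsto_fst).add
        ((tendsto_nhdsWithin_of_tendsto_nhds tendsto_id).comp tendsto_snd)
    · filter_upwards [prod_mem_prod (self_mem_nhdsWithin (a := m.upperNorm g₁))
        (self_mem_nhdsWithin (a := m.upperNorm g₂))] with a ha
      obtain ⟨r₁, h₁, h₁'⟩ := exists_isUpperBound (Set.mem_Ioi.1 ha.1)
      obtain ⟨r₂, h₂, h₂'⟩ := exists_isUpperBound (Set.mem_Ioi.1 ha.2)
      refine (key r₁ h₁ r₂ h₂).trans ?_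
      gcongr

theorem upperNorm_le_add (hh : ∀ ω, |h ω| ≤ |g₁ ω| + |g₂ ω|) :
    m.upperNorm h ≤ m.upperNorm g₁ + m.upperNorm g₂ := by
  simpa using upperNorm_le_mul_add (m := m) zero_le_one (by simpa using hh)

theorem isUpperBound_simple (hg : m.IsSimple g) :
    m.IsUpperBound g (m.simpleIntegral fun ω => |g ω|) := by
  refine ⟨fun _ ω => |g ω|, fun _ => ⟨hg.comp₁ _, fun ω => abs_nonneg _, le_rfl⟩, fun c hc => ?_⟩
  have : {ω | |g ω| + c < |g ω|} = ∅ := by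
    ext ω
    simp only [Set.mem_ofPred_eq, Set.mem_empty_iff_false, iff_false]
    linarith
  simp only [this, outer_empty]
  exact tendsto_const_nhds

theorem upperNorm_const (c : ℝ) : m.upperNorm (fun _ : Ω => c) ≤ ENNReal.ofReal |c| := by
  simpa [simpleIntegral_const] using (isUpperBound_simple (m := m) (isSimple_const c)).upperNorm_le

theorem upperNorm_zero : m.upperNorm (0 : Ω → ℝ) = 0 :=
  le_antisymm (by simpa using! upperNorm_const (m := m) 0) zero_le

theorem upperNorm_mono (hh : ∀ ω, |h ω| ≤ |g ω|) : m.upperNorm h ≤ m.upperNorm g := by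
  simpa [upperNorm_zero] using upperNorm_le_add (m := m) (g₁ := g) (g₂ := 0) (by simpa using hh)

theorem upperNorm_le_const {C : ℝ} (hh : ∀ ω, |h ω| ≤ C) :
    m.upperNorm h ≤ ENNReal.ofReal C := by
  rcases isEmpty_or_nonempty Ω with h0 | ⟨⟨ω⟩⟩
  · rw [Subsingleton.elim h 0, upperNorm_zero]; exact zero_le
  · have hC : 0 ≤ C := (abs_nonneg _).trans (hh ω)
    refine (upperNorm_mono (g := fun _ => C) fun ω => ?_).trans ((upperNorm_const C).trans ?_)
    · rw [abs_of_nonneg hC]; exact hh ω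
    · rw [abs_of_nonneg hC]

theorem upperNorm_sub_comm (g h : Ω → ℝ) : m.upperNorm (g - h) = m.upperNorm (h - g) :=
  le_antisymm (upperNorm_mono fun ω => by simp [abs_sub_comm])
    (upperNorm_mono fun ω => by simp [abs_sub_comm])

theorem upperNorm_sub_le (g h k : Ω → ℝ) :
    m.upperNorm (g - k) ≤ m.upperNorm (g - h) + m.upperNorm (h - k) :=
  upperNorm_le_add fun ω => by simpa using abs_sub_le (g ω) (h ω) (k ω)

theorem upperNorm_le_add_sub (g h : Ω → ℝ) :
    m.upperNorm g ≤ m.upperNorm h + m.upperNorm (g - h) :=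
  upperNorm_le_add fun ω => by
    have := abs_add_le (h ω) (g ω - h ω)
    simpa using this

/-- If `t n` asymptotically dominates `|g|`, then `|g| ≤ t n + c` off a set of vanishing measure, on
which `|g|` is at most its bound `M`. Integrating gives `∫ |g| ≤ r + c + o(1)`. The exceptional set
lies in the algebra because both functions are simple. -/
theorem upperNorm_simple (hg : m.IsSimple g) :
    m.upperNorm g = ENNReal.ofReal (m.simpleIntegral fun ω => |g ω|) := by
  refine le_antisymm (isUpperBound_simple hg).upperNorm_le (le_iInf₂ fun r hr => ?_)
  refine ENNReal.ofReal_le_ofReal ?_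
  obtain ⟨t, ht, ht'⟩ := hr
  obtain ⟨M, hM, hgM⟩ := hg.bounded
  refine le_of_forall_pos_le_add fun c hc => ?_
  have key : ∀ n, (m.simpleIntegral fun ω => |g ω|) ≤
      r + c + M * m.outer {ω | t n ω + c < |g ω|} := by
    intro n
    have hA : {ω | t n ω + c < |g ω|} ∈ m.sets :=
      ((ht n).1.simpleMap.prodMk hg.simpleMap).preimage_mem {p | p.1 + c < |p.2|}
    have h1 : m.IsSimple fun ω => t n ω + c := (ht n).1.comp₁ fun x => x + c
    have h2 : m.IsSimple ({ω | t n ω + c < |g ω|}.indicator fun _ => M) :=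
      isSimpleMap_indicator hA M
    have h3 := simpleIntegral_mono (hg.comp₁ fun x => |x|) (h1.comp₂ h2 fun x y => x + y)
      fun ω => by
        by_cases hω : t n ω + c < |g ω|
        · rw [Set.indicator_of_mem (by exact hω)]
          linarith [hgM ω, (ht n).2.1 ω]
        · rw [Set.indicator_of_notMem (by exact hω)]
          linarith
    rw [simpleIntegral_add h1 h2, simpleIntegral_add (ht n).1 (isSimple_const c),
      simpleIntegral_const, simpleIntegral_indicator, ← outer_of_mem hA] at h3
    linarith [(ht n).2.2]
  have hlim : Tendsto (fun n => r + c + M * m.outer {ω | t n ω + c < |g ω|}) atTop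
      (𝓝 (r + c + M * 0)) := ((ht' c hc).const_mul M).const_add _
  rw [mul_zero, add_zero] at hlim
  exact ge_of_tendsto' hlim key

theorem upperNorm_le_of_support {C : ℝ} {E : Set Ω} (hC : 0 ≤ C) (hh : ∀ ω, |h ω| ≤ C)
    (h0 : ∀ ω, ω ∉ E → h ω = 0) : m.upperNorm h ≤ ENNReal.ofReal (C * m.outer E) := by
  have key : ∀ r > m.outer E, m.upperNorm h ≤ ENNReal.ofReal (C * r) := by
    intro r hr
    obtain ⟨A, hA, hEA, hAr⟩ := exists_of_outer_lt hr
    refine (upperNorm_mono (g := A.indicator fun _ => C) fun ω => ?_).trans ?_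
    · by_cases hω : ω ∈ A
      · simpa [hω, abs_of_nonneg hC] using hh ω
      · simp [hω, h0 ω fun h => hω (hEA h)]
    · rw [upperNorm_simple (isSimpleMap_indicator hA C)]
      refine ENNReal.ofReal_le_ofReal ?_
      have : (fun ω => |A.indicator (fun _ => C) ω|) = A.indicator fun _ => C := by
        ext ω
        by_cases hω : ω ∈ A <;> simp [hω, abs_of_nonneg hC]
      rw [this, simpleIntegral_indicator]
      gcongr
  have hlim : Tendsto (fun r : ℝ => ENNReal.ofReal (C * r)) (𝓝[>] (m.outer E))
      (𝓝 (ENNReal.ofReal (C * m.outer E))) :=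
    tendsto_nhdsWithin_of_tendsto_nhds
      ((ENNReal.continuous_ofReal.comp (continuous_const.mul continuous_id)).tendsto _)
  exact ge_of_tendsto hlim (by filter_upwards [self_mem_nhdsWithin] with r hr using key r hr)

/-- Chebyshev's inequality for the upper norm: where `c < |h|`, either domination by `t n + c / 2`
fails, which is asymptotically negligible, or `c / 2 < t n`, whence the factor `2 / c`. -/
theorem outer_le_of_upperNorm_lt {c r : ℝ} (hc : 0 < c)
    (hr : m.upperNorm h < ENNReal.ofReal r) : m.outer {ω | c < |h ω|} ≤ 2 / c * r := by
  obtain ⟨r', ⟨t, ht, ht'⟩, hr'⟩ := exists_isUpperBound hr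
  have hr'' : r' < r := (ENNReal.ofReal_lt_ofReal_iff_of_nonneg
    (IsUpperBound.nonneg ⟨t, ht, ht'⟩)).1 hr'
  have key : ∀ n, m.outer {ω | c < |h ω|} ≤ m.outer {ω | t n ω + c / 2 < |h ω|} + 2 / c * r := by
    intro n
    have hA : {ω | c / 2 < t n ω} ∈ m.sets := (ht n).1.simpleMap.preimage_mem (Set.Ioi (c / 2))
    have h1 : {ω | c < |h ω|} ⊆ {ω | t n ω + c / 2 < |h ω|} ∪ {ω | c / 2 < t n ω} := by
      intro ω hω
      simp only [Set.mem_ofPred_eq, Set.mem_union] at hω ⊢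
      by_contra! hcon
      linarith [hcon.1, hcon.2]
    refine ((outer_mono h1).trans (outer_union_le _ _)).trans (by
      gcongr
      rw [outer_of_mem hA]
      have h2 := mul_prob_le_simpleIntegral (c := c / 2) (ht n).1 (ht n).2.1
      have h3 : c / 2 * m.prob {ω | c / 2 < t n ω} ≤ r := by linarith [(ht n).2.2]
      calc m.prob {ω | c / 2 < t n ω} = 2 / c * (c / 2 * m.prob {ω | c / 2 < t n ω}) := by
            field_simp
        _ ≤ 2 / c * r := by gcongr)
  have hlim := (ht' (c / 2) (by linarith)).add_const (2 / c * r)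
  rw [zero_add] at hlim
  exact ge_of_tendsto' hlim key

theorem upperNorm_eq_zero_iff :
    m.upperNorm h = 0 ↔ ∀ c > 0, m.outer {ω | c < |h ω|} = 0 := by
  constructor
  · intro h0 c hc
    refine le_antisymm (le_of_forall_pos_le_add fun ε hε => ?_) (outer_nonneg m _)
    have := outer_le_of_upperNorm_lt (m := m) (h := h) (r := c / 2 * ε) hc
      (by rw [h0]; simp; positivity)
    rw [zero_add]
    refine this.trans (le_of_eq ?_)
    field_simp
  · intro h0
    have : m.IsUpperBound h 0 := by
      refine ⟨fun _ _ => 0, fun n => ⟨isSimple_const 0, fun _ => le_rfl, ?_⟩, fun c hc => ?_⟩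
      · rw [simpleIntegral_const]
      · simp [h0 c hc]
    simpa using this.upperNorm_le

theorem tendstoInMeas_of_upperNorm {s : ℕ → Ω → ℝ}
    (hs : Tendsto (fun n => m.upperNorm (g - s n)) atTop (𝓝 0)) : m.TendstoInMeas s g := by
  intro c hc
  rw [Metric.tendsto_atTop]
  intro ε hε
  have : ∀ᶠ n in atTop, m.upperNorm (g - s n) < ENNReal.ofReal (c / 2 * (ε / 2)) :=
    hs.eventually_lt_const (by simp; positivity)
  obtain ⟨N, hN⟩ := eventually_atTop.1 this
  refine ⟨N, fun n hn => ?_⟩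
  have h1 := outer_le_of_upperNorm_lt hc (hN n hn)
  rw [Real.dist_0_eq_abs, abs_of_nonneg (outer_nonneg m _)]
  have h2 : 2 / c * (c / 2 * (ε / 2)) = ε / 2 := by field_simp
  have h3 : {ω | c < |s n ω - g ω|} = {ω | c < |(g - s n) ω|} := by
    ext ω; simp [abs_sub_comm]
  rw [h3]
  linarith

/-- Convergence in measure together with the Cauchy condition amounts to convergence in one
seminorm. Forward, for fixed `n`, the functions `|s k - s n|` asymptotically dominate `|g - s n|` as
`k → ∞` and have small integrals. Backward, Chebyshev gives convergence in measure and the triangle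
inequality the Cauchy condition. -/
theorem isDetermining_iff {s : ℕ → Ω → ℝ} : m.IsDetermining s g ↔
    (∀ n, m.IsSimple (s n)) ∧ Tendsto (fun n => m.upperNorm (g - s n)) atTop (𝓝 0) := by
  constructor
  · rintro ⟨hs, hmeas, hcau⟩
    refine ⟨hs, ENNReal.tendsto_nhds_zero.2 fun ε hε => ?_⟩
    obtain ⟨r, hr0, hrε⟩ : ∃ r : ℝ, 0 < r ∧ ENNReal.ofReal r ≤ ε := by
      obtain ⟨r, hr0, hrε⟩ := ENNReal.lt_iff_exists_nnreal_btwn.1 hε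
      exact ⟨r, by simpa using hr0, by simpa using hrε.le⟩
    have h1 := hcau.eventually_lt_const hr0
    obtain ⟨⟨N₁, N₂⟩, hN⟩ := eventually_atTop.1 h1
    filter_upwards [eventually_ge_atTop N₂] with n hn
    refine le_trans (IsUpperBound.upperNorm_le
      ⟨fun k ω => |s (k + N₁) ω - s n ω|, fun k => ⟨?_, fun ω => abs_nonneg _, ?_⟩,
        fun c hc => ?_⟩) hrε
    · exact (hs _).comp₂ (hs n) fun x y => |x - y|
    · exact (hN (k + N₁, n) ⟨by simp, hn⟩).le
    · refine tendsto_outer_of_le ((hmeas c hc).comp (tendsto_add_atTop_nat N₁)) fun k ω hω => ?_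
      simp only [Set.mem_ofPred_eq, Pi.sub_apply] at hω ⊢
      have := abs_sub_le (g ω) (s (k + N₁) ω) (s n ω)
      rw [abs_sub_comm (s (k + N₁) ω) (g ω)]
      linarith
  · rintro ⟨hs, hlim⟩
    refine ⟨hs, tendstoInMeas_of_upperNorm hlim, ?_⟩
    have h1 : Tendsto (fun p : ℕ × ℕ => m.upperNorm (s p.1 - s p.2)) atTop (𝓝 0) := by
      have h2 : Tendsto (fun p : ℕ × ℕ => m.upperNorm (g - s p.1) + m.upperNorm (g - s p.2)) atTop
          (𝓝 (0 + 0)) := by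
        rw [← prod_atTop_atTop_eq]
        exact (hlim.comp tendsto_fst).add (hlim.comp tendsto_snd)
      rw [add_zero] at h2
      refine tendsto_of_tendsto_of_tendsto_of_le_of_le tendsto_const_nhds h2 (fun _ => zero_le)
        fun p => ?_
      refine (upperNorm_sub_le (s p.1) g (s p.2)).trans ?_
      rw [upperNorm_sub_comm (s p.1) g]
    have h3 := (ENNReal.tendsto_toReal ENNReal.zero_ne_top).comp h1
    refine h3.congr fun p => ?_
    have h4 : m.IsSimple (s p.1 - s p.2) := (hs _).comp₂ (hs _) fun x y => x - y
    simp only [Function.comp]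
    rw [upperNorm_simple h4, ENNReal.toReal_ofReal]
    · rfl
    · exact simpleIntegral_nonneg (h4.comp₁ _) fun ω => abs_nonneg _

theorem isIntegrable_iff : m.IsIntegrable g ↔
    ∀ ε : ℝ, 0 < ε → ∃ s, m.IsSimple s ∧ m.upperNorm (g - s) < ENNReal.ofReal ε := by
  constructor
  · rintro ⟨s, hs⟩ ε hε
    rw [isDetermining_iff] at hs
    obtain ⟨n, hn⟩ := (hs.2.eventually_lt_const (by simpa using hε : 0 < ENNReal.ofReal ε)).exists
    exact ⟨s n, hs.1 n, hn⟩
  · intro h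
    choose s hs hs' using fun n : ℕ => h (1 / (n + 1)) (by positivity)
    refine ⟨s, isDetermining_iff.2 ⟨hs, ?_⟩⟩
    refine tendsto_of_tendsto_of_tendsto_of_le_of_le tendsto_const_nhds ?_ (fun _ => zero_le)
      fun n => (hs' n).le
    have := ENNReal.tendsto_ofReal (tendsto_one_div_add_atTop_nhds_zero_nat (𝕜 := ℝ))
    simpa using this

theorem isIntegrable_of_approx
    (hg : ∀ ε : ℝ, 0 < ε → ∃ h, m.IsIntegrable h ∧ m.upperNorm (g - h) < ENNReal.ofReal ε) :
    m.IsIntegrable g := by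
  refine isIntegrable_iff.2 fun ε hε => ?_
  obtain ⟨h, hh, hgh⟩ := hg (ε / 2) (by linarith)
  obtain ⟨s, hs, hhs⟩ := isIntegrable_iff.1 hh (ε / 2) (by linarith)
  refine ⟨s, hs, (upperNorm_sub_le g h s).trans_lt ?_⟩
  rw [← add_halves ε, ENNReal.ofReal_add (by linarith) (by linarith)]
  exact ENNReal.add_lt_add hgh hhs

theorem IsIntegrable.upperNorm_ne_top (hg : m.IsIntegrable g) : m.upperNorm g ≠ ⊤ := by
  obtain ⟨s, hs, h⟩ := isIntegrable_iff.1 hg 1 one_pos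
  refine ne_top_of_le_ne_top ?_ (upperNorm_le_add_sub g s)
  rw [upperNorm_simple hs]
  exact ENNReal.add_ne_top.2 ⟨ENNReal.ofReal_ne_top, h.ne_top⟩

theorem IsSimple.isIntegrable (hg : m.IsSimple g) : m.IsIntegrable g :=
  isIntegrable_iff.2 fun ε hε => ⟨g, hg, by simp [upperNorm_zero, hε]⟩

/-- A Lipschitz function of simple approximations is a simple approximation. The vector lattice
operations on `L¹(m)` are all instances. -/
theorem IsIntegrable.comp₂ (hg : m.IsIntegrable g) (hh : m.IsIntegrable h) (Φ : ℝ → ℝ → ℝ)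
    {C : ℝ} (hC : 0 ≤ C) (hΦ : ∀ a b a' b', |Φ a b - Φ a' b'| ≤ C * (|a - a'| + |b - b'|)) :
    m.IsIntegrable (fun ω => Φ (g ω) (h ω)) := by
  refine isIntegrable_iff.2 fun ε hε => ?_
  have hd : 0 < ε / (2 * (C + 1)) := by positivity
  obtain ⟨s, hs, hs'⟩ := isIntegrable_iff.1 hg _ hd
  obtain ⟨t, ht, ht'⟩ := isIntegrable_iff.1 hh _ hd
  refine ⟨_, hs.comp₂ ht Φ, (upperNorm_le_mul_add (g₁ := g - s) (g₂ := h - t) hC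
    fun ω => hΦ _ _ _ _).trans_lt ?_⟩
  have h1 : ENNReal.ofReal C * (m.upperNorm (g - s) + m.upperNorm (h - t)) ≤
      ENNReal.ofReal C * (ENNReal.ofReal (ε / (2 * (C + 1))) +
        ENNReal.ofReal (ε / (2 * (C + 1)))) := by gcongr
  refine h1.trans_lt ?_
  rw [← ENNReal.ofReal_add hd.le hd.le, ← ENNReal.ofReal_mul hC]
  refine (ENNReal.ofReal_lt_ofReal_iff hε).2 ?_
  have : C * (ε / (2 * (C + 1)) + ε / (2 * (C + 1))) = ε * (C / (C + 1)) := by field_simp; ring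
  rw [this]
  have : C / (C + 1) < 1 := by rw [div_lt_one (by positivity)]; linarith
  nlinarith

theorem IsIntegrable.comp₁ (hg : m.IsIntegrable g) (Φ : ℝ → ℝ)
    {C : ℝ} (hC : 0 ≤ C) (hΦ : ∀ a a', |Φ a - Φ a'| ≤ C * |a - a'|) :
    m.IsIntegrable (fun ω => Φ (g ω)) :=
  hg.comp₂ hg (fun a _ => Φ a) hC fun a b a' b' => (hΦ a a').trans (by
    gcongr; linarith [abs_nonneg (b - b')])

theorem IsIntegrable.add (hg : m.IsIntegrable g) (hh : m.IsIntegrable h) :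
    m.IsIntegrable (fun ω => g ω + h ω) :=
  hg.comp₂ hh (fun a b => a + b) zero_le_one fun a b a' b' => by
    rw [one_mul, add_sub_add_comm]; exact abs_add_le _ _

theorem IsIntegrable.sub (hg : m.IsIntegrable g) (hh : m.IsIntegrable h) :
    m.IsIntegrable (fun ω => g ω - h ω) :=
  hg.comp₂ hh (fun a b => a - b) zero_le_one fun a b a' b' => by
    rw [one_mul, sub_sub_sub_comm]; exact abs_sub _ _

theorem IsIntegrable.sup (hg : m.IsIntegrable g) (hh : m.IsIntegrable h) :
    m.IsIntegrable (fun ω => g ω ⊔ h ω) :=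
  hg.comp₂ hh (fun a b => a ⊔ b) zero_le_one fun a b a' b' => by
    rw [one_mul]
    exact (abs_max_sub_max_le_max _ _ _ _).trans (max_le_add_of_nonneg (abs_nonneg _) (abs_nonneg _))

theorem IsIntegrable.inf (hg : m.IsIntegrable g) (hh : m.IsIntegrable h) :
    m.IsIntegrable (fun ω => g ω ⊓ h ω) :=
  hg.comp₂ hh (fun a b => a ⊓ b) zero_le_one fun a b a' b' => by
    rw [one_mul]
    exact (abs_min_sub_min_le_max _ _ _ _).trans (max_le_add_of_nonneg (abs_nonneg _) (abs_nonneg _))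

theorem IsIntegrable.const_mul (hg : m.IsIntegrable g) (c : ℝ) :
    m.IsIntegrable (fun ω => c * g ω) :=
  hg.comp₁ (fun a => c * a) (abs_nonneg c) fun a a' => by rw [← mul_sub, abs_mul]

theorem IsIntegrable.abs (hg : m.IsIntegrable g) : m.IsIntegrable (fun ω => |g ω|) :=
  hg.comp₁ (fun a => |a|) zero_le_one fun a a' => by
    rw [one_mul]; exact abs_abs_sub_abs_le_abs_sub a a'

end FinAddProb
-- Truncations
/-- The truncation of a real number to `[-k, k]`. -/
def truncReal (k x : ℝ) : ℝ := (-k) ⊔ (k ⊓ x)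

theorem abs_truncReal_le {k : ℝ} (hk : 0 ≤ k) (x : ℝ) : |truncReal k x| ≤ k := by
  unfold truncReal
  exact abs_le.2 ⟨le_max_left _ _, max_le (by linarith) (min_le_left _ _)⟩

theorem truncReal_of_abs_le {k x : ℝ} (h : |x| ≤ k) : truncReal k x = x := by
  rw [abs_le] at h
  simp [truncReal, h.1, h.2]

theorem abs_truncReal_sub_le (k x y : ℝ) : |truncReal k x - truncReal k y| ≤ |x - y| := by
  unfold truncReal
  refine (abs_max_sub_max_le_max _ _ _ _).trans ?_
  rw [sub_self, abs_zero, max_eq_right (abs_nonneg _)]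
  refine (abs_min_sub_min_le_max _ _ _ _).trans ?_
  rw [sub_self, abs_zero, max_eq_right (abs_nonneg _)]

/-- `truncReal k x` is the point of `[-k, k]` nearest to `x`. -/
theorem abs_sub_truncReal_le {k x y : ℝ} (hy : |y| ≤ k) : |x - truncReal k x| ≤ |x - y| := by
  rw [abs_le] at hy
  unfold truncReal
  rcases le_total x k with h | h
  · rcases le_total (-k) x with h' | h'
    · simp [h, h']
    · rw [min_eq_right h, max_eq_left h', abs_of_nonpos (by linarith), abs_of_nonpos (by linarith)]
      linarith
  · rw [min_eq_left h, max_eq_right (by linarith), abs_of_nonneg (by linarith),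
      abs_of_nonneg (by linarith)]
    linarith

theorem truncReal_tendsto (x : ℝ) : Tendsto (fun k : ℕ => truncReal k x) atTop (𝓝 x) := by
  obtain ⟨N, hN⟩ := exists_nat_ge |x|
  refine tendsto_const_nhds.congr' ?_
  filter_upwards [eventually_ge_atTop N] with k hk
  exact (truncReal_of_abs_le (hN.trans (by exact_mod_cast hk))).symm

/-! ### The integral, continuous functions of integrable functions, and the completed algebra -/

namespace FinAddProb

variable {Ω : Type*} {m : FinAddProb Ω} {g h : Ω → ℝ}

theorem HasIntegral.isIntegrable {I : ℝ} (hg : m.HasIntegral g I) : m.IsIntegrable g := by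
  obtain ⟨s, hs, -⟩ := hg
  exact ⟨s, hs⟩

theorem IsIntegrable.exists_hasIntegral (hg : m.IsIntegrable g) : ∃ I, m.HasIntegral g I := by
  obtain ⟨s, hs⟩ := hg
  have : CauchySeq fun n => m.simpleIntegral (s n) := by
    rw [cauchySeq_iff_tendsto_dist_atTop_0]
    refine squeeze_zero (fun _ => dist_nonneg) (fun p => ?_) hs.2.2
    rw [Real.dist_eq, ← simpleIntegral_sub (hs.1 _) (hs.1 _)]
    exact abs_simpleIntegral_le ((hs.1 _).comp₂ (hs.1 _) fun x y => x - y)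
  obtain ⟨I, hI⟩ := cauchySeq_tendsto_of_complete this
  exact ⟨I, s, hs, hI⟩

theorem IsSimple.hasIntegral (hg : m.IsSimple g) : m.HasIntegral g (m.simpleIntegral g) :=
  ⟨fun _ => g, isDetermining_iff.2 ⟨fun _ => hg, by simp [upperNorm_zero]⟩, tendsto_const_nhds⟩

theorem hasIntegral_const (c : ℝ) : m.HasIntegral (fun _ => c) c := by
  simpa [simpleIntegral_const] using (isSimple_const (m := m) c).hasIntegral

theorem hasIntegral_indicator {A : Set Ω} (hA : A ∈ m.sets) :
    m.HasIntegral (A.indicator fun _ => 1) (m.prob A) := by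
  simpa [simpleIntegral_indicator] using
    (IsSimple.hasIntegral (isSimpleMap_indicator hA 1) : m.HasIntegral _ _)

theorem HasIntegral.add {I J : ℝ} (hg : m.HasIntegral g I) (hh : m.HasIntegral h J) :
    m.HasIntegral (fun ω => g ω + h ω) (I + J) := by
  obtain ⟨s, hs, hsI⟩ := hg
  obtain ⟨t, ht, htI⟩ := hh
  rw [isDetermining_iff] at hs ht
  refine ⟨fun n ω => s n ω + t n ω, isDetermining_iff.2
    ⟨fun n => (hs.1 n).comp₂ (ht.1 n) fun x y => x + y, ?_⟩, ?_⟩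
  · have h1 := hs.2.add ht.2
    rw [add_zero] at h1
    refine tendsto_of_tendsto_of_tendsto_of_le_of_le tendsto_const_nhds h1 (fun _ => zero_le)
      fun n => upperNorm_le_add fun ω => ?_
    simp only [Pi.sub_apply]
    rw [add_sub_add_comm]
    exact abs_add_le _ _
  · simp only [fun n => simpleIntegral_add (hs.1 n) (ht.1 n)]
    exact hsI.add htI

theorem HasIntegral.const_mul {I : ℝ} (hg : m.HasIntegral g I) (c : ℝ) :
    m.HasIntegral (fun ω => c * g ω) (c * I) := by
  obtain ⟨s, hs, hsI⟩ := hg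
  rw [isDetermining_iff] at hs
  refine ⟨fun n ω => c * s n ω, isDetermining_iff.2
    ⟨fun n => (hs.1 n).comp₁ fun x => c * x, ?_⟩, ?_⟩
  · have h1 := ENNReal.Tendsto.const_mul (a := ENNReal.ofReal |c|) hs.2
      (Or.inr ENNReal.ofReal_ne_top)
    rw [mul_zero] at h1
    refine tendsto_of_tendsto_of_tendsto_of_le_of_le tendsto_const_nhds h1 (fun _ => zero_le)
      fun n => ?_
    have := upperNorm_le_mul_add (m := m) (h := (fun ω => c * g ω) - fun ω => c * s n ω)
      (g₁ := g - s n) (g₂ := 0) (abs_nonneg c) fun ω => by simp [← mul_sub, abs_mul]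
    simpa [upperNorm_zero] using this
  · simp only [fun n => simpleIntegral_const_mul (hs.1 n)]
    exact hsI.const_mul c

theorem HasIntegral.sub {I J : ℝ} (hg : m.HasIntegral g I) (hh : m.HasIntegral h J) :
    m.HasIntegral (fun ω => g ω - h ω) (I - J) := by
  simpa [sub_eq_add_neg] using hg.add (hh.const_mul (-1))

theorem tendsto_upperNorm {s : ℕ → Ω → ℝ} (hg : m.upperNorm g ≠ ⊤)
    (hs : Tendsto (fun n => m.upperNorm (g - s n)) atTop (𝓝 0)) :
    Tendsto (fun n => m.upperNorm (s n)) atTop (𝓝 (m.upperNorm g)) := by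
  have h1 : Tendsto (fun n => m.upperNorm g - m.upperNorm (g - s n)) atTop
      (𝓝 (m.upperNorm g - 0)) := ENNReal.Tendsto.sub tendsto_const_nhds hs (Or.inl hg)
  have h2 : Tendsto (fun n => m.upperNorm g + m.upperNorm (g - s n)) atTop
      (𝓝 (m.upperNorm g + 0)) := tendsto_const_nhds.add hs
  rw [tsub_zero] at h1
  rw [add_zero] at h2
  refine tendsto_of_tendsto_of_tendsto_of_le_of_le h1 h2 (fun n => ?_) fun n => ?_
  · exact tsub_le_iff_right.2 (upperNorm_le_add_sub _ _)
  · refine (upperNorm_le_add_sub (s n) g).trans ?_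
    rw [upperNorm_sub_comm]

theorem IsIntegrable.hasIntegral_abs (hg : m.IsIntegrable g) :
    m.HasIntegral (fun ω => |g ω|) (m.upperNorm g).toReal := by
  have hg' := hg
  obtain ⟨s, hs⟩ := hg
  rw [isDetermining_iff] at hs
  refine ⟨fun n ω => |s n ω|, isDetermining_iff.2 ⟨fun n => (hs.1 n).comp₁ _, ?_⟩, ?_⟩
  · refine tendsto_of_tendsto_of_tendsto_of_le_of_le tendsto_const_nhds hs.2 (fun _ => zero_le)
      fun n => upperNorm_mono fun ω => ?_
    exact abs_abs_sub_abs_le_abs_sub _ _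
  · have := (ENNReal.tendsto_toReal hg'.upperNorm_ne_top).comp
      (tendsto_upperNorm hg'.upperNorm_ne_top hs.2)
    refine this.congr fun n => ?_
    simp only [Function.comp]
    rw [upperNorm_simple (hs.1 n), ENNReal.toReal_ofReal]
    exact simpleIntegral_nonneg ((hs.1 n).comp₁ _) fun ω => abs_nonneg _

/-- Uniqueness of the integral and its continuity in the upper norm both rest on this bound. -/
theorem HasIntegral.abs_le {I : ℝ} (hg : m.HasIntegral g I) : |I| ≤ (m.upperNorm g).toReal := by
  have hg' := hg.isIntegrable
  obtain ⟨s, hs, hsI⟩ := hg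
  rw [isDetermining_iff] at hs
  have := (ENNReal.tendsto_toReal hg'.upperNorm_ne_top).comp
      (tendsto_upperNorm hg'.upperNorm_ne_top hs.2)
  refine le_of_tendsto_of_tendsto' hsI.abs this fun n => ?_
  simp only [Function.comp]
  rw [upperNorm_simple (hs.1 n), ENNReal.toReal_ofReal]
  · exact abs_simpleIntegral_le (hs.1 n)
  · exact simpleIntegral_nonneg ((hs.1 n).comp₁ _) fun ω => abs_nonneg _

theorem HasIntegral.unique {I J : ℝ} (hI : m.HasIntegral g I) (hJ : m.HasIntegral g J) :
    I = J := by
  have h1 := (hI.sub hJ).abs_le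
  have h2 : (fun ω => g ω - g ω) = 0 := by ext; simp
  rw [h2, upperNorm_zero, ENNReal.toReal_zero] at h1
  linarith [abs_eq_zero.1 (le_antisymm h1 (abs_nonneg _))]

theorem HasIntegral.nonneg {I : ℝ} (hI : m.HasIntegral g I) (hg : ∀ ω, 0 ≤ g ω) : 0 ≤ I := by
  have h1 := hI.isIntegrable.hasIntegral_abs
  simp only [abs_of_nonneg (hg _)] at h1
  rw [hI.unique h1]
  exact ENNReal.toReal_nonneg

theorem HasIntegral.of_tendsto {s : ℕ → Ω → ℝ} {I : ℕ → ℝ} {J : ℝ} (hg : m.IsIntegrable g)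
    (hs : ∀ n, m.HasIntegral (s n) (I n))
    (hgs : Tendsto (fun n => m.upperNorm (g - s n)) atTop (𝓝 0)) (hI : Tendsto I atTop (𝓝 J)) :
    m.HasIntegral g J := by
  obtain ⟨K, hK⟩ := hg.exists_hasIntegral
  have h1 : Tendsto I atTop (𝓝 K) := by
    rw [tendsto_iff_dist_tendsto_zero]
    refine squeeze_zero (fun _ => dist_nonneg) (fun n => ?_)
      ((ENNReal.tendsto_toReal ENNReal.zero_ne_top).comp hgs)
    rw [dist_comm, Real.dist_eq]
    exact (hK.sub (hs n)).abs_le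
  rwa [← tendsto_nhds_unique h1 hI]

/-- The integral with respect to a finitely additive probability (zero if not integrable). -/
def integral (m : FinAddProb Ω) (g : Ω → ℝ) : ℝ :=
  open scoped Classical in if h : ∃ I, m.HasIntegral g I then h.choose else 0

theorem IsIntegrable.hasIntegral (hg : m.IsIntegrable g) : m.HasIntegral g (m.integral g) := by
  have h := hg.exists_hasIntegral
  rw [integral, dif_pos h]
  exact h.choose_spec

theorem HasIntegral.integral_eq {I : ℝ} (hg : m.HasIntegral g I) : m.integral g = I :=
  hg.isIntegrable.hasIntegral.unique hg

theorem IsIntegrable.truncReal (hg : m.IsIntegrable g) (k : ℝ) :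
    m.IsIntegrable (fun ω => truncReal k (g ω)) :=
  hg.comp₁ _ zero_le_one fun a a' => by rw [one_mul]; exact abs_truncReal_sub_le k a a'

/-- A simple function near `g` is bounded, say by `C`; for `k ≥ C` the truncation is pointwise at
least as close to `g`. -/
theorem IsIntegrable.tendsto_truncReal (hg : m.IsIntegrable g) :
    Tendsto (fun k : ℕ => m.upperNorm (g - fun ω => _root_.truncReal k (g ω))) atTop (𝓝 0) := by
  refine ENNReal.tendsto_nhds_zero.2 fun ε hε => ?_
  obtain ⟨r, hr0, hrε⟩ := ENNReal.lt_iff_exists_nnreal_btwn.1 hε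
  obtain ⟨s, hs, hgs⟩ := isIntegrable_iff.1 hg r (by simpa using hr0)
  obtain ⟨C, -, hC⟩ := hs.bounded
  obtain ⟨N, hN⟩ := exists_nat_ge C
  filter_upwards [eventually_ge_atTop N] with k hk
  refine (upperNorm_mono (g := g - s) fun ω => ?_).trans (hgs.le.trans (by simpa using hrε.le))
  exact abs_sub_truncReal_le ((hC ω).trans (hN.trans (by exact_mod_cast hk)))

theorem IsIntegrable.tendsto_outer (hg : m.IsIntegrable g) :
    Tendsto (fun k : ℕ => m.outer {ω | (k : ℝ) < |g ω|}) atTop (𝓝 0) := by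
  have hN := hg.upperNorm_ne_top
  have h1 : ∀ k : ℕ, 0 < k → m.outer {ω | (k : ℝ) < |g ω|} ≤
      2 * ((m.upperNorm g).toReal + 1) / k := by
    intro k hk
    refine (outer_le_of_upperNorm_lt (by exact_mod_cast hk)
      (ENNReal.lt_ofReal_iff_toReal_lt hN |>.2 (lt_add_one _))).trans (le_of_eq (by ring))
  refine squeeze_zero' (Eventually.of_forall fun _ => outer_nonneg m _) ?_
    (tendsto_const_div_atTop_nhds_zero_nat (2 * ((m.upperNorm g).toReal + 1)))
  filter_upwards [eventually_gt_atTop 0] with k hk using h1 k hk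

theorem upperNorm_comp_sub_le {n : ℕ} {α : (Fin n → ℝ) → ℝ} {C ε : ℝ} (hC : ∀ y, |α y| ≤ C)
    (hε : 0 ≤ ε) {u v : Fin n → Ω → ℝ} {E : Set Ω}
    (h : ∀ ω, ω ∉ E → |α (fun i => u i ω) - α fun i => v i ω| ≤ ε) :
    m.upperNorm ((fun ω => α fun i => u i ω) - fun ω => α fun i => v i ω) ≤
      ENNReal.ofReal (ε + 2 * C * m.outer E) := by
  classical
  have hC0 : 0 ≤ C := (abs_nonneg _).trans (hC 0)
  rw [ENNReal.ofReal_add hε (mul_nonneg (by linarith) (outer_nonneg m E))]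
  refine (upperNorm_le_add (g₁ := fun _ => ε) (g₂ := E.indicator fun _ => 2 * C) fun ω => ?_).trans
    (add_le_add (upperNorm_le_const fun ω => (abs_of_nonneg hε).le)
      (upperNorm_le_of_support (by linarith) (fun ω => ?_) fun ω hω => ?_))
  · by_cases hω : ω ∈ E
    · rw [Set.indicator_of_mem hω, abs_of_nonneg (by linarith : 0 ≤ 2 * C), abs_of_nonneg hε]
      simp only [Pi.sub_apply]
      refine (abs_sub _ _).trans ?_
      linarith [hC (fun i => u i ω), hC (fun i => v i ω)]
    · rw [Set.indicator_of_notMem hω, abs_zero, add_zero, abs_of_nonneg hε]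
      exact h ω hω
  · by_cases hω : ω ∈ E
    · rw [Set.indicator_of_mem hω, abs_of_nonneg (by linarith)]
    · rw [Set.indicator_of_notMem hω, abs_zero]; linarith
  · simp [hω]

/-- `α` need not be Lipschitz, but it is uniformly continuous on the cube `[-k, k]^n`. Simple
approximations, truncated so as to stay in the cube, are within `δ / 2` of `u` off a set of small
outer measure, where the bound `C` on `α` controls the error. -/
theorem isIntegrable_comp_of_bounded {n : ℕ} {α : (Fin n → ℝ) → ℝ} {C k : ℝ} (hα : Continuous α)
    (hC : ∀ y, |α y| ≤ C) (hk : 0 ≤ k) {u : Fin n → Ω → ℝ} (hu : ∀ i, m.IsIntegrable (u i))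
    (huk : ∀ i ω, |u i ω| ≤ k) : m.IsIntegrable (fun ω => α fun i => u i ω) := by
  have hC0 : 0 ≤ C := (abs_nonneg _).trans (hC 0)
  have huc := (isCompact_closedBall (0 : Fin n → ℝ) k).uniformContinuousOn_of_continuous
    hα.continuousOn
  rw [Metric.uniformContinuousOn_iff] at huc
  choose s hs using hu
  refine isIntegrable_of_approx fun ε hε => ?_
  obtain ⟨δ, hδ, hδε⟩ := huc (ε / 4) (by linarith)
  have hlim : Tendsto (fun j => ∑ i, m.outer {ω | δ / 2 < |s i j ω - u i ω|}) atTop (𝓝 0) := by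
    have := tendsto_finsetSum Finset.univ fun i _ => (hs i).2.1 (δ / 2) (by linarith)
    simpa using this
  obtain ⟨j, hj⟩ := (hlim.eventually_lt_const
    (by positivity : 0 < ε / (4 * (C + 1)))).exists
  let E : Set Ω := ⋃ i, {ω | δ / 2 < |s i j ω - u i ω|}
  have hE : m.outer E ≤ ε / (4 * (C + 1)) := (outer_iUnion_le _).trans hj.le
  have hsim : m.IsSimple (fun ω => α fun i => truncReal k (s i j ω)) :=
    (IsSimpleMap.pi fun i => ((hs i).1 j).simpleMap).comp fun y => α fun i => truncReal k (y i)
  refine ⟨_, hsim.isIntegrable, (upperNorm_comp_sub_le (E := E) (ε := ε / 4) hC (by linarith)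
    fun ω hω => ?_).trans_lt ?_⟩
  · refine (hδε _ ?_ _ ?_ ?_).le
    · rw [mem_closedBall_zero_iff, pi_norm_le_iff_of_nonneg hk]
      exact fun i => huk i ω
    · rw [mem_closedBall_zero_iff, pi_norm_le_iff_of_nonneg hk]
      exact fun i => abs_truncReal_le hk _
    · refine lt_of_le_of_lt ((dist_pi_le_iff (by linarith : 0 ≤ δ / 2)).2 fun i => ?_)
        (by linarith : δ / 2 < δ)
      simp only [E, Set.mem_iUnion, Set.mem_ofPred_eq, not_exists, not_lt] at hω
      rw [dist_comm, Real.dist_eq]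
      conv_lhs => rw [← truncReal_of_abs_le (huk i ω)]
      exact (abs_truncReal_sub_le _ _ _).trans (hω i)
  · refine (ENNReal.ofReal_lt_ofReal_iff hε).2 ?_
    have h1 : 2 * C * m.outer E ≤ 2 * C * (ε / (4 * (C + 1))) := by gcongr
    have h2 : 2 * C * (ε / (4 * (C + 1))) = ε / 2 * (C / (C + 1)) := by field_simp; ring
    have h3 : C / (C + 1) < 1 := by rw [div_lt_one (by positivity)]; linarith
    nlinarith

theorem tendsto_upperNorm_comp_truncReal {n : ℕ} {α : (Fin n → ℝ) → ℝ} {C : ℝ}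
    (hC : ∀ y, |α y| ≤ C) {u : Fin n → Ω → ℝ} (hu : ∀ i, m.IsIntegrable (u i)) :
    Tendsto (fun k : ℕ => m.upperNorm ((fun ω => α fun i => u i ω) -
      fun ω => α fun i => truncReal k (u i ω))) atTop (𝓝 0) := by
  have hC0 : 0 ≤ C := (abs_nonneg _).trans (hC 0)
  have hlim : Tendsto (fun k : ℕ => ENNReal.ofReal
      (0 + 2 * C * ∑ i, m.outer {ω | (k : ℝ) < |u i ω|})) atTop (𝓝 0) := by
    have h1 := tendsto_finsetSum Finset.univ fun i _ => (hu i).tendsto_outer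
    have h2 := ENNReal.tendsto_ofReal ((h1.const_mul (2 * C)).const_add 0)
    simpa using h2
  refine tendsto_of_tendsto_of_tendsto_of_le_of_le tendsto_const_nhds hlim (fun _ => zero_le)
    fun k => ?_
  refine (upperNorm_comp_sub_le (E := ⋃ i, {ω | (k : ℝ) < |u i ω|}) (v := fun i ω =>
    truncReal k (u i ω)) hC le_rfl fun ω hω => ?_).trans (ENNReal.ofReal_le_ofReal (by
      gcongr; exact outer_iUnion_le _))
  simp only [Set.mem_iUnion, Set.mem_ofPred_eq, not_exists, not_lt] at hω
  simp [truncReal_of_abs_le (hω _)]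

theorem isIntegrable_comp {n : ℕ} {α : (Fin n → ℝ) → ℝ} {C : ℝ} (hα : Continuous α)
    (hC : ∀ y, |α y| ≤ C) {u : Fin n → Ω → ℝ} (hu : ∀ i, m.IsIntegrable (u i)) :
    m.IsIntegrable (fun ω => α fun i => u i ω) := by
  refine isIntegrable_of_approx fun ε hε => ?_
  obtain ⟨k, hk⟩ := ((tendsto_upperNorm_comp_truncReal hC hu).eventually_lt_const
    (by simpa using hε : 0 < ENNReal.ofReal ε)).exists
  exact ⟨_, isIntegrable_comp_of_bounded (u := fun i ω => truncReal k (u i ω)) hα hC k.cast_nonneg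
    (fun i => (hu i).truncReal k) fun i ω => abs_truncReal_le k.cast_nonneg _, hk⟩

theorem IsIntegrable.mul_of_bounded (hg : m.IsIntegrable g) (hh : m.IsIntegrable h) {C : ℝ}
    (hC : ∀ ω, |h ω| ≤ C) : m.IsIntegrable (fun ω => h ω * g ω) := by
  wlog hC0 : 0 ≤ C generalizing C
  · exact this (C := |C|) (fun ω => (hC ω).trans (le_abs_self C)) (abs_nonneg C)
  refine isIntegrable_iff.2 fun ε hε => ?_
  -- The simple function `t` near `g` comes first, since the accuracy required of `s` near `h`
  -- depends on the bound of `t`.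
  obtain ⟨t, ht, hgt⟩ := isIntegrable_iff.1 hg (ε / (2 * (C + 1))) (by positivity)
  obtain ⟨M, hM, htM⟩ := ht.bounded
  obtain ⟨s, hs, hhs⟩ := isIntegrable_iff.1 hh (ε / (2 * (M + 1))) (by positivity)
  refine ⟨_, hs.comp₂ ht fun x y => x * y, ?_⟩
  have h1 := upperNorm_sub_le (m := m) (fun ω => h ω * g ω) (fun ω => h ω * t ω)
    (fun ω => s ω * t ω)
  have h2 := upperNorm_le_mul_add (m := m) (h := (fun ω => h ω * g ω) - fun ω => h ω * t ω)
    (g₁ := g - t) (g₂ := 0) hC0 fun ω => by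
      simp only [Pi.sub_apply, Pi.zero_apply, abs_zero, add_zero]
      rw [← mul_sub, abs_mul]
      gcongr
      exact hC ω
  have h3 := upperNorm_le_mul_add (m := m) (h := (fun ω => h ω * t ω) - fun ω => s ω * t ω)
    (g₁ := h - s) (g₂ := 0) hM fun ω => by
      simp only [Pi.sub_apply, Pi.zero_apply, abs_zero, add_zero]
      rw [← sub_mul, abs_mul, mul_comm]
      gcongr
      exact htM ω
  rw [upperNorm_zero, add_zero] at h2 h3
  have h4 : ∀ K : ℝ, 0 ≤ K → ∀ a, a ≤ ENNReal.ofReal (ε / (2 * (K + 1))) →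
      ENNReal.ofReal K * a ≤ ENNReal.ofReal (ε / 2 * (K / (K + 1))) := by
    intro K hK a ha
    refine (mul_le_mul_right ha _).trans ?_
    rw [← ENNReal.ofReal_mul hK]
    refine ENNReal.ofReal_le_ofReal (le_of_eq ?_)
    field_simp
  have h5 : ∀ K : ℝ, 0 ≤ K → ENNReal.ofReal (ε / 2 * (K / (K + 1))) < ENNReal.ofReal (ε / 2) := by
    intro K hK
    refine (ENNReal.ofReal_lt_ofReal_iff (by linarith)).2 ?_
    have : K / (K + 1) < 1 := by rw [div_lt_one (by positivity)]; linarith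
    nlinarith
  refine h1.trans_lt ?_
  rw [← add_halves ε, ENNReal.ofReal_add (by linarith) (by linarith)]
  exact ENNReal.add_lt_add ((h2.trans (h4 C hC0 _ hgt.le)).trans_lt (h5 C hC0))
    ((h3.trans (h4 M hM _ hhs.le)).trans_lt (h5 M hM))

variable {A : Set Ω}

theorem exists_mem_sets_of_upperNorm_lt {δ r : ℝ} (hδ : 0 < δ)
    (hr : m.upperNorm (g - h) < ENNReal.ofReal (δ / 2 * r)) :
    ∃ E ∈ m.sets, m.prob E < r ∧ ∀ ω, ω ∉ E → |g ω - h ω| ≤ δ := by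
  -- An intermediate `r'` turns the weak inequality of Chebyshev into the strict bound on `m.prob
  -- E`.
  obtain ⟨r', hr'0, hr', hr'r⟩ : ∃ r' : ℝ, 0 < r' ∧ m.upperNorm (g - h) < ENNReal.ofReal r' ∧
      r' < δ / 2 * r := by
    obtain ⟨r', h1, h2⟩ := ENNReal.lt_iff_exists_nnreal_btwn.1 hr
    have h3 : (r' : ℝ) < δ / 2 * r := by
      have := ENNReal.toReal_lt_of_lt_ofReal h2
      simpa using this
    refine ⟨r', ?_, by simpa using h1, h3⟩
    have : (0 : ℝ≥0∞) < r' := lt_of_le_of_lt zero_le h1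
    simpa using this
  have h1 := outer_le_of_upperNorm_lt hδ hr'
  have h2 : 2 / δ * r' < r := by
    calc 2 / δ * r' < 2 / δ * (δ / 2 * r) := by gcongr
      _ = r := by field_simp
  obtain ⟨E, hE, hEs, hEr⟩ := exists_of_outer_lt (h1.trans_lt h2)
  refine ⟨E, hE, hEr, fun ω hω => ?_⟩
  by_contra! hcon
  exact hω (hEs hcon)

/-- If a simple `s` is within `1 / 4` of the indicator of `A` off a small `E` in the algebra, then
`{1 / 2 < s}` with `E` removed, respectively added, encloses `A`. Membership in the completion
thereby becomes a statement about `L¹(m)`. -/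
theorem mem_completion_iff : A ∈ m.completion ↔ m.IsIntegrable (A.indicator fun _ => 1) := by
  constructor
  · intro hA
    refine isIntegrable_iff.2 fun ε hε => ?_
    obtain ⟨B, hB, D, hD, hBA, hAD, hlt⟩ := hA ε hε
    refine ⟨_, isSimpleMap_indicator hB 1, (upperNorm_le_of_support (C := 1) (E := D \ B)
      zero_le_one (fun ω => ?_) fun ω hω => ?_).trans_lt ((ENNReal.ofReal_lt_ofReal_iff hε).2 ?_)⟩
    · by_cases h1 : ω ∈ A <;> by_cases h2 : ω ∈ B <;> simp [h1, h2]
    · by_cases h1 : ω ∈ A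
      · have h2 : ω ∈ B := by
          by_contra h2
          exact hω ⟨hAD h1, h2⟩
        simp [h1, h2]
      · have h2 : ω ∉ B := fun h2 => h1 (hBA h2)
        simp [h1, h2]
    · rwa [one_mul, outer_of_mem (m.isSetAlgebra.sdiff_mem hD hB)]
  · intro hA ε hε
    obtain ⟨s, hs, hAs⟩ := isIntegrable_iff.1 hA (1 / 4 / 2 * ε) (by positivity)
    obtain ⟨E, hE, hEε, hEs⟩ := exists_mem_sets_of_upperNorm_lt (by norm_num) hAs
    have hS : {ω | 1 / 2 < s ω} ∈ m.sets := hs.simpleMap.preimage_mem (Set.Ioi (1 / 2))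
    refine ⟨_, m.isSetAlgebra.sdiff_mem hS hE, _, m.isSetAlgebra.union_mem hS hE,
      fun ω hω => ?_, fun ω hω => ?_, lt_of_le_of_lt (m.prob_mono (m.isSetAlgebra.sdiff_mem
        (m.isSetAlgebra.union_mem hS hE) (m.isSetAlgebra.sdiff_mem hS hE)) hE ?_) hEε⟩
    · by_contra hA'
      have h1 := hEs ω hω.2
      rw [Set.indicator_of_notMem hA', zero_sub, abs_neg] at h1
      have h2 : 1 / 2 < s ω := hω.1
      linarith [le_abs_self (s ω)]
    · by_contra hcon
      simp only [Set.mem_union, Set.mem_ofPred_eq, not_or, not_lt] at hcon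
      have h1 := hEs ω hcon.2
      rw [Set.indicator_of_mem hω] at h1
      linarith [(abs_le.1 h1).2]
    · intro ω hω
      simp only [Set.mem_sdiff, Set.mem_union] at hω
      tauto

theorem mem_completion_of_mem (hA : A ∈ m.sets) : A ∈ m.completion :=
  mem_completion_iff.2 (IsSimple.isIntegrable (isSimpleMap_indicator hA 1))

theorem indicator_one_mul (A : Set Ω) (g : Ω → ℝ) :
    (fun ω => A.indicator (fun _ => 1) ω * g ω) = A.indicator g := by
  classical
  ext ω
  by_cases h : ω ∈ A <;> simp [h]

theorem IsIntegrable.indicator (hg : m.IsIntegrable g) (hA : A ∈ m.completion) :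
    m.IsIntegrable (A.indicator g) := by
  classical
  rw [← indicator_one_mul]
  refine hg.mul_of_bounded (mem_completion_iff.1 hA) (C := 1) fun ω => ?_
  by_cases h : ω ∈ A <;> simp [h]

theorem isNullOn_iff : m.IsNullOn A g ↔ m.upperNorm (A.indicator g) = 0 := by
  classical
  rw [upperNorm_eq_zero_iff]
  refine forall₂_congr fun c hc => ?_
  have : A ∩ {ω | c < |g ω|} = {ω | c < |A.indicator g ω|} := by
    ext ω
    by_cases h : ω ∈ A <;> simp [h, hc.le]
  rw [this]

/-- The monotone function `t ↦ m^*(g > t)` has a continuity point `t` in `(a, b)`. There, superlevel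
sets of a simple approximation at the levels `t ± δ / 8`, corrected by a small set `E`, enclose `{t
< g}` with small difference. These sets are the source of the clopen subsets of `S`. -/
theorem exists_superlevel_mem_completion (hg : m.IsIntegrable g) {a b : ℝ} (hab : a < b) :
    ∃ t ∈ Set.Ioo a b, {ω | t < g ω} ∈ m.completion := by
  let F : ℝ → ℝ := fun t => m.outer {ω | t < g ω}
  have hF : Antitone F := fun s t hst => outer_mono fun ω (hω : t < g ω) => lt_of_le_of_lt hst hω
  obtain ⟨t, ht, htc⟩ : ∃ t ∈ Set.Ioo a b, ContinuousAt F t := by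
    obtain ⟨t, ht, hab⟩ := (hF.countable_not_continuousAt.dense_compl ℝ).exists_between hab
    exact ⟨t, hab, by simpa using ht⟩
  refine ⟨t, ht, fun ε hε => ?_⟩
  obtain ⟨δ, hδ, hδF⟩ := Metric.continuousAt_iff.1 htc (ε / 6) (by positivity)
  have hδ' : 0 < δ / 8 := by positivity
  obtain ⟨s, hs, hgs⟩ := isIntegrable_iff.1 hg (δ / 8 / 2 * (ε / 6)) (by positivity)
  obtain ⟨E, hE, hEε, hEs⟩ := exists_mem_sets_of_upperNorm_lt hδ' hgs
  have hS : ∀ c, {ω | c < s ω} ∈ m.sets := fun c => hs.simpleMap.preimage_mem (Set.Ioi c)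
  have hE' : ∀ ω, ω ∉ E → g ω - s ω ≤ δ / 8 ∧ s ω - g ω ≤ δ / 8 := fun ω hω => by
    have := abs_le.1 (hEs ω hω)
    constructor <;> linarith
  have hup : m.prob {ω | t - δ / 8 < s ω} < F (t - δ / 2) + ε / 6 := by
    rw [← outer_of_mem (hS _)]
    have h1 : {ω | t - δ / 8 < s ω} ⊆ {ω | t - δ / 2 < g ω} ∪ E := by
      intro ω hω
      by_cases hωE : ω ∈ E
      · exact Or.inr hωE
      · refine Or.inl ?_
        simp only [Set.mem_ofPred_eq] at hω ⊢
        linarith [(hE' ω hωE).2]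
    have h2 := (outer_mono (m := m) h1).trans (outer_union_le _ _)
    rw [outer_of_mem hE] at h2
    exact h2.trans_lt (by simp only [F]; linarith)
  have hlow : F (t + δ / 2) < m.prob {ω | t + δ / 8 < s ω} + ε / 6 := by
    rw [← outer_of_mem (hS _)]
    have h1 : {ω | t + δ / 2 < g ω} ⊆ {ω | t + δ / 8 < s ω} ∪ E := by
      intro ω hω
      by_cases hωE : ω ∈ E
      · exact Or.inr hωE
      · refine Or.inl ?_
        simp only [Set.mem_ofPred_eq] at hω ⊢
        linarith [(hE' ω hωE).1]
    have h2 := (outer_mono (m := m) h1).trans (outer_union_le _ _)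
    rw [outer_of_mem hE] at h2
    exact h2.trans_lt (by linarith)
  have hF1 := abs_lt.1 (Real.dist_eq _ _ ▸ hδF (x := t - δ / 2) (by
    rw [Real.dist_eq, sub_sub_cancel_left, abs_neg, abs_of_pos (by linarith)]; linarith))
  have hF2 := abs_lt.1 (Real.dist_eq _ _ ▸ hδF (x := t + δ / 2) (by
    rw [Real.dist_eq, add_sub_cancel_left, abs_of_pos (by linarith)]; linarith))
  have hd := m.prob_add_sdiff (hS (t + δ / 8)) (hS (t - δ / 8)) (fun ω hω => by
    simp only [Set.mem_ofPred_eq] at hω ⊢; linarith)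
  have hA := m.isSetAlgebra.sdiff_mem (hS (t + δ / 8)) hE
  have hB := m.isSetAlgebra.union_mem (hS (t - δ / 8)) hE
  have hD := m.isSetAlgebra.sdiff_mem (hS (t - δ / 8)) (hS (t + δ / 8))
  refine ⟨_, hA, _, hB, fun ω hω => ?_, fun ω hω => ?_, ?_⟩
  · have h1 : t + δ / 8 < s ω := hω.1
    simp only [Set.mem_ofPred_eq]
    linarith [(hE' ω hω.2).2]
  · by_cases hωE : ω ∈ E
    · exact Or.inr hωE
    · refine Or.inl ?_
      simp only [Set.mem_ofPred_eq] at hω ⊢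
      linarith [(hE' ω hωE).1]
  -- Five errors of at most `ε / 6` add up: two from the continuity of `F`, one each from `hup` and
  -- `hlow`, and the measure of `E`.
  · have h1 := m.prob_mono (m.isSetAlgebra.sdiff_mem hB hA) (m.isSetAlgebra.union_mem hD hE)
      (fun ω hω => by
        simp only [Set.mem_sdiff, Set.mem_union] at hω ⊢
        tauto)
    have h2 := m.prob_union_le hD hE
    linarith [hF1.1, hF1.2, hF2.1, hF2.2]

end FinAddProb
-- Compactifications and the Riesz measure
/-- A uniformly closed algebra of bounded functions containing the constants is the algebra of
continuous functions on a compactification. -/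
theorem exists_compactification.{w} {Z : Type w} (B : Set (Z → ℝ)) (hconst : ∀ c : ℝ, (fun _ => c) ∈ B)
    (hadd : ∀ G ∈ B, ∀ H ∈ B, G + H ∈ B) (hmul : ∀ G ∈ B, ∀ H ∈ B, G * H ∈ B)
    (hbdd : ∀ H ∈ B, ∃ C : ℝ, ∀ z, |H z| ≤ C)
    (hclosed : ∀ H : Z → ℝ, (∀ ε > 0, ∃ G ∈ B, ∀ z, |H z - G z| ≤ ε) → H ∈ B) :
    ∃ (S : Type w) (_ : TopologicalSpace S) (_ : CompactSpace S) (_ : T2Space S) (ι : Z → S)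
      (U : (Z → ℝ) → C(S, ℝ)), DenseRange ι ∧ (∀ H ∈ B, ∀ z, U H (ι z) = H z) ∧
      ∀ g : C(S, ℝ), (fun z => g (ι z)) ∈ B := by
  classical
  -- `S` is the closure of the image of `Z` in a product of bounded intervals, and `U H` is the
  -- coordinate function of index `H`.
  let ev : Z → B → ℝ := fun z H => H.1 z
  let S : Set (B → ℝ) := closure (Set.range ev)
  have hcomp : IsCompact S := by
    choose C hC using hbdd
    have hK : IsCompact (Set.univ.pi fun H : B => Set.Icc (-C H.1 H.2) (C H.1 H.2)) :=
      isCompact_univ_pi fun _ => isCompact_Icc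
    refine hK.of_isClosed_subset isClosed_closure (closure_minimal ?_ hK.isClosed)
    rintro _ ⟨z, rfl⟩ H -
    exact abs_le.1 (hC H.1 H.2 z)
  have : CompactSpace S := isCompact_iff_compactSpace.1 hcomp
  let ι : Z → S := fun z => ⟨ev z, subset_closure ⟨z, rfl⟩⟩
  have hdense : DenseRange ι := by
    rw [DenseRange, Subtype.dense_iff]
    intro s hs
    have : Subtype.val '' Set.range ι = Set.range ev := by
      rw [← Set.range_comp]; rfl
    rwa [this]
  let U : (Z → ℝ) → C(S, ℝ) := fun H =>
    if h : H ∈ B then ⟨fun s => s.1 ⟨H, h⟩, (continuous_apply _).comp continuous_subtype_val⟩ else 0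
  have hU : ∀ H (h : H ∈ B) (s : S), U H s = s.1 ⟨H, h⟩ := fun H h s => by simp [U, h]
  have hUι : ∀ H ∈ B, ∀ z, U H (ι z) = H z := fun H h z => hU H h (ι z)
  have hext : ∀ g g' : C(S, ℝ), (∀ z, g (ι z) = g' (ι z)) → g = g' := fun g g' h =>
    DFunLike.coe_injective (hdense.equalizer g.continuous g'.continuous (funext h))
  let A : Subalgebra ℝ C(S, ℝ) :=
    { carrier := U '' B
      mul_mem' := by
        rintro _ _ ⟨G, hG, rfl⟩ ⟨H, hH, rfl⟩
        exact ⟨_, hmul G hG H hH, hext _ _ fun z => by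
          simp [hUι _ (hmul G hG H hH), hUι _ hG, hUι _ hH]⟩
      add_mem' := by
        rintro _ _ ⟨G, hG, rfl⟩ ⟨H, hH, rfl⟩
        exact ⟨_, hadd G hG H hH, hext _ _ fun z => by
          simp [hUι _ (hadd G hG H hH), hUι _ hG, hUι _ hH]⟩
      algebraMap_mem' := fun c => ⟨_, hconst c, hext _ _ fun z => by simp [hUι _ (hconst c)]⟩ }
  have hsep : A.SeparatesPoints := by
    intro s t hst
    obtain ⟨H, hH⟩ : ∃ H, s.1 H ≠ t.1 H := by
      by_contra! hcon
      exact hst (Subtype.ext (funext hcon))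
    exact ⟨U H.1, ⟨_, ⟨_, H.2, rfl⟩, rfl⟩, by rwa [hU _ H.2, hU _ H.2]⟩
  -- By Stone–Weierstrass each `g` is a uniform limit of functions `U G`, so its restriction to `Z`
  -- is a uniform limit of members of `B`.
  have htop := ContinuousMap.subalgebra_topologicalClosure_eq_top_of_separatesPoints A hsep
  refine ⟨S, inferInstance, inferInstance, inferInstance, ι, U, hdense, hUι, fun g => ?_⟩
  refine hclosed _ fun ε hε => ?_
  have hg : g ∈ closure (A : Set C(S, ℝ)) := by
    rw [← Subalgebra.topologicalClosure_coe, htop]; trivial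
  obtain ⟨_, ⟨G, hG, rfl⟩, hgG⟩ := Metric.mem_closure_iff.1 hg ε hε
  refine ⟨G, hG, fun z => ?_⟩
  rw [← hUι G hG z, ← Real.dist_eq]
  exact (ContinuousMap.dist_apply_le_dist _).trans hgG.le

/-- The Riesz representation theorem for positive functionals on `C(S)`, `S` compact. -/
theorem exists_regular_measure_of_positive {S : Type*} [TopologicalSpace S] [CompactSpace S]
    [T2Space S] [MeasurableSpace S] [BorelSpace S] (L : C(S, ℝ) →ₗ[ℝ] ℝ)
    (hL : ∀ g : C(S, ℝ), (∀ s, 0 ≤ g s) → 0 ≤ L g) :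
    ∃ lam : Measure S, lam.Regular ∧ IsFiniteMeasure lam ∧ ∀ g : C(S, ℝ), ∫ s, g s ∂lam = L g := by
  let L' : CompactlySupportedContinuousMap S ℝ →ₚ[ℝ] ℝ := PositiveLinearMap.mk₀
    { toFun := fun g => L g.toContinuousMap
      map_add' := fun g h => L.map_add _ _
      map_smul' := fun c g => L.map_smul _ _ } fun g hg => hL _ hg
  refine ⟨RealRMK.rieszMeasure L', inferInstance, inferInstance, fun g => ?_⟩
  exact RealRMK.integral_rieszMeasure L' ⟨g, HasCompactSupport.of_compactSpace _⟩

/-! ### The space `Λ(m,f)` and its bounded part -/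

namespace FinAddProb

section Lambda

variable {Ω X : Type*} {m : FinAddProb Ω} {f : Ω → X}
  {H G : Ω × X → ℝ}

/-- The function `H(f)`. -/
def onGraph (f : Ω → X) (H : Ω × X → ℝ) : Ω → ℝ := fun ω => H (ω, f ω)

theorem const_mem_laBdd (c : ℝ) : (fun _ => c) ∈ m.LaBdd f :=
  ⟨(isSimple_const c).isIntegrable, |c|, fun _ => le_rfl⟩

theorem add_mem_la (hH : H ∈ m.La f) (hG : G ∈ m.La f) : H + G ∈ m.La f := IsIntegrable.add hH hG

theorem smul_mem_la (c : ℝ) (hH : H ∈ m.La f) : c • H ∈ m.La f := IsIntegrable.const_mul hH c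

theorem sup_mem_la (hH : H ∈ m.La f) (hG : G ∈ m.La f) : H ⊔ G ∈ m.La f := IsIntegrable.sup hH hG

theorem inf_mem_la (hH : H ∈ m.La f) (hG : G ∈ m.La f) : H ⊓ G ∈ m.La f := IsIntegrable.inf hH hG

theorem add_mem_laBdd (hH : H ∈ m.LaBdd f) (hG : G ∈ m.LaBdd f) : H + G ∈ m.LaBdd f := by
  refine ⟨add_mem_la hH.1 hG.1, ?_⟩
  obtain ⟨⟨-, C, hC⟩, ⟨-, D, hD⟩⟩ := hH, hG
  exact ⟨C + D, fun p => (abs_add_le _ _).trans (add_le_add (hC p) (hD p))⟩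

theorem mul_mem_laBdd (hH : H ∈ m.LaBdd f) (hG : G ∈ m.LaBdd f) : H * G ∈ m.LaBdd f := by
  obtain ⟨⟨h1, C, hC⟩, ⟨h2, D, hD⟩⟩ := hH, hG
  refine ⟨IsIntegrable.mul_of_bounded h2 h1 fun ω => hC _, C * D, fun p => ?_⟩
  rw [Pi.mul_apply, abs_mul]
  exact mul_le_mul (hC p) (hD p) (abs_nonneg _) ((abs_nonneg _).trans (hC p))

theorem smul_mem_laBdd (c : ℝ) (hH : H ∈ m.LaBdd f) : c • H ∈ m.LaBdd f :=
  mul_mem_laBdd (const_mem_laBdd c) hH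

theorem sup_mem_laBdd (hH : H ∈ m.LaBdd f) (hG : G ∈ m.LaBdd f) : H ⊔ G ∈ m.LaBdd f := by
  refine ⟨sup_mem_la hH.1 hG.1, ?_⟩
  obtain ⟨⟨-, C, hC⟩, ⟨-, D, hD⟩⟩ := hH, hG
  exact ⟨C ⊔ D, fun p => (abs_max_le_max_abs_abs).trans (sup_le_sup (hC p) (hD p))⟩

theorem inf_mem_laBdd (hH : H ∈ m.LaBdd f) (hG : G ∈ m.LaBdd f) : H ⊓ G ∈ m.LaBdd f := by
  refine ⟨inf_mem_la hH.1 hG.1, ?_⟩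
  obtain ⟨⟨-, C, hC⟩, ⟨-, D, hD⟩⟩ := hH, hG
  exact ⟨C ⊔ D, fun p => (abs_min_le_max_abs_abs).trans (sup_le_sup (hC p) (hD p))⟩

theorem truncReal_mem_laBdd (hH : H ∈ m.La f) (k : ℕ) :
    (fun z => truncReal k (H z)) ∈ m.LaBdd f :=
  ⟨IsIntegrable.truncReal hH k, k, fun _ => abs_truncReal_le k.cast_nonneg _⟩

theorem mem_laBdd_of_uniform_approx
    (h : ∀ ε > 0, ∃ G ∈ m.LaBdd f, ∀ z, |H z - G z| ≤ ε) : H ∈ m.LaBdd f := by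
  refine ⟨isIntegrable_of_approx fun ε hε => ?_, ?_⟩
  · obtain ⟨G, hG, hHG⟩ := h (ε / 2) (by linarith)
    refine ⟨_, hG.1, (upperNorm_le_const (C := ε / 2) fun ω => hHG _).trans_lt ?_⟩
    exact (ENNReal.ofReal_lt_ofReal_iff hε).2 (by linarith)
  · obtain ⟨G, ⟨-, C, hC⟩, hHG⟩ := h 1 one_pos
    refine ⟨1 + C, fun p => ?_⟩
    have := abs_add_le (H p - G p) (G p)
    rw [sub_add_cancel] at this
    linarith [hC p, hHG p]

/-- The indicator of `A × X`. -/
def cylinder (A : Set Ω) : Ω × X → ℝ := fun z => A.indicator (fun _ => 1) z.1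

theorem cylinder_mem_laBdd {A : Set Ω} (hA : A ∈ m.completion) : cylinder A ∈ m.LaBdd f := by
  classical
  refine ⟨mem_completion_iff.1 hA, 1, fun p => ?_⟩
  by_cases h : p.1 ∈ A <;> simp [cylinder, h]

theorem onGraph_cylinder_mul (A : Set Ω) (H : Ω × X → ℝ) :
    onGraph f (cylinder A * H) = A.indicator (onGraph f H) := indicator_one_mul A _

theorem completion_compl {A : Set Ω} (hA : A ∈ m.completion) : Aᶜ ∈ m.completion := by
  classical
  rw [mem_completion_iff] at hA ⊢
  convert (isSimple_const (m := m) 1).isIntegrable.sub hA using 1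
  ext ω
  by_cases h : ω ∈ A <;> simp [h]

theorem completion_inter {A B : Set Ω} (hA : A ∈ m.completion) (hB : B ∈ m.completion) :
    A ∩ B ∈ m.completion := by
  classical
  rw [mem_completion_iff] at hA hB ⊢
  convert hA.inf hB using 1
  ext ω
  by_cases h : ω ∈ A <;> by_cases h' : ω ∈ B <;> simp [h, h']

theorem tendsto_toReal_upperNorm_truncReal (hH : H ∈ m.La f) :
    Tendsto (fun k : ℕ => (m.upperNorm (onGraph f H -
      onGraph f fun z => truncReal k (H z))).toReal) atTop (𝓝 0) :=
  (ENNReal.tendsto_toReal ENNReal.zero_ne_top).comp (IsIntegrable.tendsto_truncReal hH)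

theorem upperNorm_onGraph_sub_ne_top (hH : H ∈ m.La f) (hG : G ∈ m.La f) :
    m.upperNorm (onGraph f H - onGraph f G) ≠ ⊤ :=
  (IsIntegrable.sub hH hG).upperNorm_ne_top

theorem toReal_upperNorm_sub_le {K : Ω × X → ℝ} (hH : H ∈ m.La f) (hG : G ∈ m.La f)
    (hK : K ∈ m.La f) : (m.upperNorm (onGraph f H - onGraph f K)).toReal ≤
    (m.upperNorm (onGraph f H - onGraph f G)).toReal +
      (m.upperNorm (onGraph f G - onGraph f K)).toReal := by
  rw [← ENNReal.toReal_add (upperNorm_onGraph_sub_ne_top hH hG)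
    (upperNorm_onGraph_sub_ne_top hG hK)]
  exact ENNReal.toReal_mono (ENNReal.add_ne_top.2 ⟨upperNorm_onGraph_sub_ne_top hH hG,
    upperNorm_onGraph_sub_ne_top hG hK⟩) (upperNorm_sub_le _ _ _)

end Lambda

/-! ### Representation of bounded functions -/

/-- `U` extends the functions in `Λ_b(m,f)` continuously to a compactification of `Ω × X`, and
`lam` represents the integral of these extensions. -/
structure IsBoundedRep {Ω X S : Type*}
    [TopologicalSpace S] [MeasurableSpace S] (m : FinAddProb Ω) (f : Ω → X)
    (lam : Measure S) (ι : Ω × X → S) (U : (Ω × X → ℝ) → C(S, ℝ)) : Prop where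
  dense : DenseRange ι
  eval : ∀ H ∈ m.LaBdd f, ∀ z, U H (ι z) = H z
  mem : ∀ g : C(S, ℝ), (fun z => g (ι z)) ∈ m.LaBdd f
  integral : ∀ H ∈ m.LaBdd f, ∫ s, U H s ∂lam = m.integral (onGraph f H)

/-- The compactification is of `Ω × X`, not of `Ω`: `U` has to be injective on functions that may
differ only off the graph of `f`. The functional represented by `lam` integrates along the graph
alone. -/
theorem exists_isBoundedRep {Ω : Type u} {X : Type v}
    (m : FinAddProb Ω) (f : Ω → X) :
    ∃ (S : Type (max u v)) (_ : TopologicalSpace S) (_ : CompactSpace S) (_ : T2Space S)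
      (_ : MeasurableSpace S) (_ : BorelSpace S) (lam : Measure S) (_ : lam.Regular)
      (_ : IsProbabilityMeasure lam) (ι : Ω × X → S) (U : (Ω × X → ℝ) → C(S, ℝ)),
      IsBoundedRep m f lam ι U := by
  obtain ⟨S, _, _, _, ι, U, hd, hU, hmem⟩ := exists_compactification (m.LaBdd f)
    const_mem_laBdd (fun G hG H hH => add_mem_laBdd hG hH) (fun G hG H hH => mul_mem_laBdd hG hH)
    (fun H hH => hH.2) (fun H hH => mem_laBdd_of_uniform_approx hH)
  let _ : MeasurableSpace S := borel S
  have : BorelSpace S := ⟨rfl⟩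
  let L : C(S, ℝ) →ₗ[ℝ] ℝ :=
    { toFun := fun g => m.integral (onGraph f fun z => g (ι z))
      map_add' := fun g h => HasIntegral.integral_eq
        ((hmem g).1.hasIntegral.add (hmem h).1.hasIntegral)
      map_smul' := fun c g => HasIntegral.integral_eq ((hmem g).1.hasIntegral.const_mul c) }
  obtain ⟨lam, hreg, hfin, hlam⟩ := exists_regular_measure_of_positive L
    fun g hg => (hmem g).1.hasIntegral.nonneg fun ω => hg _
  have hprob : IsProbabilityMeasure lam := by
    constructor
    have h1 := hlam 1
    have h2 : L 1 = 1 := HasIntegral.integral_eq (hasIntegral_const 1)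
    simp only [ContinuousMap.one_apply, integral_const, smul_eq_mul, mul_one] at h1
    rw [h2, measureReal_def, ENNReal.toReal_eq_one_iff] at h1
    exact h1
  refine ⟨S, inferInstance, inferInstance, inferInstance, inferInstance, inferInstance, lam, hreg,
    hprob, ι, U, hd, hU, hmem, fun H hH => ?_⟩
  rw [hlam]
  change m.integral (onGraph f fun z => U H (ι z)) = _
  simp only [hU H hH]

namespace IsBoundedRep

variable {Ω X S : Type*}
    [TopologicalSpace S] [MeasurableSpace S] {m : FinAddProb Ω} {f : Ω → X}
    {lam : Measure S} {ι : Ω × X → S} {U : (Ω × X → ℝ) → C(S, ℝ)} {G H : Ω × X → ℝ}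

/-- By this density argument each algebraic identity for `U` need only be checked on the image of `Ω
× X`, where `U H` is `H`. -/
theorem ext (h : IsBoundedRep m f lam ι U) {g g' : C(S, ℝ)} (hg : ∀ z, g (ι z) = g' (ι z)) :
    g = g' :=
  DFunLike.coe_injective (h.dense.equalizer g.continuous g'.continuous (funext hg))

theorem map_restrict (h : IsBoundedRep m f lam ι U) (g : C(S, ℝ)) : U (fun z => g (ι z)) = g :=
  h.ext fun z => h.eval _ (h.mem g) z

theorem map_const (h : IsBoundedRep m f lam ι U) (c : ℝ) : U (fun _ => c) = .const S c :=
  h.ext fun z => h.eval _ (const_mem_laBdd c) z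

theorem map_add (h : IsBoundedRep m f lam ι U) (hH : H ∈ m.LaBdd f) (hG : G ∈ m.LaBdd f) :
    U (H + G) = U H + U G :=
  h.ext fun z => by simp [h.eval _ hH, h.eval _ hG, h.eval _ (add_mem_laBdd hH hG)]

theorem map_mul (h : IsBoundedRep m f lam ι U) (hH : H ∈ m.LaBdd f) (hG : G ∈ m.LaBdd f) :
    U (H * G) = U H * U G :=
  h.ext fun z => by simp [h.eval _ hH, h.eval _ hG, h.eval _ (mul_mem_laBdd hH hG)]

theorem map_smul (h : IsBoundedRep m f lam ι U) (c : ℝ) (hH : H ∈ m.LaBdd f) :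
    U (c • H) = c • U H :=
  h.ext fun z => by simp [h.eval _ hH, h.eval _ (smul_mem_laBdd c hH)]

theorem map_sup (h : IsBoundedRep m f lam ι U) (hH : H ∈ m.LaBdd f) (hG : G ∈ m.LaBdd f) :
    U (H ⊔ G) = U H ⊔ U G :=
  h.ext fun z => by simp [h.eval _ hH, h.eval _ hG, h.eval _ (sup_mem_laBdd hH hG)]

theorem map_inf (h : IsBoundedRep m f lam ι U) (hH : H ∈ m.LaBdd f) (hG : G ∈ m.LaBdd f) :
    U (H ⊓ G) = U H ⊓ U G :=
  h.ext fun z => by simp [h.eval _ hH, h.eval _ hG, h.eval _ (inf_mem_laBdd hH hG)]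

theorem bijOn (h : IsBoundedRep m f lam ι U) : Set.BijOn U (m.LaBdd f) Set.univ := by
  refine ⟨fun _ _ => trivial, fun G hG H hH hGH => ?_, fun g _ => ⟨_, h.mem g, h.map_restrict g⟩⟩
  ext z
  rw [← h.eval _ hG, ← h.eval _ hH, hGH]

variable [CompactSpace S] [BorelSpace S] [IsProbabilityMeasure lam]

/-- `U` commutes with absolute values, so the norm in `L¹(lam)` is the integral of `U |H|`, that is,
of `|H(f)|`. -/
theorem norm_toLp (h : IsBoundedRep m f lam ι U) (hH : H ∈ m.LaBdd f) :
    ‖ContinuousMap.toLp 1 lam ℝ (U H)‖ = (m.upperNorm (onGraph f H)).toReal := by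
  have h1 : (fun z => |H z|) ∈ m.LaBdd f :=
    ⟨IsIntegrable.abs hH.1, hH.2.imp fun C hC p => by rw [abs_abs]; exact hC p⟩
  have h2 : U (fun z => |H z|) = |U H| := h.ext fun z => by simp [h.eval _ hH, h.eval _ h1]
  change _ = (m.upperNorm fun ω => H (ω, f ω)).toReal
  rw [L1.norm_eq_integral_norm, ← (IsIntegrable.hasIntegral_abs hH.1).integral_eq]
  have h3 := h.integral _ h1
  rw [h2] at h3
  refine Eq.trans (integral_congr_ae ?_) h3
  filter_upwards [ContinuousMap.coeFn_toLp (p := 1) (𝕜 := ℝ) lam (U H)] with s hs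
  rw [hs]; rfl

theorem norm_toLp_sub (h : IsBoundedRep m f lam ι U) (hH : H ∈ m.LaBdd f) (hG : G ∈ m.LaBdd f) :
    ‖ContinuousMap.toLp 1 lam ℝ (U H) - ContinuousMap.toLp 1 lam ℝ (U G)‖ =
      (m.upperNorm (onGraph f H - onGraph f G)).toReal := by
  have h1 : H + (-1 : ℝ) • G ∈ m.LaBdd f := add_mem_laBdd hH (smul_mem_laBdd _ hG)
  have h2 : U (H + (-1 : ℝ) • G) = U H - U G := by
    rw [h.map_add hH (smul_mem_laBdd _ hG), h.map_smul _ hG]; simp [sub_eq_add_neg]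
  rw [← _root_.map_sub, ← h2, h.norm_toLp h1]
  congr 2
  ext ω
  simp [onGraph, sub_eq_add_neg]

end IsBoundedRep

/-! ### Extension to unbounded functions -/

/-- `T` is the `L¹` isometric extension of `U` to `Λ(m,f)`. -/
structure IsExtension {Ω X S : Type*}
    [TopologicalSpace S] [CompactSpace S] [MeasurableSpace S] [BorelSpace S] (m : FinAddProb Ω)
    (f : Ω → X) (lam : Measure S) [IsProbabilityMeasure lam] (ι : Ω × X → S)
    (U : (Ω × X → ℝ) → C(S, ℝ)) (T : (Ω × X → ℝ) → Lp ℝ 1 lam) : Prop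
    extends IsBoundedRep m f lam ι U where
  norm_sub : ∀ H ∈ m.La f, ∀ G ∈ m.LaBdd f, ‖T H - ContinuousMap.toLp 1 lam ℝ (U G)‖ =
    (m.upperNorm (onGraph f H - onGraph f G)).toReal

section

variable {Ω X S : Type*}
    [TopologicalSpace S] [CompactSpace S] [MeasurableSpace S] [BorelSpace S] {m : FinAddProb Ω}
    {f : Ω → X} {lam : Measure S} [IsProbabilityMeasure lam] {ι : Ω × X → S}
    {U : (Ω × X → ℝ) → C(S, ℝ)} {T : (Ω × X → ℝ) → Lp ℝ 1 lam} {G H : Ω × X → ℝ}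

/-- Truncations of `H` converge to `H` in the upper norm, so their images are Cauchy in `L¹(lam)`.
The limit has the right distance to every bounded element, and those distances determine it. -/
theorem IsBoundedRep.exists_isExtension (h : IsBoundedRep m f lam ι U) :
    ∃ T, IsExtension m f lam ι U T := by
  have key : ∀ H ∈ m.La f, ∃ F : Lp ℝ 1 lam, ∀ G ∈ m.LaBdd f,
      ‖F - ContinuousMap.toLp 1 lam ℝ (U G)‖ =
        (m.upperNorm (onGraph f H - onGraph f G)).toReal := by
    intro H hH
    have h0 := tendsto_toReal_upperNorm_truncReal hH
    have hmem := fun k : ℕ => truncReal_mem_laBdd hH k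
    have hcau : CauchySeq fun k : ℕ =>
        ContinuousMap.toLp 1 lam ℝ (U fun z => truncReal k (H z)) := by
      rw [cauchySeq_iff_tendsto_dist_atTop_0]
      have h1 := (h0.comp tendsto_fst).add (h0.comp tendsto_snd)
      rw [prod_atTop_atTop_eq, add_zero] at h1
      refine squeeze_zero (fun _ => dist_nonneg) (fun p => ?_) h1
      rw [dist_eq_norm, h.norm_toLp_sub (hmem _) (hmem _)]
      refine (toReal_upperNorm_sub_le (hmem _).1 hH (hmem _).1).trans ?_
      rw [upperNorm_sub_comm]
      rfl
    obtain ⟨F, hF⟩ := cauchySeq_tendsto_of_complete hcau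
    refine ⟨F, fun G hG => ?_⟩
    have h1 := (hF.sub_const (ContinuousMap.toLp 1 lam ℝ (U G))).norm
    refine tendsto_nhds_unique h1 ?_
    simp only [h.norm_toLp_sub (hmem _) hG]
    rw [tendsto_iff_dist_tendsto_zero]
    refine squeeze_zero (fun _ => dist_nonneg) (fun k => ?_) h0
    rw [Real.dist_eq, abs_sub_le_iff]
    constructor
    · rw [upperNorm_sub_comm (onGraph f H) (onGraph f fun z => truncReal k (H z))]
      linarith [toReal_upperNorm_sub_le (hmem k).1 hH hG.1]
    · linarith [toReal_upperNorm_sub_le hH (hmem k).1 hG.1]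
  choose! T hT using key
  exact ⟨T, h, hT⟩

namespace IsExtension

theorem map_bounded (h : IsExtension m f lam ι U T) (hH : H ∈ m.LaBdd f) :
    T H = ContinuousMap.toLp 1 lam ℝ (U H) := by
  rw [← sub_eq_zero, ← norm_eq_zero, h.norm_sub H hH.1 H hH, sub_self, upperNorm_zero,
    ENNReal.toReal_zero]

theorem map_bounded_ae (h : IsExtension m f lam ι U T) (hH : H ∈ m.LaBdd f) :
    T H =ᵐ[lam] U H := by
  rw [h.map_bounded hH]
  exact ContinuousMap.coeFn_toLp (p := 1) (𝕜 := ℝ) lam (U H)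

theorem tendsto (h : IsExtension m f lam ι U T) (hH : H ∈ m.La f) {K : ℕ → Ω × X → ℝ}
    (hK : ∀ n, K n ∈ m.LaBdd f)
    (hlim : Tendsto (fun n => m.upperNorm (onGraph f H - onGraph f (K n))) atTop (𝓝 0)) :
    Tendsto (fun n => ContinuousMap.toLp 1 lam ℝ (U (K n))) atTop (𝓝 (T H)) := by
  rw [tendsto_iff_dist_tendsto_zero]
  refine ((ENNReal.tendsto_toReal ENNReal.zero_ne_top).comp hlim).congr fun n => ?_
  rw [dist_comm, dist_eq_norm, h.norm_sub H hH _ (hK n)]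
  rfl

theorem tendsto_truncReal (h : IsExtension m f lam ι U T) (hH : H ∈ m.La f) :
    Tendsto (fun k : ℕ => ContinuousMap.toLp 1 lam ℝ (U fun z => truncReal k (H z))) atTop
      (𝓝 (T H)) :=
  h.tendsto hH (fun k => truncReal_mem_laBdd hH k) (IsIntegrable.tendsto_truncReal hH)

/-- A nonexpansive operation applied to truncations converges to the operation applied to the
functions; sums, suprema and infima are treated alike. -/
theorem tendsto_binary (h : IsExtension m f lam ι U T) (hH : H ∈ m.La f) (hG : G ∈ m.La f)
    {Φ : ℝ → ℝ → ℝ} (hΦ : ∀ a b a' b', |Φ a b - Φ a' b'| ≤ |a - a'| + |b - b'|)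
    (hmem : ∀ k : ℕ, (fun z => Φ (truncReal k (H z)) (truncReal k (G z))) ∈ m.LaBdd f) :
    Tendsto (fun k : ℕ => ContinuousMap.toLp 1 lam ℝ
      (U fun z => Φ (truncReal k (H z)) (truncReal k (G z)))) atTop
      (𝓝 (T fun z => Φ (H z) (G z))) := by
  have hint : (fun z => Φ (H z) (G z)) ∈ m.La f :=
    IsIntegrable.comp₂ (g := onGraph f H) (h := onGraph f G) hH hG Φ zero_le_one
      (by simpa using hΦ)
  refine h.tendsto hint hmem ?_
  have h1 := (IsIntegrable.tendsto_truncReal hH).add (IsIntegrable.tendsto_truncReal hG)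
  rw [add_zero] at h1
  exact tendsto_of_tendsto_of_tendsto_of_le_of_le tendsto_const_nhds h1 (fun _ => zero_le)
    fun k => upperNorm_le_add fun ω => hΦ _ _ _ _

theorem map_add (h : IsExtension m f lam ι U T) (hH : H ∈ m.La f) (hG : G ∈ m.La f) :
    T (H + G) = T H + T G := by
  have hmem := fun k : ℕ => truncReal_mem_laBdd hH k
  have hmem' := fun k : ℕ => truncReal_mem_laBdd hG k
  have h1 := h.tendsto_binary hH hG (Φ := fun a b => a + b)
    (fun a b a' b' => by rw [add_sub_add_comm]; exact abs_add_le _ _)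
    fun k => add_mem_laBdd (hmem k) (hmem' k)
  have h2 : ∀ k : ℕ, ContinuousMap.toLp 1 lam ℝ (U fun z => truncReal k (H z)) +
      ContinuousMap.toLp 1 lam ℝ (U fun z => truncReal k (G z)) =
      ContinuousMap.toLp 1 lam ℝ (U fun z => truncReal k (H z) + truncReal k (G z)) := by
    intro k
    rw [← _root_.map_add, ← h.toIsBoundedRep.map_add (hmem k) (hmem' k)]
    rfl
  exact tendsto_nhds_unique (((h.tendsto_truncReal hH).add (h.tendsto_truncReal hG)).congr h2) h1
    |>.symm

theorem toLp_sup (g g' : C(S, ℝ)) : ContinuousMap.toLp 1 lam ℝ (g ⊔ g') =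
    (ContinuousMap.toLp 1 lam ℝ g ⊔ ContinuousMap.toLp 1 lam ℝ g' : Lp ℝ 1 lam) := by
  apply Lp.ext
  filter_upwards [ContinuousMap.coeFn_toLp (p := 1) (𝕜 := ℝ) lam (g ⊔ g'),
    ContinuousMap.coeFn_toLp (p := 1) (𝕜 := ℝ) lam g,
    ContinuousMap.coeFn_toLp (p := 1) (𝕜 := ℝ) lam g',
    Lp.coeFn_sup (ContinuousMap.toLp 1 lam ℝ g) (ContinuousMap.toLp 1 lam ℝ g')] with s h1 h2 h3 h4
  rw [h1, h4, Pi.sup_apply, h2, h3, ContinuousMap.sup_apply]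

theorem toLp_inf (g g' : C(S, ℝ)) : ContinuousMap.toLp 1 lam ℝ (g ⊓ g') =
    (ContinuousMap.toLp 1 lam ℝ g ⊓ ContinuousMap.toLp 1 lam ℝ g' : Lp ℝ 1 lam) := by
  apply Lp.ext
  filter_upwards [ContinuousMap.coeFn_toLp (p := 1) (𝕜 := ℝ) lam (g ⊓ g'),
    ContinuousMap.coeFn_toLp (p := 1) (𝕜 := ℝ) lam g,
    ContinuousMap.coeFn_toLp (p := 1) (𝕜 := ℝ) lam g',
    Lp.coeFn_inf (ContinuousMap.toLp 1 lam ℝ g) (ContinuousMap.toLp 1 lam ℝ g')] with s h1 h2 h3 h4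
  rw [h1, h4, Pi.inf_apply, h2, h3, ContinuousMap.inf_apply]

theorem map_sup (h : IsExtension m f lam ι U T) (hH : H ∈ m.La f) (hG : G ∈ m.La f) :
    T (H ⊔ G) = T H ⊔ T G := by
  have hmem := fun k : ℕ => truncReal_mem_laBdd hH k
  have hmem' := fun k : ℕ => truncReal_mem_laBdd hG k
  refine tendsto_nhds_unique (h.tendsto_binary hH hG (Φ := fun a b => a ⊔ b)
    (fun a b a' b' => (abs_max_sub_max_le_max _ _ _ _).trans
      (max_le_add_of_nonneg (abs_nonneg _) (abs_nonneg _)))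
    fun k => sup_mem_laBdd (hmem k) (hmem' k))
    (((h.tendsto_truncReal hH).sup_nhds (h.tendsto_truncReal hG)).congr fun k => ?_)
  rw [← toLp_sup, ← h.toIsBoundedRep.map_sup (hmem k) (hmem' k)]
  rfl

theorem map_inf (h : IsExtension m f lam ι U T) (hH : H ∈ m.La f) (hG : G ∈ m.La f) :
    T (H ⊓ G) = T H ⊓ T G := by
  have hmem := fun k : ℕ => truncReal_mem_laBdd hH k
  have hmem' := fun k : ℕ => truncReal_mem_laBdd hG k
  refine tendsto_nhds_unique (h.tendsto_binary hH hG (Φ := fun a b => a ⊓ b)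
    (fun a b a' b' => (abs_min_sub_min_le_max _ _ _ _).trans
      (max_le_add_of_nonneg (abs_nonneg _) (abs_nonneg _)))
    fun k => inf_mem_laBdd (hmem k) (hmem' k))
    (((h.tendsto_truncReal hH).inf_nhds (h.tendsto_truncReal hG)).congr fun k => ?_)
  rw [← toLp_inf, ← h.toIsBoundedRep.map_inf (hmem k) (hmem' k)]
  rfl

theorem map_smul (h : IsExtension m f lam ι U T) (c : ℝ) (hH : H ∈ m.La f) :
    T (c • H) = c • T H := by
  have hmem := fun k : ℕ => truncReal_mem_laBdd hH k
  refine tendsto_nhds_unique (h.tendsto (K := fun k => c • fun z => truncReal k (H z))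
    (smul_mem_la c hH) (fun k => smul_mem_laBdd c (hmem k)) ?_)
    (((h.tendsto_truncReal hH).const_smul c).congr fun k => ?_)
  · have h1 := ENNReal.Tendsto.const_mul (a := ENNReal.ofReal |c|)
      (IsIntegrable.tendsto_truncReal hH) (Or.inr ENNReal.ofReal_ne_top)
    rw [mul_zero] at h1
    refine tendsto_of_tendsto_of_tendsto_of_le_of_le tendsto_const_nhds h1 (fun _ => zero_le)
      fun k => ?_
    have := upperNorm_le_mul_add (m := m) (h := onGraph f (c • H) - onGraph f
      (c • fun z => truncReal k (H z))) (g₁ := onGraph f H - onGraph f fun z => truncReal k (H z))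
      (g₂ := 0) (abs_nonneg c) fun ω => by simp [onGraph, ← mul_sub, abs_mul]
    simpa [upperNorm_zero] using! this
  · rw [h.toIsBoundedRep.map_smul c (hmem k), _root_.map_smul]

theorem norm_eq (h : IsExtension m f lam ι U T) (hH : H ∈ m.La f) :
    ‖T H‖ = (m.upperNorm (onGraph f H)).toReal := by
  have h1 := h.norm_sub H hH _ (const_mem_laBdd 0)
  have h2 : U (fun _ => 0) = 0 := h.map_const 0
  rw [h2, map_zero, sub_zero] at h1
  rw [h1]
  congr 2
  ext ω
  simp [onGraph]

/-- Truncation is a lattice expression in `H` and constants, hence commutes with `T`. -/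
theorem truncReal_ae (h : IsExtension m f lam ι U T) (hH : H ∈ m.La f) (k : ℕ) :
    U (fun z => truncReal k (H z)) =ᵐ[lam] fun s => truncReal k (T H s) := by
  have hc := fun c : ℝ => const_mem_laBdd (m := m) (f := f) c
  have h1 : (fun z => truncReal k (H z)) = (fun _ => -(k : ℝ)) ⊔ ((fun _ => (k : ℝ)) ⊓ H) := rfl
  have h2 := h.map_bounded_ae (truncReal_mem_laBdd hH k)
  rw [h1, h.map_sup (hc _).1 (inf_mem_la (hc _).1 hH), h.map_inf (hc _).1 hH] at h2
  filter_upwards [h2, Lp.coeFn_sup (T fun _ => -(k : ℝ)) (T (fun _ => (k : ℝ)) ⊓ T H),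
    Lp.coeFn_inf (T fun _ => (k : ℝ)) (T H), h.map_bounded_ae (hc (-k)),
    h.map_bounded_ae (hc k)] with s h2 h3 h4 h5 h6
  rw [h1, ← h2, h3, Pi.sup_apply, h4, Pi.inf_apply, h5, h6, h.map_const, h.map_const]
  rfl

/-- Applying `α` to the continuous functions `U (truncReal k (H i))` gives a continuous function on
`S` with the correct values on the image of `Ω × X`. -/
theorem truncReal_comp_ae (h : IsExtension m f lam ι U T) {n : ℕ} {H : Fin n → Ω × X → ℝ}
    (hH : ∀ i, H i ∈ m.La f) {α : (Fin n → ℝ) → ℝ} (hα : Continuous α) {k : ℕ}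
    (hmem : (fun p => α fun i => truncReal k (H i p)) ∈ m.LaBdd f) :
    U (fun p => α fun i => truncReal k (H i p)) =ᵐ[lam]
      fun s => α fun i => truncReal k (T (H i) s) := by
  let g : C(S, ℝ) := ⟨fun s => α fun i => U (fun p => truncReal k (H i p)) s,
    hα.comp (continuous_pi fun i => map_continuous _)⟩
  have h1 : U (fun p => α fun i => truncReal k (H i p)) = g := h.ext fun z => by
    rw [h.eval _ hmem]
    change _ = α fun i => U (fun p => truncReal k (H i p)) (ι z)
    congr 1
    ext i
    rw [h.eval _ (truncReal_mem_laBdd (hH i) k)]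
  rw [h1]
  filter_upwards [ae_all_iff.2 fun i => h.truncReal_ae (hH i) k] with s hs
  change (α fun i => U (fun p => truncReal k (H i p)) s) = _
  congr 1
  ext i
  exact hs i

/-- Let the truncation level grow in the previous identity. The left side converges in `L¹`, hence
a.e. along a subsequence; the right side converges pointwise because `α` is continuous. -/
theorem map_comp (h : IsExtension m f lam ι U T) {n : ℕ} {H : Fin n → Ω × X → ℝ}
    (hH : ∀ i, H i ∈ m.La f) {α : (Fin n → ℝ) → ℝ} (hα : Continuous α) {C : ℝ}
    (hC : ∀ y, |α y| ≤ C) :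
    T (fun p => α fun i => H i p) =ᵐ[lam] fun s => α fun i => T (H i) s := by
  have hmem : ∀ k : ℕ, (fun p => α fun i => truncReal k (H i p)) ∈ m.LaBdd f := fun k =>
    ⟨isIntegrable_comp (u := fun i ω => truncReal k (H i (ω, f ω))) hα hC
      fun i => (truncReal_mem_laBdd (hH i) k).1, C, fun p => hC _⟩
  have hint : (fun p => α fun i => H i p) ∈ m.La f :=
    isIntegrable_comp (u := fun i ω => H i (ω, f ω)) hα hC hH
  have hlim := h.tendsto hint hmem
    (tendsto_upperNorm_comp_truncReal (u := fun i ω => H i (ω, f ω)) hC hH)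
  obtain ⟨ns, hns, hae⟩ := (tendstoInMeasure_of_tendsto_Lp hlim).exists_seq_tendsto_ae
  filter_upwards [hae, ae_all_iff.2 fun k => h.truncReal_comp_ae hH hα (hmem k),
    ae_all_iff.2 fun k : ℕ => ContinuousMap.coeFn_toLp (p := 1) (𝕜 := ℝ) lam
      (U fun p => α fun i => truncReal k (H i p))] with s h1 h2 h3
  refine tendsto_nhds_unique (h1.congr fun j => (h3 _).trans (h2 _)) ?_
  exact (hα.tendsto _).comp (tendsto_pi_nhds.2 fun i =>
    (truncReal_tendsto (T (H i) s)).comp hns.tendsto_atTop)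

end IsExtension
end
end FinAddProb
-- The homomorphism `χ`, clopen sets and null sets
theorem measurable_of_exists_between {S : Type*} [MeasurableSpace S] {g : S → ℝ}
    (h : ∀ a b : ℝ, a < b → ∃ E : Set S, MeasurableSet E ∧ {s | b ≤ g s} ⊆ E ∧ E ⊆ {s | a < g s}) :
    Measurable g := by
  refine measurable_of_Ioi fun a => ?_
  choose E hE h1 h2 using fun n : ℕ => h a (a + 1 / (n + 1)) (by simp; positivity)
  have : g ⁻¹' Set.Ioi a = ⋃ n, E n := by
    refine Set.Subset.antisymm (fun s hs => ?_) (Set.iUnion_subset h2)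
    have hs' : a < g s := hs
    obtain ⟨n, hn⟩ := exists_nat_one_div_lt (sub_pos.2 hs')
    exact Set.mem_iUnion.2 ⟨n, h1 n (by simp only [Set.mem_ofPred_eq]; linarith)⟩
  rw [this]
  exact MeasurableSet.iUnion hE

namespace FinAddProb
namespace IsExtension

variable {Ω X S : Type*}
    [TopologicalSpace S] [CompactSpace S] [MeasurableSpace S] [BorelSpace S] {m : FinAddProb Ω}
    {f : Ω → X} {lam : Measure S} [IsProbabilityMeasure lam] {ι : Ω × X → S}
    {U : (Ω × X → ℝ) → C(S, ℝ)} {T : (Ω × X → ℝ) → Lp ℝ 1 lam} {G H : Ω × X → ℝ} {A B : Set Ω}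

/-- The clopen subset of `S` which represents `A`. -/
def chi (U : (Ω × X → ℝ) → C(S, ℝ)) (A : Set Ω) : Set S := {s | U (cylinder A) s = 1}

/-- The indicator of a cylinder is idempotent, and so is its image under the multiplicative map `U`.
-/
theorem map_cylinder_eq (h : IsExtension m f lam ι U T) (hA : A ∈ m.completion) (s : S) :
    U (cylinder A) s = 0 ∨ U (cylinder A) s = 1 := by
  classical
  have hmem : (cylinder A : Ω × X → ℝ) ∈ m.LaBdd f := cylinder_mem_laBdd hA
  have h1 : (cylinder A : Ω × X → ℝ) * cylinder A = cylinder A := by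
    ext z
    by_cases hz : z.1 ∈ A <;> simp [cylinder, hz]
  have h2 := h.map_mul hmem hmem
  rw [h1] at h2
  have h3 : U (cylinder A) s = U (cylinder A) s * U (cylinder A) s := DFunLike.congr_fun h2 s
  rcases eq_or_ne (U (cylinder A) s) 0 with h0 | h0
  · exact Or.inl h0
  · exact Or.inr (mul_left_cancel₀ h0 (by rw [← h3, mul_one]))

theorem map_cylinder (h : IsExtension m f lam ι U T) (hA : A ∈ m.completion) :
    ⇑(U (cylinder A)) = (chi U A).indicator fun _ => 1 := by
  classical
  ext s
  rcases h.map_cylinder_eq hA s with h0 | h0 <;> simp [chi, h0]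

theorem isClopen_chi (h : IsExtension m f lam ι U T) (hA : A ∈ m.completion) :
    IsClopen (chi U A) := by
  refine ⟨isClosed_eq (map_continuous _) continuous_const, ?_⟩
  have : chi U A = {s | U (cylinder A) s ≠ 0} := by
    ext s
    rcases h.map_cylinder_eq hA s with h0 | h0 <;> simp [chi, h0]
  rw [this]
  exact isOpen_ne_fun (map_continuous _) continuous_const

theorem chi_compl (h : IsExtension m f lam ι U T) (hA : A ∈ m.completion) :
    chi U Aᶜ = (chi U A)ᶜ := by
  classical
  have h1 : U (cylinder Aᶜ) = .const S 1 - U (cylinder A) := h.ext fun z => by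
    rw [h.eval _ (cylinder_mem_laBdd (completion_compl hA)), ContinuousMap.sub_apply,
      h.eval _ (cylinder_mem_laBdd hA)]
    by_cases hz : z.1 ∈ A <;> simp [cylinder, hz]
  ext s
  rcases h.map_cylinder_eq hA s with h0 | h0 <;> simp [chi, h0, h1]

theorem chi_inter (h : IsExtension m f lam ι U T) (hA : A ∈ m.completion)
    (hB : B ∈ m.completion) : chi U (A ∩ B) = chi U A ∩ chi U B := by
  classical
  have h1 : (cylinder (A ∩ B) : Ω × X → ℝ) = cylinder A * cylinder B := by
    ext z
    by_cases hz : z.1 ∈ A <;> by_cases hz' : z.1 ∈ B <;> simp [cylinder, hz, hz']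
  have h2 := h.map_mul (cylinder_mem_laBdd hA) (cylinder_mem_laBdd hB)
  ext s
  rcases h.map_cylinder_eq hA s with h0 | h0 <;> rcases h.map_cylinder_eq hB s with h0' | h0' <;>
    simp [chi, h0, h0', h1, h2]

theorem chi_union (h : IsExtension m f lam ι U T) (hA : A ∈ m.completion)
    (hB : B ∈ m.completion) : chi U (A ∪ B) = chi U A ∪ chi U B := by
  have hA' := completion_compl hA
  have hB' := completion_compl hB
  have := h.chi_compl (completion_inter hA' hB')
  rwa [h.chi_inter hA' hB', h.chi_compl hA, h.chi_compl hB, Set.compl_inter, Set.compl_inter,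
    compl_compl, compl_compl, compl_compl, compl_compl] at this

theorem setIntegral_bounded (h : IsExtension m f lam ι U T) (hA : A ∈ m.completion)
    (hH : H ∈ m.LaBdd f) :
    m.HasIntegral (A.indicator (onGraph f H)) (∫ s in chi U A, U H s ∂lam) := by
  classical
  have hmem : cylinder A * H ∈ m.LaBdd f := mul_mem_laBdd (cylinder_mem_laBdd hA) hH
  have h1 := IsIntegrable.hasIntegral hmem.1
  have h2 := h.integral _ hmem
  rw [h.map_mul (cylinder_mem_laBdd hA) hH] at h2
  have h3 : ∫ s in chi U A, U H s ∂lam = ∫ s, (U (cylinder A) * U H) s ∂lam := by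
    rw [← integral_indicator (h.isClopen_chi hA).isOpen.measurableSet]
    congr 1
    ext s
    rw [ContinuousMap.mul_apply, h.map_cylinder hA]
    by_cases hs : s ∈ chi U A <;> simp [hs]
  rw [h3, h2, ← onGraph_cylinder_mul]
  exact h1

theorem setIntegral (h : IsExtension m f lam ι U T) (hA : A ∈ m.completion)
    (hH : H ∈ m.La f) :
    m.HasIntegral (A.indicator (onGraph f H)) (∫ s in chi U A, T H s ∂lam) := by
  classical
  have hmem := fun k : ℕ => truncReal_mem_laBdd hH k
  refine HasIntegral.of_tendsto (IsIntegrable.indicator hH hA)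
    (fun k : ℕ => h.setIntegral_bounded hA (hmem k)) ?_ ?_
  · refine tendsto_of_tendsto_of_tendsto_of_le_of_le tendsto_const_nhds
      (IsIntegrable.tendsto_truncReal hH) (fun _ => zero_le) fun k => upperNorm_mono fun ω => ?_
    by_cases hω : ω ∈ A
    · simp [hω, onGraph]
    · simp [hω]
  · have h1 := ((continuous_setIntegral (μ := lam) (chi U A)).tendsto (T H)).comp
      (h.tendsto_truncReal hH)
    refine h1.congr fun k => integral_congr_ae (ae_restrict_of_ae ?_)
    exact ContinuousMap.coeFn_toLp (p := 1) (𝕜 := ℝ) lam _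

theorem setIntegral_abs (h : IsExtension m f lam ι U T) (hA : A ∈ m.completion)
    (hH : H ∈ m.La f) :
    ∫ s in chi U A, |T H s| ∂lam = (m.upperNorm (A.indicator (onGraph f H))).toReal := by
  classical
  have hneg : (-1 : ℝ) • H ∈ m.La f := smul_mem_la _ hH
  have h1 := h.setIntegral hA (sup_mem_la hH hneg)
  have h2 := IsIntegrable.hasIntegral_abs (IsIntegrable.indicator hH hA)
  have h3 : A.indicator (onGraph f (H ⊔ (-1 : ℝ) • H)) =
      fun ω => |A.indicator (onGraph f H) ω| := by
    ext ω
    by_cases hω : ω ∈ A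
    · simp [hω, onGraph, abs]
    · simp [hω]
  rw [h3] at h1
  refine Eq.trans (integral_congr_ae (ae_restrict_of_ae ?_)) (h1.unique h2)
  rw [h.map_sup hH hneg, h.map_smul _ hH]
  filter_upwards [Lp.coeFn_sup (T H) ((-1 : ℝ) • T H), Lp.coeFn_smul (-1 : ℝ) (T H)] with s h4 h5
  rw [h4, Pi.sup_apply, h5]
  simp [abs]

/-- Both sides express that the integral of `|T H|` over `chi U A` vanishes. -/
theorem isNullOn_iff (h : IsExtension m f lam ι U T) (hA : A ∈ m.completion)
    (hH : H ∈ m.La f) :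
    m.IsNullOn A (onGraph f H) ↔ ∀ᵐ s ∂lam, s ∈ chi U A → T H s = 0 := by
  rw [FinAddProb.isNullOn_iff]
  have h1 := h.setIntegral_abs hA hH
  have h2 : m.upperNorm (A.indicator (onGraph f H)) ≠ ⊤ :=
    (IsIntegrable.indicator hH hA).upperNorm_ne_top
  have h3 := setIntegral_eq_zero_iff_of_nonneg_ae (μ := lam) (s := chi U A)
    (f := fun s => |T H s|) (Eventually.of_forall fun s => abs_nonneg _)
    (L1.integrable_coeFn (T H)).abs.integrableOn
  rw [← ae_restrict_iff' (h.isClopen_chi hA).isOpen.measurableSet]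
  rw [h1, ENNReal.toReal_eq_zero_iff, or_iff_left h2] at h3
  rw [h3]
  exact eventually_congr (Eventually.of_forall fun s => by simp)

/-- For some `t` in `(a, b)` the indicator `D` of `{t < g ∘ ι}` is integrable along the graph. On
the image of `ι`, either `U D = 0` and `g ≤ t`, or `U D = 1` and `t ≤ g`. This alternative is a
closed condition, so it holds on all of `S`, and `{U D = 1}` is the required clopen set. -/
theorem exists_isClopen_between (h : IsExtension m f lam ι U T) (g : C(S, ℝ)) {a b : ℝ}
    (hab : a < b) : ∃ E : Set S, IsClopen E ∧ {s | b ≤ g s} ⊆ E ∧ E ⊆ {s | a < g s} := by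
  classical
  obtain ⟨t, ht, htm⟩ := exists_superlevel_mem_completion (h.mem g).1 hab
  let D : Ω × X → ℝ := {z | t < g (ι z)}.indicator fun _ => 1
  have hD : D ∈ m.LaBdd f := by
    refine ⟨mem_completion_iff.1 htm, 1, fun p => ?_⟩
    by_cases hp : t < g (ι p) <;> simp [D, hp]
  have h01 : ∀ s, U D s = 0 ∧ g s ≤ t ∨ U D s = 1 ∧ t ≤ g s := by
    intro s
    have hcl : IsClosed {s | U D s = 0 ∧ g s ≤ t ∨ U D s = 1 ∧ t ≤ g s} := by
      have h0 : ∀ c : ℝ, IsClosed {s | U D s = c} := fun c =>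
        isClosed_eq (map_continuous _) continuous_const
      exact ((h0 0).inter (isClosed_le (map_continuous g) continuous_const)).union
        ((h0 1).inter (isClosed_le continuous_const (map_continuous g)))
    refine h.dense.induction_on (p := fun s => U D s = 0 ∧ g s ≤ t ∨ U D s = 1 ∧ t ≤ g s) s hcl
      fun z => ?_
    rw [h.eval D hD]
    by_cases hz : t < g (ι z)
    · exact Or.inr ⟨by simp [D, hz], hz.le⟩
    · exact Or.inl ⟨by simp [D, hz], not_lt.1 hz⟩
  refine ⟨{s | U D s = 1}, ⟨isClosed_eq (map_continuous _) continuous_const, ?_⟩,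
    fun s hs => ?_, fun s hs => ?_⟩
  · have : {s | U D s = 1} = {s | U D s ≠ 0} := by
      ext s
      rcases h01 s with h0 | h0 <;> simp [h0.1]
    rw [this]
    exact isOpen_ne_fun (map_continuous _) continuous_const
  · rcases h01 s with h0 | h0
    · exact absurd (lt_of_lt_of_le ht.2 hs) (not_lt.2 h0.2)
    · exact h0.1
  · rcases h01 s with h0 | h0
    · have h1 : U D s = 1 := hs
      rw [h0.1] at h1
      exact absurd h1 zero_ne_one
    · exact lt_of_lt_of_le ht.1 h0.2

theorem measurable_generateFrom_isClopen (h : IsExtension m f lam ι U T) (g : C(S, ℝ)) :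
    @Measurable S ℝ (MeasurableSpace.generateFrom {E : Set S | IsClopen E}) inferInstance g := by
  refine @measurable_of_exists_between S (MeasurableSpace.generateFrom {E : Set S | IsClopen E}) g
    fun a b hab => ?_
  obtain ⟨E, hE, hE'⟩ := h.exists_isClopen_between g hab
  exact ⟨E, MeasurableSpace.measurableSet_generateFrom hE, hE'⟩

/-- Let `A` be the set of `ω` whose graph point `(ω, f ω)` is sent into `E`. The indicators of `E`
and of `chi U A` restrict to the same function on the graph, so they agree a.e. by isometry; off the
graph they may differ. -/
theorem exists_chi_of_isClopen (h : IsExtension m f lam ι U T) {E : Set S} (hE : IsClopen E) :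
    ∃ A ∈ m.completion, lam (symmDiff E (chi U A)) = 0 := by
  classical
  let g : C(S, ℝ) := ⟨E.indicator fun _ => 1, hE.continuous_indicator continuous_const⟩
  let A : Set Ω := {ω | ι (ω, f ω) ∈ E}
  have hgA : onGraph f (fun z => g (ι z)) = A.indicator fun _ => 1 := by
    ext ω
    by_cases hω : ι (ω, f ω) ∈ E <;> simp [onGraph, A, g, hω]
  have hA : A ∈ m.completion := by
    rw [mem_completion_iff, ← hgA]
    exact (h.mem g).1
  refine ⟨A, hA, ?_⟩
  have h1 := h.norm_toLp_sub (h.mem g) (cylinder_mem_laBdd hA)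
  have h2 : onGraph f (cylinder A) = A.indicator fun _ => 1 := rfl
  rw [hgA, h2, sub_self, upperNorm_zero, ENNReal.toReal_zero, norm_eq_zero, sub_eq_zero,
    h.map_restrict] at h1
  have h3 : g =ᵐ[lam] U (cylinder A) :=
    (ContinuousMap.coeFn_toLp (p := 1) (𝕜 := ℝ) lam g).symm.trans
      ((by rw [h1] : _ =ᵐ[lam] _).trans (ContinuousMap.coeFn_toLp (p := 1) (𝕜 := ℝ) lam _))
  rw [h.map_cylinder hA] at h3
  rw [measure_symmDiff_eq_zero_iff, Filter.eventuallyEq_set]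
  filter_upwards [h3] with s hs
  change E.indicator (fun _ => (1 : ℝ)) s = _ at hs
  by_cases h4 : s ∈ E <;> by_cases h5 : s ∈ chi U A <;> simp_all

/-- The null sets for individual `H` cannot be united, as there may be uncountably many `H`. The
topological support of `lam` serves instead: it has full measure by regularity, and a continuous
function vanishing a.e. on the open set `chi U A` vanishes at every support point in it. -/
theorem measure_diff_eq_zero [lam.Regular] (h : IsExtension m f lam ι U T)
    (hA : A ∈ m.completion) :
    lam (chi U A \ {s | ∀ H ∈ m.LaBdd f, m.IsNullOn A (onGraph f H) → U H s = 0}) = 0 := by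
  refine measure_mono_null (t := lam.supportᶜ) (fun s hs => ?_)
    Measure.measure_compl_support_of_regular
  rw [Set.mem_compl_iff]
  refine fun hs' => hs.2 fun H hH hnull => ?_
  by_contra hne
  have hopen : IsOpen (chi U A ∩ {s | U H s ≠ 0}) :=
    (h.isClopen_chi hA).isOpen.inter (isOpen_ne_fun (map_continuous _) continuous_const)
  have h1 := (Measure.mem_support_iff_forall s).1 hs' _ (hopen.mem_nhds ⟨hs.1, hne⟩)
  refine h1.ne' ?_
  have h2 := (h.isNullOn_iff hA hH.1).1 hnull
  have h3 : ∀ᵐ s ∂lam, s ∈ chi U A → U H s = 0 := by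
    filter_upwards [h2, h.map_bounded_ae hH] with s h2 h3
    rwa [← h3]
  refine measure_mono_null (fun s hs => ?_) h3
  exact fun hcon => hs.2 (hcon hs.1)

theorem dense_image [lam.Regular] [T2Space S] (h : IsExtension m f lam ι U T) :
    Dense (T '' m.La f) := by
  have h1 : DenseRange (ContinuousMap.toLp 1 lam ℝ : C(S, ℝ) →L[ℝ] Lp ℝ 1 lam) :=
    ContinuousMap.toLp_denseRange ℝ lam ℝ ENNReal.one_ne_top
  refine h1.mono ?_
  rintro _ ⟨g, rfl⟩
  refine ⟨_, (h.mem g).1, ?_⟩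
  rw [h.map_bounded (h.mem g), h.map_restrict]

end IsExtension

variable {Ω X S : Type*} [NormedAddCommGroup X] [NormedSpace ℝ X]
    [TopologicalSpace S] [CompactSpace S] [T2Space S] [MeasurableSpace S] [BorelSpace S]
    {m : FinAddProb Ω}
    {f : Ω → X} {lam : Measure S} [IsProbabilityMeasure lam] [lam.Regular] {ι : Ω × X → S}
    {U : (Ω × X → ℝ) → C(S, ℝ)} {T : (Ω × X → ℝ) → Lp ℝ 1 lam}

theorem IsExtension.isAbstractStandardRep (h : IsExtension m f lam ι U T) :
    IsAbstractStandardRep m f (chi U) lam T U where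
  compact := inferInstance
  hausdorff := inferInstance
  borel := inferInstance
  probability := inferInstance
  regular := inferInstance
  clopen_chi _ hA := h.isClopen_chi hA
  chi_compl _ hA := h.chi_compl hA
  chi_union _ hA _ hB := h.chi_union hA hB
  chi_inter _ hA _ hB := h.chi_inter hA hB
  map_add _ hH _ hG := h.map_add hH hG
  map_smul c _ hH := h.map_smul c hH
  map_sup _ hH _ hG := h.map_sup hH hG
  map_inf _ hH _ hG := h.map_inf hH hG
  isometric H hH := by
    rw [h.norm_eq hH]
    exact IsIntegrable.hasIntegral_abs hH
  integral_eq A hA H hH := h.setIntegral (mem_completion_of_mem hA) hH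
  bounded_ae _ hH := h.map_bounded_ae hH
  bounded_bij := h.bijOn
  bounded_add _ hH _ hG := h.toIsBoundedRep.map_add hH hG
  bounded_smul c _ hH := h.toIsBoundedRep.map_smul c hH
  bounded_mul _ hH _ hG := h.map_mul hH hG
  measurable_clopen := h.measurable_generateFrom_isClopen
  clopen_eq _ hE := h.exists_chi_of_isClopen hE
  dense_range := h.dense_image
  map_comp n H hH α hα hC := hC.elim fun C hC => h.map_comp hH hα hC
  null_iff A hA H hH := h.isNullOn_iff hA hH
  null_tilde A hA := h.measure_diff_eq_zero hA

end FinAddProb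

/-- The separation by clopen sets is kept alongside the axioms for the approximation of Borel sets
in `exists_approx`. -/
theorem exists_isAbstractStandardRep {Ω : Type u} {X : Type v} [NormedAddCommGroup X]
    [NormedSpace ℝ X] (m : FinAddProb Ω) (f : Ω → X) :
    ∃ (S : Type (max u v)) (_ : TopologicalSpace S) (_ : MeasurableSpace S)
      (χ : Set Ω → Set S) (lam : Measure S) (T : (Ω × X → ℝ) → Lp ℝ 1 lam)
      (U : (Ω × X → ℝ) → C(S, ℝ)), IsAbstractStandardRep m f χ lam T U ∧
      ∀ (g : C(S, ℝ)) (a b : ℝ), a < b →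
        ∃ E : Set S, IsClopen E ∧ {s | b ≤ g s} ⊆ E ∧ E ⊆ {s | a < g s} := by
  obtain ⟨S, _, _, _, _, _, lam, _, _, ι, U, h⟩ := FinAddProb.exists_isBoundedRep m f
  obtain ⟨T, hT⟩ := h.exists_isExtension
  exact ⟨S, inferInstance, inferInstance, _, lam, T, U, hT.isAbstractStandardRep,
    fun g _ _ hab => hT.exists_isClopen_between g hab⟩

/-! ### The weak uniformity and the weak closure -/

section WeakUniformity

variable {X : Type*} [NormedAddCommGroup X] [NormedSpace ℝ X]

theorem exists_of_mem_weakUniformity {V : Set (X × X)}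
    (hV : V ∈ @uniformity X (weakUniformSpace X)) :
    ∃ (n : ℕ) (φ : Fin n → StrongDual ℝ X) (δ : ℝ), 0 < δ ∧
      ∀ x y, (∀ i, |φ i x - φ i y| < δ) → (x, y) ∈ V := by
  have hV' : V ∈ comap (fun p : X × X => ((fun φ : StrongDual ℝ X => φ p.1),
      fun φ : StrongDual ℝ X => φ p.2)) (uniformity (StrongDual ℝ X → ℝ)) := hV
  rw [Pi.uniformity, mem_comap] at hV'
  obtain ⟨W, hW, hWV⟩ := hV'
  obtain ⟨⟨I, r⟩, ⟨hI, hr⟩, hIW⟩ := (HasBasis.iInf' fun φ : StrongDual ℝ X =>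
    (Metric.uniformity_basis_dist (α := ℝ)).comap
      fun a : (StrongDual ℝ X → ℝ) × (StrongDual ℝ X → ℝ) => (a.1 φ, a.2 φ)).mem_iff.1 hW
  obtain ⟨δ, hδ, hδr⟩ : ∃ δ > 0, ∀ φ ∈ I, δ ≤ r φ := by
    rcases I.eq_empty_or_nonempty with rfl | hne
    · exact ⟨1, one_pos, by simp⟩
    · obtain ⟨φ₀, hφ₀, hmin⟩ := Set.exists_min_image I r hI hne
      exact ⟨r φ₀, hr φ₀ hφ₀, hmin⟩
  have := hI.fintype
  let e := Fintype.equivFin I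
  refine ⟨Fintype.card I, fun i => (e.symm i).1, δ, hδ, fun x y hxy => hWV (hIW ?_)⟩
  simp only [Set.mem_iInter]
  intro φ hφ
  have h1 := hxy (e ⟨φ, hφ⟩)
  simp only [Equiv.symm_apply_apply] at h1
  exact lt_of_lt_of_le (by rw [Real.dist_eq]; exact h1) (hδr φ hφ)

theorem weakUniformContinuous_comp {n : ℕ} (φ : Fin n → StrongDual ℝ X) {α : (Fin n → ℝ) → ℝ}
    (hα : UniformContinuous α) :
    @UniformContinuous X ℝ (weakUniformSpace X) inferInstance fun x => α fun i => φ i x := by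
  have h1 : ∀ ψ : StrongDual ℝ X, @UniformContinuous X ℝ (weakUniformSpace X) inferInstance ψ :=
    fun ψ => @UniformContinuous.comp X (StrongDual ℝ X → ℝ) ℝ (weakUniformSpace X) _ _
      (fun a => a ψ) (fun x φ => φ x) (Pi.uniformContinuous_proj (fun _ => ℝ) ψ)
      uniformContinuous_comap
  have h2 : @UniformContinuous X (Fin n → ℝ) (weakUniformSpace X) inferInstance
      fun x i => φ i x :=
    (@uniformContinuous_pi (Fin n) (fun _ => ℝ) _ X (weakUniformSpace X) _).2 fun i => h1 (φ i)
  exact @UniformContinuous.comp X (Fin n → ℝ) ℝ (weakUniformSpace X) _ _ α _ hα h2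

theorem weakUniformContinuous_dual (φ : StrongDual ℝ X) :
    @UniformContinuous X ℝ (weakUniformSpace X) inferInstance φ :=
  weakUniformContinuous_comp (fun _ : Fin 1 => φ)
    (Pi.uniformContinuous_proj (fun _ : Fin 1 => ℝ) 0)

/-- Points whose images under finitely many functionals are within `δ` have `h`-values within `ε`,
so `h` almost factors through `ℝ^n`. At each `y` the values admissible for `β` form a convex set,
and near every point some constant is admissible; a partition of unity then glues these constants to
a continuous `β`. -/
theorem exists_continuous_approx {h : X → ℝ}
    (hh : @UniformContinuous X ℝ (weakUniformSpace X) inferInstance h) {ε : ℝ} (hε : 0 < ε) :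
    ∃ (n : ℕ) (φ : Fin n → StrongDual ℝ X) (β : C(Fin n → ℝ, ℝ)),
      ∀ x, |h x - β fun i => φ i x| ≤ ε := by
  obtain ⟨n, φ, δ, hδ, hφ⟩ := exists_of_mem_weakUniformity
    (V := (fun p : X × X => (h p.1, h p.2)) ⁻¹' {p | dist p.1 p.2 < ε})
    (hh (Metric.dist_mem_uniformity hε))
  have hδ4 : 0 < δ / 4 := by linarith
  obtain ⟨β, hβ⟩ := exists_continuous_forall_mem_convex_of_local_const
    (t := fun y : Fin n → ℝ => {r : ℝ | ∀ x : X, dist (fun i => φ i x) y < δ / 4 → |h x - r| ≤ ε})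
    (fun y => by
      have : {r : ℝ | ∀ x : X, dist (fun i => φ i x) y < δ / 4 → |h x - r| ≤ ε} =
          ⋂ x : X, ⋂ _ : dist (fun i => φ i x) y < δ / 4, Metric.closedBall (h x) ε := by
        ext r
        simp [Real.dist_eq, abs_sub_comm]
      rw [this]
      exact convex_iInter₂ fun x _ => convex_closedBall _ _)
    (fun y₀ => by
      -- If the image of some `x₀` is within `δ / 2` of `y₀`, the constant `h x₀` works because `δ /
      -- 4 + δ / 4 + δ / 2 = δ`. Otherwise no image is close enough to constrain the value, and `0`
      -- will do.
      by_cases hx₀ : ∃ x₀ : X, dist (fun i => φ i x₀) y₀ < δ / 2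
      · obtain ⟨x₀, hx₀⟩ := hx₀
        refine ⟨h x₀, ?_⟩
        filter_upwards [Metric.ball_mem_nhds y₀ hδ4] with y hy x hx
        have h1 : dist (fun i => φ i x) (fun i => φ i x₀) < δ := by
          have h2 := dist_triangle4 (fun i => φ i x) y y₀ (fun i => φ i x₀)
          rw [dist_comm y₀] at h2
          rw [Metric.mem_ball] at hy
          linarith
        exact (hφ x x₀ fun i => lt_of_le_of_lt
          (dist_le_pi_dist (fun i => φ i x) (fun i => φ i x₀) i) h1).le
      · refine ⟨0, ?_⟩
        filter_upwards [Metric.ball_mem_nhds y₀ hδ4] with y hy x hx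
        refine absurd ⟨x, ?_⟩ hx₀
        rw [Metric.mem_ball] at hy
        linarith [dist_triangle (fun i => φ i x) y y₀])
  exact ⟨n, φ, β, fun x => hβ _ x (by rw [dist_self]; exact hδ4)⟩

theorem subset_weakClosure (C : Set X) : C ⊆ weakClosure C := by
  intro x hx
  have h : toWeakSpace ℝ X x ∈ closure (toWeakSpace ℝ X '' C) :=
    subset_closure (Set.mem_image_of_mem _ hx)
  exact h

/-- Points outside the weak closure of `C` have basic weak neighborhoods disjoint from `C`. -/
theorem exists_of_notMem_weakClosure {C : Set X} {x : X} (hx : x ∉ weakClosure C) :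
    ∃ (n : ℕ) (φ : Fin n → StrongDual ℝ X) (δ : ℝ), 0 < δ ∧
      ∀ y ∈ C, ¬ dist (fun i => φ i y) (fun i => φ i x) < δ := by
  have h1 : (toWeakSpace ℝ X '' C)ᶜ ∈ 𝓝 (toWeakSpace ℝ X x) := by
    rw [← mem_interior_iff_mem_nhds, interior_compl]
    exact hx
  -- The weak topology and the topology of the weak uniformity agree by definition, so the
  -- neighborhood transfers unchanged.
  have h2 : Cᶜ ∈ @nhds X (weakUniformSpace X).toTopologicalSpace x := by
    have h3 : (toWeakSpace ℝ X '' C)ᶜ = Cᶜ := by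
      ext y
      exact ⟨fun hy hyC => hy ⟨y, hyC, rfl⟩, fun hy ⟨z, hz, hzy⟩ => hy (by rwa [← hzy])⟩
    rw [h3] at h1
    exact h1
  let _ : UniformSpace X := weakUniformSpace X
  rw [UniformSpace.mem_nhds_iff] at h2
  obtain ⟨V, hV, hVC⟩ := h2
  obtain ⟨n, φ, δ, hδ, hφ⟩ := exists_of_mem_weakUniformity hV
  refine ⟨n, φ, δ, hδ, fun y hy hd => hVC (hφ x y fun i => ?_) hy⟩
  rw [abs_sub_comm]
  exact lt_of_le_of_lt (dist_le_pi_dist (fun i => φ i y) (fun i => φ i x) i) hd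

end WeakUniformity
-- From dominated scalar densities to a Bochner density
section Density

variable {S X : Type*} [MeasurableSpace S] {lam : Measure S}
  [NormedAddCommGroup X] [NormedSpace ℝ X]

theorem abs_setIntegral_le_of_ae_le {u w : S → ℝ} {c : ℝ} {E : Set S}
    (hu : Integrable u lam) (hw : Integrable w lam) (huw : ∀ᵐ s ∂lam, |u s| ≤ c * w s) :
    |∫ s in E, u s ∂lam| ≤ c * ∫ s in E, w s ∂lam := by
  rw [← integral_const_mul]
  refine (abs_integral_le_integral_abs).trans (integral_mono_ae hu.abs.integrableOn
    (hw.const_mul c).integrableOn (ae_restrict_of_ae huw))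

theorem abs_setIntegral_sub_le {u w : S → ℝ} {c : ℝ} {E F : Set S} (hE : MeasurableSet E)
    (hF : MeasurableSet F) (hu : Integrable u lam) (hw : Integrable w lam)
    (huw : ∀ᵐ s ∂lam, |u s| ≤ c * w s) :
    |∫ s in E, u s ∂lam - ∫ s in F, u s ∂lam| ≤ c * ∫ s in symmDiff E F, w s ∂lam := by
  rw [← integral_indicator hE, ← integral_indicator hF,
    ← integral_sub (hu.indicator hE) (hu.indicator hF), ← integral_const_mul,
    ← integral_indicator (hE.symmDiff hF)]
  refine (abs_integral_le_integral_abs).trans (integral_mono_ae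
    ((hu.indicator hE).sub (hu.indicator hF)).abs
    ((hw.const_mul c).indicator (hE.symmDiff hF)) ?_)
  filter_upwards [huw] with s hs
  by_cases h1 : s ∈ E <;> by_cases h2 : s ∈ F <;> simp [h1, h2, Set.mem_symmDiff, hs]

theorem norm_le_of_forall_dual {w : S → ℝ} {u : StrongDual ℝ X → S → ℝ} {E : Set S} {x : X}
    (hw : Integrable w lam) (hw0 : ∀ᵐ s ∂lam, 0 ≤ w s) (hu : ∀ φ, Integrable (u φ) lam)
    (huw : ∀ φ, ∀ᵐ s ∂lam, |u φ s| ≤ ‖φ‖ * w s) (hx : ∀ φ, φ x = ∫ s in E, u φ s ∂lam) :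
    ‖x‖ ≤ ∫ s in E, w s ∂lam := by
  refine NormedSpace.norm_le_dual_bound ℝ x
    (integral_nonneg_of_ae (ae_restrict_of_ae hw0)) fun φ => ?_
  rw [hx φ, mul_comm, Real.norm_eq_abs]
  exact abs_setIntegral_le_of_ae_le (hu φ) hw (huw φ)

/-- Domination by `‖φ‖ * w` makes the convergence of `φ (x n)` uniform over the unit ball of the
dual, with rate the integral of `w` over `symmDiff E (F n)`, which tends to zero. Thus `x n` is
Cauchy in norm and its limit represents `E`. -/
theorem exists_forall_dual_of_approx [CompleteSpace X] {w : S → ℝ} {u : StrongDual ℝ X → S → ℝ}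
    (hw : Integrable w lam) (hw0 : ∀ᵐ s ∂lam, 0 ≤ w s) (hu : ∀ φ, Integrable (u φ) lam)
    (huw : ∀ φ, ∀ᵐ s ∂lam, |u φ s| ≤ ‖φ‖ * w s) {E : Set S} (hE : MeasurableSet E)
    (happrox : ∀ ε : ℝ, 0 < ε → ∃ F, MeasurableSet F ∧ lam (symmDiff E F) < ENNReal.ofReal ε ∧
      ∃ x : X, ∀ φ, φ x = ∫ s in F, u φ s ∂lam) :
    ∃ x : X, ∀ φ : StrongDual ℝ X, φ x = ∫ s in E, u φ s ∂lam := by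
  choose F hF hEF x hx using fun n : ℕ =>
    happrox (1 / (n + 1)) (Nat.one_div_pos_of_nat (n := n) (α := ℝ))
  let a : ℕ → ℝ := fun n => ∫ s in symmDiff E (F n), w s ∂lam
  have ha : Tendsto a atTop (𝓝 0) := by
    refine hw.tendsto_setIntegral_nhds_zero ?_
    have h1 := ENNReal.tendsto_ofReal (tendsto_one_div_add_atTop_nhds_zero_nat (𝕜 := ℝ))
    rw [ENNReal.ofReal_zero] at h1
    exact tendsto_of_tendsto_of_tendsto_of_le_of_le tendsto_const_nhds h1 (fun _ => zero_le)
      fun n => (hEF n).le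
  have h1 : ∀ n φ, |∫ s in E, u φ s ∂lam - φ (x n)| ≤ ‖φ‖ * a n := fun n φ => by
    rw [hx n φ]
    exact abs_setIntegral_sub_le hE (hF n) (hu φ) hw (huw φ)
  have ha0 : ∀ n, 0 ≤ a n := fun n => integral_nonneg_of_ae (ae_restrict_of_ae hw0)
  have hcau : CauchySeq x := by
    rw [cauchySeq_iff_tendsto_dist_atTop_0]
    have h2 := (ha.comp tendsto_fst).add (ha.comp tendsto_snd)
    rw [prod_atTop_atTop_eq, add_zero] at h2
    refine squeeze_zero (fun _ => dist_nonneg) (fun p => ?_) h2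
    rw [dist_eq_norm]
    refine NormedSpace.norm_le_dual_bound ℝ _ (add_nonneg (ha0 _) (ha0 _)) fun φ => ?_
    rw [map_sub, Real.norm_eq_abs]
    have h3 := abs_sub_le (φ (x p.1)) (∫ s in E, u φ s ∂lam) (φ (x p.2))
    rw [abs_sub_comm (φ (x p.1)) (∫ s in E, u φ s ∂lam)] at h3
    simp only [Function.comp]
    linarith [h1 p.1 φ, h1 p.2 φ]
  obtain ⟨y, hy⟩ := cauchySeq_tendsto_of_complete hcau
  refine ⟨y, fun φ => tendsto_nhds_unique ((φ.continuous.tendsto y).comp hy) ?_⟩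
  rw [tendsto_iff_dist_tendsto_zero]
  have h2 := ha.const_mul ‖φ‖
  rw [mul_zero] at h2
  refine squeeze_zero (fun _ => dist_nonneg) (fun n => ?_) h2
  rw [dist_comm, Real.dist_eq]
  exact h1 n φ

end Density

/-- The vectors attached to the sets `E` are additive, since functionals separate points, and
bounded in norm by the finite measure `w lam`. This yields countable additivity, finite variation
and absolute continuity at once. The density `g` given by the Radon–Nikodým property satisfies `φ(g)
= u φ` a.e. because both have the same integrals over all measurable sets. -/
theorem HasRNP.exists_density.{w} {X : Type v} [NormedAddCommGroup X] [NormedSpace ℝ X]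
    [CompleteSpace X] (hX : HasRNP.{w, v} X) {S : Type w} [MeasurableSpace S] {lam : Measure S}
    [IsProbabilityMeasure lam] {w : S → ℝ} {u : StrongDual ℝ X → S → ℝ}
    (hw : Integrable w lam) (hw0 : ∀ᵐ s ∂lam, 0 ≤ w s) (hu : ∀ φ, Integrable (u φ) lam)
    (huw : ∀ φ, ∀ᵐ s ∂lam, |u φ s| ≤ ‖φ‖ * w s)
    (hx : ∀ E, MeasurableSet E → ∃ x : X, ∀ φ : StrongDual ℝ X, φ x = ∫ s in E, u φ s ∂lam) :
    ∃ g : S → X, Integrable g lam ∧ ∀ φ : StrongDual ℝ X, (fun s => φ (g s)) =ᵐ[lam] u φ := by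
  classical
  choose x hx using hx
  let μ := lam.withDensity fun s => ENNReal.ofReal (w s)
  have hμ : IsFiniteMeasure μ := isFiniteMeasure_withDensity_ofReal hw.2
  let G₀ : Set S → X := fun E => if hE : MeasurableSet E then x E hE else 0
  have hG₀ : ∀ E (hE : MeasurableSet E), G₀ E = x E hE := fun E hE => dif_pos hE
  have hle : ∀ E, ‖G₀ E‖ₑ ≤ μ E := by
    intro E
    by_cases hE : MeasurableSet E
    · rw [hG₀ E hE, withDensity_apply _ hE, ← ofReal_integral_eq_lintegral_ofReal hw.integrableOn
        (ae_restrict_of_ae hw0), ← ofReal_norm]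
      exact ENNReal.ofReal_le_ofReal (norm_le_of_forall_dual hw hw0 hu huw (hx E hE))
    · simp [G₀, hE]
  have hadd : ∀ E F, MeasurableSet E → MeasurableSet F → Disjoint E F →
      G₀ (E ∪ F) = G₀ E + G₀ F := by
    intro E F hE hF hEF
    rw [hG₀ E hE, hG₀ F hF, hG₀ _ (hE.union hF), SeparatingDual.eq_iff_forall_dual_eq (R := ℝ)]
    intro φ
    rw [map_add, hx, hx, hx, setIntegral_union hEF hF (hu φ).integrableOn (hu φ).integrableOn]
  let G : VectorMeasure S X := VectorMeasure.of_additive_of_le_measure (μ := μ) G₀ hle hadd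
    fun E hE => by simp [G₀, hE]
  have hG : ∀ E, G E = G₀ E := fun _ => rfl
  have hvar : G.variation Set.univ ≠ ⊤ :=
    ne_top_of_le_ne_top (measure_ne_top μ Set.univ)
      (VectorMeasure.variation_le_of_forall_enorm_le (fun E _ => hle E) Set.univ)
  obtain ⟨g, hg, hgG⟩ := hX S lam G hvar fun E hE h0 => by
    have h1 := hle E
    rw [withDensity_absolutelyContinuous lam _ h0] at h1
    rw [hG]
    simpa using h1
  refine ⟨g, hg, fun φ => Integrable.ae_eq_of_forall_setIntegral_eq _ _ (φ.integrable_comp hg)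
    (hu φ) fun E hE _ => ?_⟩
  rw [ContinuousLinearMap.integral_comp_comm φ hg.integrableOn, ← hgG E hE, hG, hG₀ E hE, hx]

/-! ### From abstract to standard representations -/

namespace FinAddProb

variable {Ω X : Type*} [NormedAddCommGroup X] {m : FinAddProb Ω} {f : Ω → X}

theorem NormIntegrable.norm_mem_la (hf : m.NormIntegrable f) :
    (fun p : Ω × X => ‖p.2‖) ∈ m.La f := hf

theorem WeaklyIntegrable.dual_mem_la [NormedSpace ℝ X] (hw : m.WeaklyIntegrable f) (φ : StrongDual ℝ X) :
    (fun p : Ω × X => φ p.2) ∈ m.La f := hw φ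

end FinAddProb

namespace IsAbstractStandardRep

open FinAddProb

variable {Ω X S : Type*} [NormedAddCommGroup X] [NormedSpace ℝ X]
    [TopologicalSpace S] [MeasurableSpace S] {m : FinAddProb Ω} {f : Ω → X}
    {χ : Set Ω → Set S} {lam : Measure S} {T : (Ω × X → ℝ) → Lp ℝ 1 lam}
    {U : (Ω × X → ℝ) → C(S, ℝ)} {A B : Set Ω}

/-- Axiom (e) requires bounded functions, so `β` is clipped to `[0, 1]`: the clipped composition
vanishes identically, and therefore so does its image under `T`. -/
theorem ae_nonpos_of_forall (h : IsAbstractStandardRep m f χ lam T U) {n : ℕ}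
    {H : Fin n → Ω × X → ℝ} (hH : ∀ i, H i ∈ m.La f) {β : (Fin n → ℝ) → ℝ} (hβ : Continuous β)
    (h0 : ∀ p, β (fun i => H i p) ≤ 0) : ∀ᵐ s ∂lam, β (fun i => T (H i) s) ≤ 0 := by
  have h1 := h.map_comp n H hH (fun y => min 1 (max 0 (β y))) (by fun_prop)
    ⟨1, fun y => abs_le.2 ⟨le_min (by norm_num) (le_max_of_le_left (by norm_num)),
      min_le_left _ _⟩⟩
  -- Written as a multiple by `0`, the zero function is sent to `0` by homogeneity.
  have h2 : (fun p => min 1 (max 0 (β fun i => H i p))) = (0 : ℝ) • fun _ : Ω × X => (0 : ℝ) := by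
    ext p
    simp [h0 p]
  rw [h2, h.map_smul 0 _ (const_mem_laBdd 0).1, zero_smul] at h1
  filter_upwards [h1, Lp.coeFn_zero ℝ 1 lam] with s h3 h4
  rw [h4, Pi.zero_apply] at h3
  by_contra! hcon
  have : 0 < min 1 (max 0 (β fun i => T (H i) s)) := lt_min one_pos (lt_max_of_lt_right hcon)
  exact this.ne h3

theorem ae_abs_le (h : IsAbstractStandardRep m f χ lam T U) {H G : Ω × X → ℝ}
    (hH : H ∈ m.La f) (hG : G ∈ m.La f) {c : ℝ} (hHG : ∀ p, |H p| ≤ c * G p) :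
    ∀ᵐ s ∂lam, |T H s| ≤ c * T G s := by
  have h1 := h.ae_nonpos_of_forall (H := ![H, G]) (Fin.forall_fin_two.2 ⟨hH, hG⟩)
    (β := fun y => |y 0| - c * y 1) (by fun_prop) fun p => by simpa using hHG p
  filter_upwards [h1] with s hs
  simpa using hs

theorem measurableSet_chi (h : IsAbstractStandardRep m f χ lam T U) (hA : A ∈ m.completion) :
    MeasurableSet (χ A) :=
  have := h.borel
  (h.clopen_chi A hA).isOpen.measurableSet

theorem chi_subset (h : IsAbstractStandardRep m f χ lam T U) (hA : A ∈ m.completion)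
    (hB : B ∈ m.completion) (hAB : A ⊆ B) : χ A ⊆ χ B := by
  have := h.chi_inter A hA B hB
  rw [Set.inter_eq_left.2 hAB] at this
  exact Set.inter_eq_left.1 this.symm

theorem chi_empty (h : IsAbstractStandardRep m f χ lam T U) : χ ∅ = ∅ := by
  have h0 : ∅ ∈ m.completion := mem_completion_of_mem m.isSetAlgebra.empty_mem
  have h1 := h.chi_inter _ h0 _ (completion_compl h0)
  rwa [h.chi_compl _ h0, Set.inter_compl_self, Set.inter_compl_self] at h1

theorem chi_sdiff (h : IsAbstractStandardRep m f χ lam T U) (hA : A ∈ m.completion)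
    (hB : B ∈ m.completion) : χ (B \ A) = χ B \ χ A := by
  rw [Set.sdiff_eq, h.chi_inter B hB _ (completion_compl hA), h.chi_compl A hA, Set.sdiff_eq]

theorem measure_chi (h : IsAbstractStandardRep m f χ lam T U) (hA : A ∈ m.sets) :
    lam (χ A) = ENNReal.ofReal (m.prob A) := by
  have := h.probability
  have hone : (fun _ : Ω × X => (1 : ℝ)) ∈ m.LaBdd f := const_mem_laBdd 1
  obtain ⟨G, hG, hG1⟩ := h.bounded_bij.surjOn (Set.mem_univ (1 : C(S, ℝ)))
  -- Preservation of the unit is not an axiom: a preimage `G` of `1` gives `U 1 = U 1 * U G = U G =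
  -- 1`.
  have h1 : U (fun _ => 1) = 1 := by
    have h2 := h.bounded_mul _ hone G hG
    rw [hG1, mul_one, show (fun _ : Ω × X => (1 : ℝ)) * G = G from one_mul G, hG1] at h2
    exact h2.symm
  have h2 : ∫ s in χ A, T (fun _ => 1) s ∂lam = lam.real (χ A) := by
    have h3 := h.bounded_ae _ hone
    rw [h1] at h3
    rw [integral_congr_ae (ae_restrict_of_ae h3)]
    simp
  have h3 := (h.integral_eq A hA _ hone.1).unique (hasIntegral_indicator hA)
  rw [← h3, h2, ofReal_measureReal]

theorem exists_approx_clopen (h : IsAbstractStandardRep m f χ lam T U) {E : Set S}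
    (hE : IsClopen E) {ε : ℝ} (hε : 0 < ε) :
    ∃ A ∈ m.sets, lam (symmDiff E (χ A)) < ENNReal.ofReal ε := by
  obtain ⟨C, hC, hEC⟩ := h.clopen_eq E hE
  obtain ⟨A, hA, B, hB, hAC, hCB, hlt⟩ := hC ε hε
  have hA' := mem_completion_of_mem hA
  have hB' := mem_completion_of_mem hB
  have hsub : symmDiff E (χ A) ⊆ symmDiff E (χ C) ∪ χ (B \ A) := by
    rw [h.chi_sdiff hA' hB']
    intro s hs
    have h1 : s ∈ χ A → s ∈ χ C := fun hs => h.chi_subset hA' hC hAC hs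
    have h2 : s ∈ χ C → s ∈ χ B := fun hs => h.chi_subset hC hB' hCB hs
    simp only [Set.mem_symmDiff, Set.mem_union, Set.mem_sdiff] at hs ⊢
    tauto
  refine ⟨A, hA, (measure_mono hsub).trans_lt ((measure_union_le _ _).trans_lt ?_)⟩
  rw [hEC, zero_add, h.measure_chi (m.isSetAlgebra.sdiff_mem hB hA)]
  exact (ENNReal.ofReal_lt_ofReal_iff hε).2 hlt

/-- Regularity gives a compact set inside `E` and an open set around it; a Urysohn function and
`hsep` place a clopen set between them, which axiom (c) and the definition of the completion replace
by some `χ A` with `A` in the algebra. -/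
theorem exists_approx (h : IsAbstractStandardRep m f χ lam T U)
    (hsep : ∀ (g : C(S, ℝ)) (a b : ℝ), a < b →
      ∃ E : Set S, IsClopen E ∧ {s | b ≤ g s} ⊆ E ∧ E ⊆ {s | a < g s}) {E : Set S}
    (hE : MeasurableSet E) {ε : ℝ} (hε : 0 < ε) :
    ∃ A ∈ m.sets, lam (symmDiff E (χ A)) < ENNReal.ofReal ε := by
  have := h.probability
  have := h.compact
  have := h.hausdorff
  have := h.borel
  have := h.regular
  have hε3 : 0 < ε / 3 := by linarith
  have hε3' : ENNReal.ofReal (ε / 3) ≠ 0 := by simpa using hε3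
  obtain ⟨K, hKE, hK, hEK⟩ := hE.exists_isCompact_sdiff_lt (measure_ne_top lam E) hε3'
  obtain ⟨V, hEV, hV, -, hVE⟩ := hE.exists_isOpen_sdiff_lt (measure_ne_top lam E) hε3'
  obtain ⟨g, hg0, hg1, -⟩ := exists_continuous_zero_one_of_isClosed hV.isClosed_compl
    hK.isClosed (Set.disjoint_compl_left_iff_subset.2 (hKE.trans hEV))
  obtain ⟨C, hC, hKC, hCV⟩ := hsep g 0 1 one_pos
  obtain ⟨A, hA, hCA⟩ := h.exists_approx_clopen hC hε3
  refine ⟨A, hA, ?_⟩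
  have hsub : symmDiff E (χ A) ⊆ (E \ K ∪ V \ E) ∪ symmDiff C (χ A) := by
    intro s hs
    have h1 : s ∈ K → s ∈ C := fun hsK => hKC (hg1 hsK).ge
    have h2 : s ∈ C → s ∈ V := fun hsC => by
      by_contra hsV
      exact (hCV hsC).ne' (hg0 hsV)
    simp only [Set.mem_symmDiff, Set.mem_union, Set.mem_sdiff] at hs ⊢
    tauto
  refine (measure_mono hsub).trans_lt ((measure_union_le _ _).trans_lt ?_)
  have h3 : ENNReal.ofReal ε =
      ENNReal.ofReal (ε / 3) + ENNReal.ofReal (ε / 3) + ENNReal.ofReal (ε / 3) := by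
    rw [← ENNReal.ofReal_add hε3.le hε3.le, ← ENNReal.ofReal_add (by linarith) hε3.le]
    congr 1
    ring
  rw [h3]
  exact ENNReal.add_lt_add ((measure_union_le _ _).trans_lt (ENNReal.add_lt_add hEK hVE)) hCA

/-- The dominating density is `w = T(‖·‖)`, from `|φ x| ≤ ‖φ‖ ‖x‖`. The Pettis integral over `A`
represents the integrals over `χ A`, and approximation extends this to Borel sets. -/
theorem exists_bochner.{w} {Ω : Type u} {X : Type v} [NormedAddCommGroup X]
    [NormedSpace ℝ X] [CompleteSpace X] {S : Type w} [TopologicalSpace S] [MeasurableSpace S]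
    {m : FinAddProb Ω} {f : Ω → X} {χ : Set Ω → Set S} {lam : Measure S}
    {T : (Ω × X → ℝ) → Lp ℝ 1 lam} {U : (Ω × X → ℝ) → C(S, ℝ)} (hX : HasRNP.{w, v} X)
    (h : IsAbstractStandardRep m f χ lam T U)
    (hsep : ∀ (g : C(S, ℝ)) (a b : ℝ), a < b →
      ∃ E : Set S, IsClopen E ∧ {s | b ≤ g s} ⊆ E ∧ E ⊆ {s | a < g s})
    (hf : m.NormIntegrable f) (hw : m.WeaklyIntegrable f) (hP : m.PettisIntegrable f) :
    ∃ ft : S → X, Integrable ft lam ∧ ∀ φ : StrongDual ℝ X,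
      (fun s => φ (ft s)) =ᵐ[lam] T fun p => φ p.2 := by
  have := h.probability
  have hn := hf.norm_mem_la
  have hφ := hw.dual_mem_la
  obtain ⟨w, hw⟩ : ∃ w : S → ℝ, w = T fun p => ‖p.2‖ := ⟨_, rfl⟩
  obtain ⟨u, hu⟩ : ∃ u : StrongDual ℝ X → S → ℝ, ∀ φ, u φ = T fun p => φ p.2 :=
    ⟨fun φ => T fun p => φ p.2, fun _ => rfl⟩
  have hw1 : Integrable w lam := hw ▸ L1.integrable_coeFn _
  have hu1 : ∀ φ, Integrable (u φ) lam := fun φ => hu φ ▸ L1.integrable_coeFn _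
  have hw0 : ∀ᵐ s ∂lam, 0 ≤ w s := by
    rw [hw]
    filter_upwards [h.ae_abs_le (c := 1) hn hn fun p => by rw [abs_norm, one_mul]] with s hs
    rw [one_mul] at hs
    exact (abs_nonneg _).trans hs
  have hle : ∀ φ, ∀ᵐ s ∂lam, |u φ s| ≤ ‖φ‖ * w s := fun φ => by
    rw [hw, hu]
    exact h.ae_abs_le (hφ φ) hn fun p => φ.le_opNorm p.2
  have hex : ∀ E, MeasurableSet E → ∃ x : X, ∀ φ : StrongDual ℝ X, φ x = ∫ s in E, u φ s ∂lam := by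
    refine fun E hE => exists_forall_dual_of_approx hw1 hw0 hu1 hle hE fun ε hε => ?_
    obtain ⟨A, hA, hlt⟩ := h.exists_approx hsep hE hε
    obtain ⟨x, hx⟩ := hP A hA
    refine ⟨χ A, h.measurableSet_chi (mem_completion_of_mem hA), hlt, x, fun φ => ?_⟩
    have h1 := h.integral_eq A hA _ (hφ φ)
    rw [← hu] at h1
    exact (hx φ).unique h1
  obtain ⟨g, hg, hgu⟩ := hX.exists_density hw1 hw0 hu1 hle hex
  exact ⟨g, hg, fun φ => hu φ ▸ hgu φ⟩

/-- Let `β` of finitely many functionals approximate `k` uniformly within `1 / (j + 1)`. The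
inequality passes through `T` and also holds at `ft s`, where both bounds involve the same value of
`β`; hence the factor `2`. -/
theorem ae_eq_of_weakUnif (h : IsAbstractStandardRep m f χ lam T U)
    (hw : m.WeaklyIntegrable f) {ft : S → X}
    (hft : ∀ φ : StrongDual ℝ X, (fun s => φ (ft s)) =ᵐ[lam] T fun p => φ p.2)
    {k : X → ℝ} (hk : k ∈ weakUnifLa m f) : T (fun p => k p.2) =ᵐ[lam] fun s => k (ft s) := by
  have key : ∀ j : ℕ, ∀ᵐ s ∂lam, |T (fun p => k p.2) s - k (ft s)| ≤ 2 * (1 / (j + 1)) := by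
    intro j
    obtain ⟨n, φ, β, hβ⟩ := exists_continuous_approx hk.1 (Nat.one_div_pos_of_nat (n := j) (α := ℝ))
    have h1 := h.ae_nonpos_of_forall (n := n + 1)
      (H := Fin.cons (fun p => k p.2) fun i p => φ i p.2)
      (Fin.forall_fin_succ.2 ⟨hk.2, fun i => hw (φ i)⟩)
      (β := fun y => |y 0 - β fun i => y i.succ| - 1 / (j + 1)) (by fun_prop)
      (fun p => by simpa using hβ p.2)
    filter_upwards [h1, ae_all_iff.2 fun i => hft (φ i)] with s h2 h3
    simp only [Fin.cons_zero, Fin.cons_succ] at h2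
    simp only [← h3] at h2
    have h4 := abs_sub_le (T (fun p => k p.2) s) (β fun i => φ i (ft s)) (k (ft s))
    rw [abs_sub_comm (β fun i => φ i (ft s))] at h4
    linarith [hβ (ft s)]
  filter_upwards [ae_all_iff.2 key] with s hs
  have hlim := (tendsto_one_div_add_atTop_nhds_zero_nat (𝕜 := ℝ)).const_mul 2
  rw [mul_zero] at hlim
  have := ge_of_tendsto' hlim hs
  rw [← sub_eq_zero, ← abs_eq_zero]
  exact le_antisymm this (abs_nonneg _)

/-- Each point outside the weak closure has a norm neighborhood that `ft` a.e. avoids on `χ A`. The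
essential range of `ft` is separable, so the part of it to be excluded is Lindelöf and countably
many neighborhoods cover it. -/
theorem ae_mem_weakClosure (h : IsAbstractStandardRep m f χ lam T U)
    (hw : m.WeaklyIntegrable f) {ft : S → X} (hft : Integrable ft lam)
    (hT : ∀ k ∈ weakUnifLa m f, T (fun p => k p.2) =ᵐ[lam] fun s => k (ft s))
    (hA : A ∈ m.completion) :
    ∀ᵐ s ∂lam, s ∈ χ A → ft s ∈ weakClosure (f '' A) := by
  classical
  obtain ⟨t, ht, hft_t⟩ := hft.aestronglyMeasurable.isSeparable_ae_range
  let W : Set X := t \ weakClosure (f '' A)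
  have hW : ∀ x : X, ∃ N ∈ 𝓝 x, x ∉ weakClosure (f '' A) → ∀ᵐ s ∂lam, s ∈ χ A → ft s ∉ N := by
    intro x
    by_cases hx : x ∈ weakClosure (f '' A)
    · exact ⟨Set.univ, univ_mem, fun hx' => absurd hx hx'⟩
    obtain ⟨n, φ, δ, hδ, hφ⟩ := exists_of_notMem_weakClosure hx
    let y₀ : Fin n → ℝ := fun i => φ i x
    -- A tent of height and radius `δ`: positive at the image of `x`, zero on the images of `f ''
    -- A`, bounded and Lipschitz, so that `k` lies in `weakUnifLa m f`.
    let α : (Fin n → ℝ) → ℝ := fun y => max 0 (δ - dist y y₀)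
    have hαlip : LipschitzWith 1 α := by
      refine LipschitzWith.of_dist_le_mul fun y z => ?_
      rw [NNReal.coe_one, one_mul, Real.dist_eq]
      refine (abs_max_sub_max_le_max _ _ _ _).trans (max_le (by simp) ?_)
      rw [sub_sub_sub_cancel_left, abs_sub_comm]
      exact abs_dist_sub_le _ _ _
    have hαbdd : ∀ y, |α y| ≤ δ := fun y => by
      rw [abs_of_nonneg (le_max_left _ _)]
      exact max_le hδ.le (by linarith [dist_nonneg (x := y) (y := y₀)])
    let k : X → ℝ := fun z => α fun i => φ i z
    have hkint : (fun p : Ω × X => k p.2) ∈ m.La f :=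
      isIntegrable_comp (u := fun i ω => φ i (f ω)) hαlip.continuous hαbdd fun i => hw (φ i)
    have hk : k ∈ weakUnifLa m f :=
      ⟨weakUniformContinuous_comp φ hαlip.uniformContinuous, hkint⟩
    have hnull : m.IsNullOn A fun ω => k (f ω) := by
      rw [FinAddProb.isNullOn_iff]
      have : (A.indicator fun ω => k (f ω)) = 0 := by
        ext ω
        by_cases hω : ω ∈ A
        · rw [Set.indicator_of_mem hω]
          have := not_lt.1 (hφ (f ω) ⟨ω, hω, rfl⟩)
          exact max_eq_left (by linarith)
        · rw [Set.indicator_of_notMem hω]; rfl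
      rw [this, upperNorm_zero]
    refine ⟨{z | 0 < k z}, ?_, fun _ => ?_⟩
    · have hcont : Continuous k :=
        hαlip.continuous.comp (continuous_pi fun i => (φ i).continuous)
      refine (isOpen_lt continuous_const hcont).mem_nhds ?_
      have : k x = δ := by simp [k, α, y₀, hδ.le]
      simp [this, hδ]
    · filter_upwards [(h.null_iff A hA _ hkint).1 hnull, hT k hk] with s h1 h2 hs
      rw [← h2, h1 hs]
      exact lt_irrefl 0
  choose N hN hN' using hW
  have hWsep : TopologicalSpace.IsSeparable W := ht.mono Set.sdiff_subset
  have := hWsep.secondCountableTopology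
  obtain ⟨I, hI, hIW, hcover⟩ := (IsLindelof.of_coe (s := W)).elim_nhds_subcover N
    fun x _ => hN x
  filter_upwards [hft_t, (ae_ball_iff hI).2 fun x hx => hN' x (hIW x hx).2] with s h1 h2 hs
  by_contra hcon
  obtain ⟨x, hx, hsx⟩ := Set.mem_iUnion₂.1 (hcover ⟨h1, hcon⟩)
  exact h2 x hx hs hsx

/-- Remove a measurable null set containing the exceptional points, then exhaust the remainder of `χ
A` up to measure zero by compact sets. -/
theorem exists_isClosed_iUnion (h : IsAbstractStandardRep m f χ lam T U)
    (hA : A ∈ m.completion) {P : S → Prop} (hP : ∀ᵐ s ∂lam, s ∈ χ A → P s) :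
    ∃ K : ℕ → Set S, (∀ n, IsClosed (K n) ∧ K n ⊆ χ A) ∧ lam (χ A \ ⋃ n, K n) = 0 ∧
      ∀ s ∈ ⋃ n, K n, P s := by
  have := h.probability
  have := h.hausdorff
  have := h.borel
  have := h.regular
  obtain ⟨D, hD, hDm, hDae⟩ := exists_measurable_superset_of_null hP
  have hE : MeasurableSet (χ A \ D) := (h.measurableSet_chi hA).diff hDm
  choose K hKE hK hlt using fun n : ℕ => hE.exists_isCompact_sdiff_lt (measure_ne_top lam _)
    (ε := ENNReal.ofReal (1 / (n + 1))) (by simp; positivity)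
  refine ⟨K, fun n => ⟨(hK n).isClosed, (hKE n).trans Set.sdiff_subset⟩, ?_, fun s hs => ?_⟩
  · have h1 : lam ((χ A \ D) \ ⋃ n, K n) = 0 := by
      refine le_antisymm (ge_of_tendsto' (f := fun n : ℕ => ENNReal.ofReal (1 / ((n : ℝ) + 1)))
        (x := atTop) ?_ fun n => ?_) zero_le
      · have := ENNReal.tendsto_ofReal (tendsto_one_div_add_atTop_nhds_zero_nat (𝕜 := ℝ))
        rwa [ENNReal.ofReal_zero] at this
      · exact (measure_mono (Set.sdiff_subset_sdiff_right (Set.subset_iUnion K n))).trans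
          (hlt n).le
    refine measure_mono_null (t := ((χ A \ D) \ ⋃ n, K n) ∪ D) (fun s hs => ?_)
      (measure_union_null h1 hDae)
    by_cases hsD : s ∈ D
    · exact Or.inr hsD
    · exact Or.inl ⟨⟨hs.1, hsD⟩, hs.2⟩
  · obtain ⟨n, hn⟩ := Set.mem_iUnion.1 hs
    have h1 := hKE n hn
    by_contra hcon
    exact h1.2 (hD fun hP' => hcon (hP' h1.1))

end IsAbstractStandardRep

/-! ### The converse implication and the theorem -/

theorem IsStandardRep.pettisIntegrable {Ω X S : Type*} [NormedAddCommGroup X] [NormedSpace ℝ X]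
    [CompleteSpace X] [TopologicalSpace S] [MeasurableSpace S] {m : FinAddProb Ω} {f : Ω → X}
    {χ : Set Ω → Set S} {lam : Measure S} {ft : S → X} (hw : m.WeaklyIntegrable f)
    (h : IsStandardRep m f (weakUnifLa m f) χ lam ft) (hft : Integrable ft lam) :
    m.PettisIntegrable f := by
  obtain ⟨T, U, hTU, hT⟩ := h
  refine fun A hA => ⟨∫ s in χ A, ft s ∂lam, fun φ => ?_⟩
  have h1 := hTU.integral_eq A hA _ (hw.dual_mem_la φ)
  rw [integral_congr_ae (ae_restrict_of_ae (hT φ ⟨weakUniformContinuous_dual φ, hw.dual_mem_la φ⟩)),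
    ContinuousLinearMap.integral_comp_comm φ hft.integrableOn] at h1
  exact h1

end

theorem theorem6p1 {Ω : Type u} {X : Type v} [NormedAddCommGroup X] [NormedSpace ℝ X]
    [CompleteSpace X] (hX : HasRNP.{max u v, v} X) (m : FinAddProb Ω) (f : Ω → X)
    (hf : m.NormIntegrable f) (hw : m.WeaklyIntegrable f) :
    (m.PettisIntegrable f ↔
      ∃ (S : Type (max u v)) (_ : TopologicalSpace S) (_ : MeasurableSpace S)
        (χ : Set Ω → Set S) (lam : Measure S) (ft : S → X),
        IsStandardRep m f (weakUnifLa m f) χ lam ft ∧ Integrable ft lam) ∧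
    (∀ (S : Type (max u v)) [TopologicalSpace S] [MeasurableSpace S]
        (χ : Set Ω → Set S) (lam : Measure S) (ft : S → X),
        IsStandardRep m f (weakUnifLa m f) χ lam ft → Integrable ft lam →
        ∀ A ∈ m.sets,
          (∃ At : Set S, IsClosed At ∧ At ⊆ χ A ∧ lam (χ A \ At) = 0 ∧
            ∃ g : S → X, g =ᵐ[lam] ft ∧ g '' At ⊆ weakClosure (f '' A)) ∧
          (∃ K : ℕ → Set S, (∀ n, IsClosed (K n) ∧ K n ⊆ χ A) ∧ lam (χ A \ ⋃ n, K n) = 0 ∧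
            ft '' (⋃ n, K n) ⊆ weakClosure (f '' A))) := by
  classical
  refine ⟨⟨fun hP => ?_, ?_⟩, ?_⟩
  · obtain ⟨S, _, _, χ, lam, T, U, h, hsep⟩ := exists_isAbstractStandardRep m f
    obtain ⟨ft, hft, hφ⟩ := h.exists_bochner hX hsep hf hw hP
    exact ⟨S, inferInstance, inferInstance, χ, lam, ft,
      ⟨T, U, h, fun k hk => h.ae_eq_of_weakUnif hw hφ hk⟩, hft⟩
  · rintro ⟨S, _, _, χ, lam, ft, h, hft⟩
    exact h.pettisIntegrable hw hft
  · rintro S _ _ χ lam ft ⟨T, U, h, hT⟩ hft A hA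
    have hA' := FinAddProb.mem_completion_of_mem hA
    have hae := h.ae_mem_weakClosure hw hft hT hA'
    constructor
    -- For nonempty `A` the closed set can be all of `χ A`: on the exceptional null set `ft` is
    -- replaced by a value `f ω` with `ω ∈ A`. For empty `A` no such value exists, but `χ ∅` is
    -- empty.
    · rcases A.eq_empty_or_nonempty with rfl | ⟨ω, hω⟩
      · exact ⟨∅, isClosed_empty, Set.empty_subset _, by simp [h.chi_empty], ft, EventuallyEq.rfl,
          by simp⟩
      · refine ⟨χ A, (h.clopen_chi A hA').isClosed, subset_rfl, by simp,
          fun s => if s ∈ χ A → ft s ∈ weakClosure (f '' A) then ft s else f ω, ?_, ?_⟩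
        · filter_upwards [hae] with s hs
          rw [if_pos hs]
        · rintro _ ⟨s, hs, rfl⟩
          dsimp only
          split_ifs with hif
          · exact hif hs
          · exact subset_weakClosure (f '' A) (Set.mem_image_of_mem f hω)
    · obtain ⟨K, hK, hK0, hKP⟩ := h.exists_isClosed_iUnion hA' hae
      exact ⟨K, hK, hK0, by rintro _ ⟨s, hs, rfl⟩; exact hKP s hs⟩
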